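/- **Conventions.** A smooth étale groupoid $G$ has smooth manifolds $G_0$ of objects and $G_1$ of arrows, and its structure maps are local diffeomorphisms; $s,t:G_1\to G_0$ are source and target, $g_1g_2$ is the composite of $x_0\xrightarrow{g_1}x_1\xrightarrow{g_2}x_2$, and $G_2$ is the space of composable pairs. A $G$-sheaf is a sheaf on $G_0$ with a continuous right action of $G_1$. $\mathcal A^l$ is the $G$-sheaf of complex-valued smooth $l$-forms (arrows act by pull-back), $\mathbb C^\times$ the $G$-sheaf of smooth functions with values in $\mathbb C^\times$, $\mathbb Z(p)=(2\pi i)^p\mathbb Z$, and $$\mathbb C^\times(p)=\big(\mathbb C^\times\xrightarrow{d\log}\mathcal A^1\xrightarrow{d}\cdots\xrightarrow{d}\mathcal A^{p-1}\big),\qquad \mathbb Z(p)^\infty_D=\big(\mathbb Z(p)\to\mathcal A^0\xrightarrow{d}\mathcal A^1\xrightarrow{d}\cdots\xrightarrow{d}\mathcal A^{p-1}\big),$$ both starting in degree $0$. For a complex $F$ of abelian $G$-sheaves in non-negative degrees, $\mathbb H^n(G,F)$ is the $n$-th cohomology of $\Gamma_{inv}(G,T)$, the invariant sections of a quasi-isomorphic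 complex $F\to T$ of injective $G$-sheaves. By $c\cdot\mathbb H^n(G,\mathbb Z(p)^\infty_D)$ we mean the hypercohomology of the complex $c\cdot\mathbb Z(p)\to\mathcal A^0\to\cdots\to\mathcal A^{p-1}$. The exponential map $\mathcal A^0\to\mathbb C^\times$ and the identities of $\mathcal A^1,\dots,\mathcal A^{p-1}$ give a morphism from $(2\pi i)^{-p+1}\cdot\mathbb Z(p)^\infty_D$ to $\mathbb C^\times(p)[-1]$, and hence homomorphisms $$\exp:(2\pi i)^{-p+1}\cdot\mathbb H^{q+1}(G,\mathbb Z(p)^\infty_D)\to\mathbb H^{q}(G,\mathbb C^\times(p)).$$ The inertia groupoid $\wedge G$ has objects $\wedge G_0=\{a\in G_1: s(a)=t(a)\}$ and arrows $\wedge G_1=\{(a,b)\in G_2: a\in\wedge G_0\}$, where $(a,b)$ goes from $a$ to $b^{-1}ab$; $\wedge G_0$ has the smooth structure induced from $G_1$. A gerbe with connection on an étale groupoid $K$ is a triple $(h,A,B)$ with $h:K_2\to\mathbb C^\times$ smooth, $A\in A^1(K_1)$ and $B\in A^2(K_0)$ such that $$s^*B-t^*B=dA,\qquad \mathrm{pr}_2^*A-m^*A+\mathrm{pr}_1^*A=d\log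 h,\qquad \frac{h(k_2,k_3)\,h(k_1,k_2k_3)}{h(k_1k_2,k_3)\,h(k_1,k_2)}=1 .$$ A line bundle with connection on $K$ is a pair $(\rho,\nabla)$ of a smooth morphism of groupoids $\rho:K\to\mathbb C^\times$ and a form $\nabla\in A^1(K_0)$ with $s^*\nabla-t^*\nabla=d\log\rho$; it is flat if $d\nabla=0$. Let $\varphi:K\to G$ be an étale Morita morphism (for example, a Leray description of $G$): $\varphi_0$ is étale, $K_1$ is the fibre product of $K_0\times K_0$ and $G_1$ over $G_0\times G_0$, and $K_0\,{}_{\varphi_0}\!\times_t G_1\to G_0$, $(x,g)\mapsto s(g)$, is surjective. A gerbe with connection on $K$ then has a class in $\mathbb H^2(G,\mathbb C^\times(3))$, and a line bundle with connection on $K$ has a class in $\mathbb H^1(G,\mathbb C^\times(2))$, by comparison of the Čech complex of $K$ and of $\Gamma_{inv}(G,T)$ inside the double complex of sections of $T$ over the nerve of $K$. The morphism $\varphi$ induces $\wedge K\to\wedge G$, along which line bundles with connection on $\wedge K$ have classes in $\mathbb H^1(\wedge G,\mathbb C^\times(2))$. **Theorem.** Let $G$ be a smooth étale groupoid whose inertia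 groupoid $\wedge G$ is smooth. Then there are holonomy homomorphisms forming the rows of a commutative square $$\begin{array}{ccc}\mathbb H^2(G,\mathbb C^\times\xrightarrow{d\log}\mathcal A^1\xrightarrow{d}\mathcal A^2)&\xrightarrow{\ \mathrm{holo}\ }&\mathbb H^1(\wedge G,\mathbb C^\times\xrightarrow{d\log}\mathcal A^1)\\ {\scriptstyle\exp}\uparrow\cong&&{\scriptstyle\exp}\uparrow\cong\\ (2\pi i)^{-2}\cdot\mathbb H^3(G,\mathbb Z(3)^\infty_D)&\xrightarrow{\ \mathrm{holo}\ }&(2\pi i)^{-1}\cdot\mathbb H^2(\wedge G,\mathbb Z(2)^\infty_D)\end{array}$$ whose vertical maps are isomorphisms, with the following properties. 1. For every étale Morita morphism $\varphi:K\to G$ from a smooth étale groupoid $K$ and every gerbe with connection $(h,A,B)$ on $K$, the pair $$\rho(a,b)=\frac{h(a,b)}{h(b,b^{-1}ab)},\qquad \nabla=A|_{\wedge K_0}$$ is a line bundle with connection on $\wedge K$, it is flat ($d\nabla=0$), both have a unique class, and $\mathrm{holo}$ sends the class of $(h,A,B)$ to the class of $(\rho,\nabla)$. 2. All classes in the image of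 $\mathrm{holo}$ are flat: the homomorphism $\mathbb H^1(\wedge G,\mathbb C^\times\to\mathcal A^1)\to\mathbb H^1(\wedge G,\mathcal A^2[-1])=\Gamma_{inv}(\wedge G,\mathcal A^2)$ given by $d:\mathcal A^1\to\mathcal A^2$ (the curvature) vanishes on it. -/

import Mathlib

open CategoryTheory Opposite Topology TopologicalSpace
open scoped ContDiff

universe u v

namespace Holonomy

/-! ### Smooth spaces and differential forms -/

/-- The Euclidean space `ℝⁿ`. -/
abbrev Eu (n : ℕ) : Type := EuclideanSpace ℝ (Fin n)

/-- `f` is `C^∞` on a neighbourhood of `x`. -/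
def SmoothNear {m n : ℕ} (f : Eu m → Eu n) (x : Eu m) : Prop :=
  ∀ᶠ y in 𝓝 x, ContDiffAt ℝ ∞ f y

/-- A smooth structure on a topological space, given by its smooth parametrisations:
`IsSmoothAt u x` says that `u : ℝⁿ → M` is smooth on a neighbourhood of `x` (the values of `u` away
from `x` are irrelevant).  Smooth manifolds are singled out by `IsManifold` below. -/
class SmoothSpace (M : Type u) [TopologicalSpace M] where
  IsSmoothAt : ∀ {n : ℕ}, (Eu n → M) → Eu n → Prop
  continuousAt : ∀ {n : ℕ} {u : Eu n → M} {x : Eu n}, IsSmoothAt u x → ContinuousAt u x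
  eventually : ∀ {n : ℕ} {u : Eu n → M} {x : Eu n}, IsSmoothAt u x → ∀ᶠ y in 𝓝 x, IsSmoothAt u y
  congr : ∀ {n : ℕ} {u v : Eu n → M} {x : Eu n}, IsSmoothAt u x → v =ᶠ[𝓝 x] u → IsSmoothAt v x
  comp : ∀ {m n : ℕ} {u : Eu n → M} {f : Eu m → Eu n} {y : Eu m},
    IsSmoothAt u (f y) → SmoothNear f y → IsSmoothAt (u ∘ f) y

open SmoothSpace (IsSmoothAt)

/-- `M` is a smooth manifold (without boundary, components of possibly different dimensions):
every point has a chart `e` onto an open subset of some `ℝⁿ` such that a map into the domain of `e`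
is smooth iff it is so when read in the chart. -/
def IsManifold (M : Type u) [TopologicalSpace M] [SmoothSpace M] : Prop :=
  ∀ p : M, ∃ (n : ℕ) (e : OpenPartialHomeomorph M (Eu n)), p ∈ e.source ∧
    ∀ (m : ℕ) (u : Eu m → M) (x : Eu m), u x ∈ e.source →
      (IsSmoothAt u x ↔ ∀ᶠ y in 𝓝 x, ContinuousAt u y ∧ ContDiffAt ℝ ∞ (e ∘ u) y)

lemma minSmoothness_le_infty : minSmoothness ℝ 2 ≤ (∞ : WithTop ℕ∞) := by
  simp only [minSmoothness_of_isRCLikeNormedField]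
  exact WithTop.coe_le_coe.2 (le_top : (2 : ℕ∞) ≤ ⊤)

lemma SmoothNear.continuousAt {m n : ℕ} {f : Eu m → Eu n} {x : Eu m} (h : SmoothNear f x) :
    ContinuousAt f x := h.self_of_nhds.continuousAt

/-- The smooth structure on `N` induced by a map `f : N → M`: a continuous parametrisation of `N`
is smooth iff its composite with `f` is.  It is used for étale maps and for subspaces. -/
abbrev SmoothSpace.induced {M N : Type u} [TopologicalSpace M] [TopologicalSpace N] [SmoothSpace M]
    (f : N → M) : SmoothSpace N where
  IsSmoothAt u x := (∀ᶠ y in 𝓝 x, ContinuousAt u y) ∧ IsSmoothAt (f ∘ u) x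
  continuousAt h := h.1.self_of_nhds
  eventually h := h.1.eventually_nhds.and (SmoothSpace.eventually h.2)
  congr {n u v x} h huv := by
    refine ⟨?_, SmoothSpace.congr h.2 (huv.fun_comp f)⟩
    filter_upwards [h.1, huv.eventually_nhds] with y hy hy'
    exact hy.congr (Filter.EventuallyEq.symm hy')
  comp {m n u g y} h hg := by
    refine ⟨?_, SmoothSpace.comp (u := f ∘ u) h.2 hg⟩
    filter_upwards [hg.continuousAt.eventually h.1, hg] with z hz hz'
    exact ContinuousAt.comp hz hz'.continuousAt

instance {M : Type u} [TopologicalSpace M] [SmoothSpace M] (U : Opens M) : SmoothSpace U :=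
  SmoothSpace.induced Subtype.val

/-- Smooth maps between smooth spaces. -/
structure SMap (M N : Type u) [TopologicalSpace M] [SmoothSpace M] [TopologicalSpace N]
    [SmoothSpace N] where
  toFun : M → N
  continuous : Continuous toFun
  smooth : ∀ {n : ℕ} {u : Eu n → M} {x : Eu n}, IsSmoothAt u x → IsSmoothAt (toFun ∘ u) x

/-- Étale maps of smooth spaces, i.e. local diffeomorphisms: local homeomorphisms which preserve and
reflect smoothness of continuous parametrisations. -/
structure IsEtale {M N : Type u} [TopologicalSpace M] [SmoothSpace M] [TopologicalSpace N]
    [SmoothSpace N] (f : M → N) : Prop where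
  isLocalHomeomorph : IsLocalHomeomorph f
  smooth_iff : ∀ {n : ℕ} {u : Eu n → M} {x : Eu n}, (∀ᶠ y in 𝓝 x, ContinuousAt u y) →
    (IsSmoothAt (f ∘ u) x ↔ IsSmoothAt u x)

lemma IsSmoothAt.continuousNear {M : Type u} [TopologicalSpace M] [SmoothSpace M] {n : ℕ}
    {u : Eu n → M} {x : Eu n} (h : IsSmoothAt u x) : ∀ᶠ y in 𝓝 x, ContinuousAt u y :=
  (SmoothSpace.eventually h).mono fun _ hy => SmoothSpace.continuousAt hy

section Forms

variable {M N : Type u} [TopologicalSpace M] [SmoothSpace M] [TopologicalSpace N] [SmoothSpace N]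

/-- The complex-valued smooth `p`-forms on `M`.  A form `α` is the family of all its local
expressions `u^*α` in smooth parametrisations `u : ℝⁿ → M`; `α n u x` is the value of `u^*α` at `x`
(set to `0` where `u` is not smooth).  The local expressions are smooth, and compatible with smooth
reparametrisations.  On a manifold, such a family amounts to compatible expressions in charts. -/
def formSubgroup (p : ℕ) (M : Type u) [TopologicalSpace M] [SmoothSpace M] :
    AddSubgroup (∀ n : ℕ, (Eu n → M) → Eu n → (Eu n) [⋀^Fin p]→L[ℝ] ℂ) where
  carrier := {α |
    (∀ (n : ℕ) (u : Eu n → M) (x : Eu n), ¬ IsSmoothAt u x → α n u x = 0) ∧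
    (∀ (n : ℕ) (u : Eu n → M) (x : Eu n), IsSmoothAt u x → ContDiffAt ℝ ∞ (α n u) x) ∧
    (∀ (m n : ℕ) (u : Eu n → M) (v : Eu m → M) (f : Eu m → Eu n) (y : Eu m),
      IsSmoothAt u (f y) → SmoothNear f y → v =ᶠ[𝓝 y] u ∘ f →
        α m v y = (α n u (f y)).compContinuousLinearMap (fderiv ℝ f y))}
  add_mem' {a b} ha hb := by
    refine ⟨fun n u x h => ?_, fun n u x h => ?_, fun m n u v f y h hf hv => ?_⟩
    · simp [ha.1 n u x h, hb.1 n u x h]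
    · exact (ha.2.1 n u x h).add (hb.2.1 n u x h)
    · simp only [Pi.add_apply]
      rw [ha.2.2 m n u v f y h hf hv, hb.2.2 m n u v f y h hf hv]
      rfl
  zero_mem' := by
    refine ⟨fun n u x h => rfl, fun n u x h => contDiffAt_const, fun m n u v f y h hf hv => ?_⟩
    ext; simp
  neg_mem' {a} ha := by
    refine ⟨fun n u x h => ?_, fun n u x h => ?_, fun m n u v f y h hf hv => ?_⟩
    · simp [ha.1 n u x h]
    · exact (ha.2.1 n u x h).neg
    · simp only [Pi.neg_apply]
      rw [ha.2.2 m n u v f y h hf hv]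
      rfl

/-- The group of complex-valued smooth `p`-forms on `M`. -/
abbrev Form (p : ℕ) (M : Type u) [TopologicalSpace M] [SmoothSpace M] : Type u :=
  formSubgroup p M

open scoped Classical in
/-- The pull-back `f^*α` of forms along a smooth map: `u^*(f^*α) = (f ∘ u)^*α`. -/
noncomputable def Form.pull {p : ℕ} (f : SMap M N) : Form p N →+ Form p M :=
  AddMonoidHom.mk' (fun α => ⟨fun n u x => if IsSmoothAt u x then α.1 n (f.toFun ∘ u) x else 0, by
    refine ⟨fun n u x h => if_neg h, fun n u x h => ?_, fun m n u v g y h hg hv => ?_⟩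
    · refine (α.2.2.1 n _ x (f.smooth h)).congr_of_eventuallyEq ?_
      filter_upwards [SmoothSpace.eventually h] with y hy using if_pos hy
    · have h1 : IsSmoothAt v y := SmoothSpace.congr (SmoothSpace.comp h hg) hv
      simp only [if_pos h, if_pos h1]
      exact α.2.2.2 m n _ _ g y (f.smooth h) hg (hv.fun_comp f.toFun)⟩) (by
    intro a b
    apply Subtype.ext; funext n u x
    by_cases h : IsSmoothAt u x <;> simp [h])

open scoped Classical in
/-- The exterior derivative of forms: `u^*(dα) = d(u^*α)`. -/
noncomputable def Form.d {p : ℕ} : Form p M →+ Form (p + 1) M :=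
  AddMonoidHom.mk' (fun α => ⟨fun n u x => if IsSmoothAt u x then extDeriv (α.1 n u) x else 0, by
    refine ⟨fun n u x h => if_neg h, fun n u x h => ?_, fun m n u v g y h hg hv => ?_⟩
    · have h1 : ContDiffAt ℝ ∞ (fun y => extDeriv (α.1 n u) y) x := by
        have := (α.2.2.1 n u x h).fderiv_right (m := ∞) (by simp)
        exact (ContinuousAlternatingMap.alternatizeUncurryFinCLM ℝ (Eu n) ℂ).contDiff.contDiffAt.comp
          x this
      refine h1.congr_of_eventuallyEq ?_
      filter_upwards [SmoothSpace.eventually h] with y hy using if_pos hy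
    · have h1 : IsSmoothAt v y := SmoothSpace.congr (SmoothSpace.comp h hg) hv
      simp only [if_pos h, if_pos h1]
      rw [← extDeriv_pullback (r := ∞)
        ((α.2.2.1 n u _ h).differentiableAt (by simp)) hg.self_of_nhds minSmoothness_le_infty]
      apply Filter.EventuallyEq.extDeriv_eq
      filter_upwards [hg.continuousAt.eventually (SmoothSpace.eventually h), hg.eventually_nhds,
        hv.eventually_nhds] with z h1 h2 h3
      exact α.2.2.2 m n u v g z h1 h2 h3⟩) (by
    intro a b
    apply Subtype.ext; funext n u x
    by_cases h : IsSmoothAt u x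
    · simp only [if_pos h, AddSubgroup.coe_add, Pi.add_apply]
      exact extDeriv_add ((a.2.2.1 n u _ h).differentiableAt (by simp))
        ((b.2.2.1 n u _ h).differentiableAt (by simp))
    · simp [h])

lemma Form.d_d {p : ℕ} (α : Form p M) : Form.d (Form.d α) = 0 := by
  apply Subtype.ext; funext n u x
  by_cases h : IsSmoothAt u x
  · simp only [Form.d, AddMonoidHom.mk'_apply, if_pos h]
    rw [Filter.EventuallyEq.extDeriv_eq (ω₂ := extDeriv (α.1 n u))]
    · exact extDeriv_extDeriv_apply (α.2.2.1 n u x h) minSmoothness_le_infty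
    · filter_upwards [SmoothSpace.eventually h] with y hy using if_pos hy
  · simp [Form.d, h]

lemma Form.d_pull {p : ℕ} (f : SMap M N) (α : Form p N) :
    Form.d (Form.pull f α) = Form.pull f (Form.d α) := by
  apply Subtype.ext; funext n u x
  by_cases h : IsSmoothAt u x
  · simp only [Form.d, Form.pull, AddMonoidHom.mk'_apply, if_pos h, if_pos (f.smooth h)]
    apply Filter.EventuallyEq.extDeriv_eq
    filter_upwards [SmoothSpace.eventually h] with y hy using if_pos hy
  · simp [Form.d, Form.pull, h]

/-- The group `A⁰(M)` of complex-valued smooth functions on `M`. -/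
def smoothFun (M : Type u) [TopologicalSpace M] [SmoothSpace M] : AddSubgroup (M → ℂ) where
  carrier := {f | ∀ (n : ℕ) (u : Eu n → M) (x : Eu n), IsSmoothAt u x →
    ContDiffAt ℝ ∞ (fun y => f (u y)) x}
  add_mem' ha hb n u x h := (ha n u x h).add (hb n u x h)
  zero_mem' _ _ _ _ := contDiffAt_const
  neg_mem' ha n u x h := (ha n u x h).neg

/-- The group `ℂ^×(M)` of smooth functions on `M` with values in `ℂ^×`, written additively. -/
def smoothUnits (M : Type u) [TopologicalSpace M] [SmoothSpace M] :
    AddSubgroup (M → Additive ℂˣ) where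
  carrier := {f | ∀ (n : ℕ) (u : Eu n → M) (x : Eu n), IsSmoothAt u x →
    ContDiffAt ℝ ∞ (fun y => ((f (u y)).toMul : ℂ)) x}
  add_mem' ha hb n u x h := by simpa using (ha n u x h).mul (hb n u x h)
  zero_mem' _ _ _ _ := by simpa using contDiffAt_const
  neg_mem' ha n u x h := by
    have := (ha n u x h).inv (Units.ne_zero _)
    simpa only [Pi.neg_apply, toMul_neg, Units.val_inv_eq_inv_val] using! this

/-- The group of locally constant functions on `M` with values in `c · ℤ(p)`, where
`ℤ(p) = (2πi)^p · ℤ`. -/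
def latticeFun (p : ℕ) (c : ℂ) (M : Type u) [TopologicalSpace M] : AddSubgroup (M → ℂ) where
  carrier := {f | IsLocallyConstant f ∧
    ∀ x, ∃ k : ℤ, f x = c * ((2 * Real.pi * Complex.I) ^ p * k)}
  add_mem' ha hb := ⟨ha.1.add hb.1, fun x => by
    obtain ⟨k, hk⟩ := ha.2 x
    obtain ⟨l, hl⟩ := hb.2 x
    exact ⟨k + l, by simp only [Pi.add_apply, hk, hl]; push_cast; ring⟩⟩
  zero_mem' := ⟨IsLocallyConstant.const 0, fun x => ⟨0, by simp⟩⟩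
  neg_mem' ha := ⟨ha.1.neg, fun x => by
    obtain ⟨k, hk⟩ := ha.2 x
    exact ⟨-k, by simp only [Pi.neg_apply, hk]; push_cast; ring⟩⟩

lemma latticeFun_le (p : ℕ) (c : ℂ) (M : Type u) [TopologicalSpace M] [SmoothSpace M] :
    latticeFun p c M ≤ smoothFun M := by
  intro f hf n u x h
  have : ∀ᶠ y in 𝓝 x, f (u y) = f (u x) :=
    (SmoothSpace.continuousAt h).eventually (hf.1.eventually_eq (u x))
  exact contDiffAt_const.congr_of_eventuallyEq this

/-- The inclusion of locally constant `c · ℤ(p)`-valued functions into the smooth functions. -/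
def latticeIncl (p : ℕ) (c : ℂ) : latticeFun p c M →+ smoothFun M :=
  AddSubgroup.inclusion (latticeFun_le p c M)

open scoped Classical in
/-- The differential `d : A⁰ → A¹` of smooth functions: `u^*(df) = d(f ∘ u)`. -/
noncomputable def d0 : smoothFun M →+ Form 1 M :=
  AddMonoidHom.mk' (fun f => ⟨fun n u x => if IsSmoothAt u x then
      ContinuousAlternatingMap.ofSubsingleton ℝ (Eu n) ℂ (0 : Fin 1)
        (fderiv ℝ (fun y => f.1 (u y)) x) else 0, by
    refine ⟨fun n u x h => if_neg h, fun n u x h => ?_, fun m n u v g y h hg hv => ?_⟩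
    · have := ((f.2 n u x h).fderiv_right (m := ∞) (by simp))
      have h1 := (ContinuousAlternatingMap.ofSubsingletonLIE (𝕜 := ℝ) (E := Eu n) (F := ℂ) (0 : Fin 1)).contDiff.contDiffAt.comp x this
      refine h1.congr_of_eventuallyEq ?_
      filter_upwards [SmoothSpace.eventually h] with y hy using if_pos hy
    · have h1 : IsSmoothAt v y := SmoothSpace.congr (SmoothSpace.comp h hg) hv
      simp only [if_pos h, if_pos h1]
      have h2 : (fun y => f.1 (v y)) =ᶠ[𝓝 y] (fun y => f.1 (u y)) ∘ g := hv.fun_comp f.1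
      rw [h2.fderiv_eq, fderiv_comp y ((f.2 n u _ h).differentiableAt (by simp))
        (hg.self_of_nhds.differentiableAt (by simp))]
      ext; simp⟩) (by
    intro a b
    apply Subtype.ext; funext n u x
    by_cases h : IsSmoothAt u x
    · simp only [if_pos h, AddSubgroup.coe_add, Pi.add_apply]
      rw [fderiv_fun_add ((a.2 n u _ h).differentiableAt (by simp))
        ((b.2 n u _ h).differentiableAt (by simp))]
      ext; simp
    · simp [h])

open scoped Classical in
/-- The logarithmic differential `d log : ℂ^× → A¹`: `u^*(d log f) = (f ∘ u)⁻¹ d(f ∘ u)`. -/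
noncomputable def dlog : smoothUnits M →+ Form 1 M :=
  AddMonoidHom.mk' (fun f => ⟨fun n u x => if IsSmoothAt u x then
      ((f.1 (u x)).toMul : ℂ)⁻¹ • ContinuousAlternatingMap.ofSubsingleton ℝ (Eu n) ℂ (0 : Fin 1)
        (fderiv ℝ (fun y => ((f.1 (u y)).toMul : ℂ)) x) else 0, by
    refine ⟨fun n u x h => if_neg h, fun n u x h => ?_, fun m n u v g y h hg hv => ?_⟩
    · have := ((f.2 n u x h).fderiv_right (m := ∞) (by simp))
      have h1 := (ContinuousAlternatingMap.ofSubsingletonLIE (𝕜 := ℝ) (E := Eu n) (F := ℂ) (0 : Fin 1)).contDiff.contDiffAt.comp x this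
      refine (((f.2 n u x h).inv (Units.ne_zero _)).smul h1).congr_of_eventuallyEq ?_
      filter_upwards [SmoothSpace.eventually h] with y hy using if_pos hy
    · have h1 : IsSmoothAt v y := SmoothSpace.congr (SmoothSpace.comp h hg) hv
      simp only [if_pos h, if_pos h1]
      have h2 : (fun y => ((f.1 (v y)).toMul : ℂ)) =ᶠ[𝓝 y]
        (fun y => ((f.1 (u y)).toMul : ℂ)) ∘ g := hv.fun_comp fun z => ((f.1 z).toMul : ℂ)
      have h3 := h2.self_of_nhds
      simp only [Function.comp_apply] at h3
      rw [h2.fderiv_eq, h3, fderiv_comp y ((f.2 n u _ h).differentiableAt (by simp))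
        (hg.self_of_nhds.differentiableAt (by simp))]
      ext; simp⟩) (by
    intro a b
    apply Subtype.ext; funext n u x
    by_cases h : IsSmoothAt u x
    · simp only [if_pos h, AddSubgroup.coe_add, Pi.add_apply, toMul_add, Units.val_mul]
      rw [fderiv_fun_mul ((a.2 n u _ h).differentiableAt (by simp))
        ((b.2 n u _ h).differentiableAt (by simp))]
      ext v
      simp
      field_simp
      ring
    · simp [h])

/-- The exponential map `A⁰ → ℂ^×`. -/
noncomputable def expFun : smoothFun M →+ smoothUnits M :=
  AddMonoidHom.mk' (fun f => ⟨fun x => Additive.ofMul (Units.mk0 _ (Complex.exp_ne_zero (f.1 x))),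
    fun n u x h => (f.2 n u x h).cexp⟩) (by
    intro a b
    apply Subtype.ext; funext x
    apply Additive.toMul.injective
    ext
    simp [Complex.exp_add])

lemma d_d0 (f : smoothFun M) : Form.d (d0 f) = 0 := by
  apply Subtype.ext; funext n u x
  by_cases h : IsSmoothAt u x
  · simp only [Form.d, AddMonoidHom.mk'_apply, if_pos h]
    rw [Filter.EventuallyEq.extDeriv_eq (ω₂ := extDeriv
      (fun y => ContinuousAlternatingMap.constOfIsEmpty ℝ (Eu n) (Fin 0) (f.1 (u y))))]
    · refine extDeriv_extDeriv_apply (r := ∞) ?_ minSmoothness_le_infty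
      exact (ContinuousAlternatingMap.constOfIsEmptyLIE ℝ (Eu n) ℂ
        (Fin 0)).contDiff.contDiffAt.comp x (f.2 n u x h)
    · filter_upwards [SmoothSpace.eventually h] with y hy
      rw [extDeriv_constOfIsEmpty]
      simp only [d0, AddMonoidHom.mk'_apply, if_pos hy]
  · simp [Form.d, h]

lemma dlog_expFun (f : smoothFun M) : dlog (expFun f) = d0 f := by
  apply Subtype.ext; funext n u x
  by_cases h : IsSmoothAt u x
  · have := ((f.2 n u x h).differentiableAt (by simp)).hasFDerivAt.cexp.fderiv
    simp only [d0, dlog, AddMonoidHom.mk'_apply, if_pos h]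
    simp only [expFun, AddMonoidHom.mk'_apply, toMul_ofMul, Units.val_mk0]
    rw [this]
    ext v
    simp
  · simp [d0, dlog, h]

lemma d_dlog (f : smoothUnits M) : Form.d (dlog f) = 0 := by
  apply Subtype.ext; funext n u x
  by_cases h : IsSmoothAt u x
  · simp only [Form.d, AddMonoidHom.mk'_apply, if_pos h]
    -- near `x`, the form `d log f` is the differential of `log (f / f(u x))`
    set c : ℂ := ((f.1 (u x)).toMul : ℂ) with hc
    have hc0 : c ≠ 0 := Units.ne_zero _
    have hs : ∀ᶠ y in 𝓝 x, ((f.1 (u y)).toMul : ℂ) / c ∈ Complex.slitPlane := by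
      have : ContinuousAt (fun y => ((f.1 (u y)).toMul : ℂ) / c) x :=
        (f.2 n u x h).continuousAt.div_const c
      refine this.eventually (Complex.isOpen_slitPlane.mem_nhds ?_)
      change c / c ∈ _
      rw [div_self hc0]
      exact Complex.one_mem_slitPlane
    rw [Filter.EventuallyEq.extDeriv_eq (ω₂ := extDeriv
      (fun y => ContinuousAlternatingMap.constOfIsEmpty ℝ (Eu n) (Fin 0)
        (Complex.log (((f.1 (u y)).toMul : ℂ) / c))))]
    · refine extDeriv_extDeriv_apply (r := ∞) ?_ minSmoothness_le_infty
      refine (ContinuousAlternatingMap.constOfIsEmptyLIE ℝ (Eu n) ℂ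
        (Fin 0)).contDiff.contDiffAt.comp x ?_
      exact ((Complex.contDiffAt_log hs.self_of_nhds).restrict_scalars ℝ).comp x
        ((f.2 n u x h).div_const c)
    · filter_upwards [SmoothSpace.eventually h, hs] with y hy hy'
      rw [extDeriv_constOfIsEmpty]
      simp only [dlog, AddMonoidHom.mk'_apply, if_pos hy]
      have h1 := ((f.2 n u y hy).differentiableAt (by simp)).hasFDerivAt.mul_const c⁻¹
      simp only [← div_eq_mul_inv] at h1
      replace h1 := (Complex.hasStrictFDerivAt_log_real hy').hasFDerivAt.comp y h1
      rw [show fderiv ℝ (fun y => Complex.log (((f.1 (u y)).toMul : ℂ) / c)) y = _ from h1.fderiv]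
      ext v
      simp
      field_simp
  · simp [Form.d, h]

lemma d0_latticeIncl (p : ℕ) (c : ℂ) (f : latticeFun p c M) : d0 (latticeIncl p c f) = 0 := by
  apply Subtype.ext; funext n u x
  by_cases h : IsSmoothAt u x
  · simp only [d0, AddMonoidHom.mk'_apply, if_pos h]
    have : (fun y => f.1 (u y)) =ᶠ[𝓝 x] fun _ => f.1 (u x) :=
      (SmoothSpace.continuousAt h).eventually (f.2.1.eventually_eq (u x))
    simp only [latticeIncl, AddSubgroup.coe_inclusion]
    rw [this.fderiv_eq]
    ext; simp
  · simp [d0, h]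

end Forms


/-- The pull-back of smooth functions along a smooth map. -/
def smoothFun.pull {M N : Type u} [TopologicalSpace M] [SmoothSpace M] [TopologicalSpace N]
    [SmoothSpace N] (f : SMap M N) : smoothFun N →+ smoothFun M :=
  AddMonoidHom.mk' (fun a => ⟨fun x => a.1 (f.toFun x), fun n _ x h =>
    a.2 n _ x (f.smooth h)⟩) fun _ _ => rfl

/-- The pull-back of smooth `ℂ^×`-valued functions along a smooth map. -/
def smoothUnits.pull {M N : Type u} [TopologicalSpace M] [SmoothSpace M] [TopologicalSpace N]
    [SmoothSpace N] (f : SMap M N) : smoothUnits N →+ smoothUnits M :=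
  AddMonoidHom.mk' (fun a => ⟨fun x => a.1 (f.toFun x), fun n _ x h =>
    a.2 n _ x (f.smooth h)⟩) fun _ _ => rfl

/-! ### Étale groupoids -/

/-- An étale groupoid in smooth spaces: spaces of objects and of arrows, and structure maps
satisfying the axioms of a groupoid, which are continuous, and such that the source and target maps
are étale (the other structure maps are then étale, too).
The composite of `x --g--> y --h--> z` is written `mul g h`.
It is a smooth étale groupoid in the usual sense iff `IsSmooth` below holds. -/
structure EtaleGroupoid where
  Obj : Type u
  Arr : Type u
  [topObj : TopologicalSpace Obj]
  [topArr : TopologicalSpace Arr]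
  [smObj : SmoothSpace Obj]
  [smArr : SmoothSpace Arr]
  src : Arr → Obj
  tgt : Arr → Obj
  one : Obj → Arr
  inv : Arr → Arr
  mul : ∀ g h : Arr, tgt g = src h → Arr
  src_one : ∀ x, src (one x) = x
  tgt_one : ∀ x, tgt (one x) = x
  src_inv : ∀ g, src (inv g) = tgt g
  tgt_inv : ∀ g, tgt (inv g) = src g
  src_mul : ∀ g h p, src (mul g h p) = src g
  tgt_mul : ∀ g h p, tgt (mul g h p) = tgt h
  one_mul : ∀ g, mul (one (src g)) g (tgt_one _) = g
  mul_one : ∀ g, mul g (one (tgt g)) (src_one _).symm = g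
  inv_mul : ∀ g, mul (inv g) g (tgt_inv g) = one (tgt g)
  mul_inv : ∀ g, mul g (inv g) (src_inv g).symm = one (src g)
  mul_assoc : ∀ g h k p q,
    mul (mul g h p) k ((tgt_mul g h p).trans q) = mul g (mul h k q) (p.trans (src_mul h k q).symm)
  continuous_one : Continuous one
  continuous_inv : Continuous inv
  continuous_mul : Continuous fun p : {p : Arr × Arr // tgt p.1 = src p.2} => mul p.1.1 p.1.2 p.2
  etale_src : IsEtale src
  etale_tgt : IsEtale tgt

namespace EtaleGroupoid

attribute [instance] topObj topArr smObj smArr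

variable (G : EtaleGroupoid.{u})

/-- `G` is a smooth étale groupoid: its space of objects is a smooth manifold (hence so are the
space of arrows, and all the spaces of composable arrows, which are étale over it). -/
def IsSmooth : Prop := IsManifold G.Obj

variable {G}

lemma mul_congr {g g' h h' : G.Arr} {p : G.tgt g = G.src h} (hg : g = g') (hh : h = h') :
    G.mul g h p = G.mul g' h' (by rw [← hg, ← hh, p]) := by
  subst hg hh; rfl

lemma one_mul' {x : G.Obj} {g : G.Arr} (p : G.tgt (G.one x) = G.src g) :
    G.mul (G.one x) g p = g := by
  have : x = G.src g := (G.tgt_one x).symm.trans p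
  subst this
  exact G.one_mul g

lemma mul_one' {x : G.Obj} {g : G.Arr} (p : G.tgt g = G.src (G.one x)) :
    G.mul g (G.one x) p = g := by
  have : x = G.tgt g := ((G.src_one x).symm.trans p.symm)
  subst this
  exact G.mul_one g

end EtaleGroupoid

/-! ### Étale spaces over a groupoid, the site of a groupoid -/

/-- A space with an étale map to the space of objects of `G`. -/
structure EtSp (G : EtaleGroupoid.{u}) where
  carrier : Type u
  [top : TopologicalSpace carrier]
  [sm : SmoothSpace carrier]
  proj : carrier → G.Obj
  etale : IsEtale proj

namespace EtSp

attribute [instance] top sm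

variable {G : EtaleGroupoid.{u}}

instance : CoeSort (EtSp G) (Type u) := ⟨carrier⟩

/-- A morphism `E ⟶ E'` of spaces étale over `G`: a continuous map `f : E → E'` together with a
continuous choice of an arrow from the projection of `f e` to the projection of `e`. -/
@[ext]
structure Hom (E E' : EtSp G) where
  map : E → E'
  arr : E → G.Arr
  continuous_map : Continuous map
  continuous_arr : Continuous arr
  src_arr : ∀ e, G.src (arr e) = E'.proj (map e)
  tgt_arr : ∀ e, G.tgt (arr e) = E.proj e

instance : Category.{u} (EtSp G) where
  Hom := Hom
  id E :=
    { map := id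
      arr := fun e => G.one (E.proj e)
      continuous_map := continuous_id
      continuous_arr := G.continuous_one.comp E.etale.isLocalHomeomorph.continuous
      src_arr := fun _ => G.src_one _
      tgt_arr := fun _ => G.tgt_one _ }
  comp f g :=
    { map := fun e => g.map (f.map e)
      arr := fun e => G.mul (g.arr (f.map e)) (f.arr e) ((g.tgt_arr _).trans (f.src_arr e).symm)
      continuous_map := g.continuous_map.comp f.continuous_map
      continuous_arr := G.continuous_mul.comp
        (((g.continuous_arr.comp f.continuous_map).prodMk f.continuous_arr).subtype_mk
          fun e => (g.tgt_arr _).trans (f.src_arr e).symm)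
      src_arr := fun _ => (G.src_mul _ _ _).trans (g.src_arr _)
      tgt_arr := fun _ => (G.tgt_mul _ _ _).trans (f.tgt_arr _) }
  id_comp _ := Hom.ext rfl (funext fun _ => EtaleGroupoid.mul_one' _)
  comp_id _ := Hom.ext rfl (funext fun _ => EtaleGroupoid.one_mul' _)
  assoc _ _ _ := Hom.ext rfl (funext fun _ => (G.mul_assoc _ _ _ _ _).symm)

@[ext] lemma hom_ext {E E' : EtSp G} {f g : E ⟶ E'} (h : f.map = g.map) (h' : f.arr = g.arr) :
    f = g := Hom.ext h h'

@[simp] lemma comp_map {E E' E'' : EtSp G} (f : E ⟶ E') (g : E' ⟶ E'') (e : E) :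
    (f ≫ g).map e = g.map (f.map e) := rfl

lemma comp_arr {E E' E'' : EtSp G} (f : E ⟶ E') (g : E' ⟶ E'') (e : E) :
    (f ≫ g).arr e = G.mul (g.arr (f.map e)) (f.arr e) ((g.tgt_arr _).trans (f.src_arr e).symm) :=
  rfl

/-- The map underlying a morphism is smooth. -/
def smap {E E' : EtSp G} (f : E ⟶ E') : SMap E E' where
  toFun := f.map
  continuous := f.continuous_map
  smooth {n u x} h := by
    have h0 : ∀ᶠ y in 𝓝 x, ContinuousAt (f.arr ∘ u) y :=
      (IsSmoothAt.continuousNear h).mono fun _ hy => f.continuous_arr.continuousAt.comp hy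
    have h0' : ∀ᶠ y in 𝓝 x, ContinuousAt (f.map ∘ u) y :=
      (IsSmoothAt.continuousNear h).mono fun _ hy => f.continuous_map.continuousAt.comp hy
    have h1 : IsSmoothAt (E.proj ∘ u) x := (E.etale.smooth_iff (IsSmoothAt.continuousNear h)).2 h
    have h2 : IsSmoothAt (f.arr ∘ u) x := by
      refine (G.etale_tgt.smooth_iff h0).1 ?_
      convert! h1 using 1
      exact funext fun y => f.tgt_arr _
    have h3 := (G.etale_src.smooth_iff h0).2 h2
    refine (E'.etale.smooth_iff h0').1 ?_
    convert! h3 using 1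
    exact funext fun y => (f.src_arr _).symm

end EtSp

section Site

variable (G : EtaleGroupoid.{u})

lemma isEtale_opens {M : Type u} [TopologicalSpace M] [SmoothSpace M] (U : Opens M) :
    IsEtale (Subtype.val : U → M) where
  isLocalHomeomorph := U.isOpen.isOpenEmbedding_subtypeVal.isLocalHomeomorph
  smooth_iff h := ⟨fun h' => ⟨h, h'⟩, fun h' => h'.2⟩

/-- An open subset of the space of objects, as a space étale over `G`. -/
def openSp (U : Opens G.Obj) : EtSp G where
  carrier := U
  proj := Subtype.val
  etale := isEtale_opens U

/-- The site of `G`: its objects are the open subsets of the space of objects, its morphisms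
`U ⟶ V` are the continuous families of arrows from points of `V` to the points of `U`. -/
abbrev Site : Type u := InducedCategory (EtSp G) (openSp G)

variable {G}

/-- An open subset, as an object of the site. -/
abbrev st (U : Opens G.Obj) : Site G := U

/-- An object of the site, as an open subset. -/
abbrev Site.opens (U : Site G) : Opens G.Obj := U

/-- The inclusion of open subsets, as a morphism in the site of `G` (given by unit arrows). -/
def incl {U V : Opens G.Obj} (h : U ≤ V) :
    (st U) ⟶ (st V) :=
  InducedCategory.homMk
    { map := fun x => ⟨x.1, h x.2⟩
      arr := fun x => G.one x.1
      continuous_map := by exact continuous_subtype_val.subtype_mk _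
      continuous_arr := G.continuous_one.comp continuous_subtype_val
      src_arr := fun _ => G.src_one _
      tgt_arr := fun _ => G.tgt_one _ }

lemma incl_comp {U V W : Opens G.Obj} (h : U ≤ V) (h' : V ≤ W) :
    incl h ≫ incl h' = incl (h.trans h') := by
  apply InducedCategory.hom_ext
  exact EtSp.hom_ext rfl (funext fun _ => EtaleGroupoid.mul_one' _)

lemma incl_refl {U : Opens G.Obj} : incl (le_refl U) = 𝟙 (st U) := rfl

/-- A morphism of the site maps a smaller open set to a given open neighbourhood. -/
lemma exists_incl_comp {U V : Site G} (f : V ⟶ U) (W : Opens G.Obj) (hW : W ≤ U)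
    (x : (Site.opens V)) (hx : (f.hom.map x).1 ∈ W) :
    ∃ (V' : Opens G.Obj) (h : V' ≤ V) (g : (st V') ⟶ (st W)),
      x.1 ∈ V' ∧ incl h ≫ f = g ≫ incl hW := by
  let V' : Opens G.Obj := ⟨Subtype.val '' {y : (Site.opens V) | (f.hom.map y).1 ∈ W},
    (Site.opens V).isOpen.isOpenMap_subtype_val _
      (W.isOpen.preimage (continuous_subtype_val.comp f.hom.continuous_map))⟩
  have hV' : V' ≤ V := by rintro _ ⟨y, _, rfl⟩; exact y.2
  have hm : ∀ y : V', (f.hom.map ⟨y.1, hV' y.2⟩).1 ∈ W := by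
    rintro ⟨_, y, hy, rfl⟩; exact hy
  refine ⟨V', hV', InducedCategory.homMk
    { map := fun y => ⟨(f.hom.map ⟨y.1, hV' y.2⟩).1, hm y⟩
      arr := fun y => f.hom.arr ⟨y.1, hV' y.2⟩
      continuous_map := (continuous_subtype_val.comp (f.hom.continuous_map.comp
        (continuous_subtype_val.subtype_mk _))).subtype_mk _
      continuous_arr := f.hom.continuous_arr.comp (continuous_subtype_val.subtype_mk _)
      src_arr := fun y => f.hom.src_arr _
      tgt_arr := fun y => f.hom.tgt_arr _ }, ⟨x, hx, rfl⟩, ?_⟩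
  apply InducedCategory.hom_ext
  refine EtSp.hom_ext rfl (funext fun y => ?_)
  exact (EtaleGroupoid.mul_one' _).trans (EtaleGroupoid.one_mul' _).symm

variable (G)

/-- The topology of the site of `G`: a sieve on `U` is covering if the open subsets whose
inclusion belongs to it cover `U`.  The sheaves of abelian groups for this topology are the abelian
`G`-sheaves, i.e. the sheaves on the space of objects with a continuous action of the arrows:
`F(f) : F(V) → F(U)` is restriction for an inclusion `f`, and in general
`(F(f)σ)(x) = σ(src (f x)) · f x` for a continuous family of arrows `f`. -/
def siteTopology : GrothendieckTopology (Site G) where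
  sieves U := {S | ∀ x ∈ (Site.opens U), ∃ (W : Opens G.Obj) (h : W ≤ U),
    x ∈ W ∧ S.arrows (incl h)}
  top_mem' U x hx := ⟨U, le_rfl, hx, trivial⟩
  pullback_stable' U V S f hS x hx := by
    obtain ⟨W, hW, hxW, hSW⟩ := hS (f.hom.map ⟨x, hx⟩).1 (f.hom.map ⟨x, hx⟩).2
    obtain ⟨V', h, g, hxV', e⟩ := exists_incl_comp f W hW ⟨x, hx⟩ hxW
    refine ⟨V', h, hxV', ?_⟩
    change S.arrows (incl h ≫ f)
    rw [e]
    exact S.downward_closed hSW g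
  transitive' U S hS R hR x hx := by
    obtain ⟨W, hW, hxW, hSW⟩ := hS x hx
    obtain ⟨W', hW', hxW', h'⟩ := hR hSW x hxW
    refine ⟨W', hW'.trans hW, hxW', ?_⟩
    rw [← incl_comp hW' hW]
    exact h'

/-- The category of abelian `G`-sheaves. -/
abbrev GSheaf : Type (u + 1) := Sheaf (siteTopology G) AddCommGrpCat.{u}

variable {G}

/-- A criterion for a presheaf on the site of `G` to be a sheaf. -/
lemma isSheaf_of_local (P : (Site G)ᵒᵖ ⥤ AddCommGrpCat.{u})
    (sep : ∀ (U : Opens G.Obj) (s t : P.obj (op (st U))),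
      (∀ x ∈ U, ∃ (W : Opens G.Obj) (h : W ≤ U), x ∈ W ∧
        P.map (incl h).op s = P.map (incl h).op t) → s = t)
    (glue : ∀ (U : Opens G.Obj) (W : U → Opens G.Obj) (hW : ∀ x, W x ≤ U) (_ : ∀ x, x.1 ∈ W x)
      (s : ∀ x, P.obj (op (st (W x)))),
      (∀ x y, P.map (incl (inf_le_left : W x ⊓ W y ≤ W x)).op (s x) =
        P.map (incl (inf_le_right : W x ⊓ W y ≤ W y)).op (s y)) →
      ∃ t : P.obj (op (st U)), ∀ x, P.map (incl (hW x)).op t = s x) :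
    Presheaf.IsSheaf (siteTopology G) P := by
  rw [Presheaf.isSheaf_iff_isSheaf_forget _ _ (forget AddCommGrpCat.{u}), isSheaf_iff_isSheaf_of_type]
  intro U S hS fam hfam
  choose W hW hxW hSW using fun x : (Site.opens U) => hS x.1 x.2
  obtain ⟨t, ht⟩ := glue U W hW hxW (fun x => fam _ (hSW x)) (fun x y => by
    refine hfam _ _ (hSW x) (hSW y) ?_
    rw [incl_comp, incl_comp])
  refine ⟨t, fun V f hf => ?_, fun t' ht' => ?_⟩
  · refine sep V _ _ fun z hz => ?_
    obtain ⟨V', h, g, hzV', e⟩ := exists_incl_comp f _ (hW (f.hom.map ⟨z, hz⟩)) ⟨z, hz⟩ (hxW _)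
    refine ⟨V', h, hzV', ?_⟩
    have h1 : P.map (incl h).op (P.map f.op t) = P.map g.op (fam _ (hSW (f.hom.map ⟨z, hz⟩))) := by
      refine Eq.trans ?_ (congrArg (P.map g.op) (ht (f.hom.map ⟨z, hz⟩)))
      have e' := congrArg (fun k => P.map k.op t) e
      simpa only [op_comp, P.map_comp, ConcreteCategory.comp_apply] using e'
    refine h1.trans ?_
    exact hfam g (incl h) (hSW _) hf e.symm
  · refine sep _ _ _ fun x hx => ⟨W ⟨x, hx⟩, hW _, hxW _, ?_⟩
    exact (ht' _ (hSW _)).trans (ht _).symm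

end Site


/-! ### The sheaves of the theory -/

section Lifts

variable {M : Type u} [TopologicalSpace M] [SmoothSpace M]

lemma Form.congr {p : ℕ} (α : Form p M) {n : ℕ} {u v : Eu n → M} {x : Eu n}
    (h : v =ᶠ[𝓝 x] u) : α.1 n v x = α.1 n u x := by
  by_cases hu : IsSmoothAt u x
  · have := α.2.2.2 n n u v id x hu (Filter.Eventually.of_forall fun _ => contDiffAt_id) h
    rw [this]
    ext v
    simp
  · have hv : ¬ IsSmoothAt v x := fun hv => hu (SmoothSpace.congr hv h.symm)
    rw [α.2.1 n u x hu, α.2.1 n v x hv]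

open scoped Classical in
/-- A parametrisation of `U`, as a parametrisation of a smaller open set `W`. -/
noncomputable def toOpen {U : Opens M} (W : Opens M) (w : W) {n : ℕ} (u : Eu n → U) : Eu n → W :=
  fun y => if h : (u y).1 ∈ W then ⟨(u y).1, h⟩ else w

lemma val_toOpen {U W : Opens M} (w : W) {n : ℕ} {u : Eu n → U} {x : Eu n}
    (hu : IsSmoothAt u x) (hx : (u x).1 ∈ W) :
    (fun y => (toOpen W w u y).1) =ᶠ[𝓝 x] fun y => (u y).1 := by
  have : ∀ᶠ y in 𝓝 x, (u y).1 ∈ W :=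
    (continuous_subtype_val.continuousAt.comp (SmoothSpace.continuousAt hu)).eventually
      (W.isOpen.mem_nhds hx)
  filter_upwards [this] with y hy
  simp [toOpen, hy]

lemma isSmoothAt_val_iff {W : Opens M} {n : ℕ} {u : Eu n → W} {x : Eu n} :
    IsSmoothAt u x ↔ IsSmoothAt (fun y => (u y).1) x := by
  refine ⟨fun h => h.2, fun h => ⟨?_, h⟩⟩
  filter_upwards [IsSmoothAt.continuousNear h] with y hy
  exact Topology.IsInducing.subtypeVal.continuousAt_iff.2 hy

lemma isSmoothAt_toOpen {U W : Opens M} (w : W) {n : ℕ} {u : Eu n → U} {x : Eu n}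
    (hu : IsSmoothAt u x) (hx : (u x).1 ∈ W) : IsSmoothAt (toOpen W w u) x :=
  isSmoothAt_val_iff.2 (SmoothSpace.congr hu.2 (val_toOpen w hu hx))

end Lifts

section PullLemmas

variable {M N : Type u} [TopologicalSpace M] [SmoothSpace M] [TopologicalSpace N] [SmoothSpace N]

lemma d0_pull (f : SMap M N) (a : smoothFun N) :
    d0 (smoothFun.pull f a) = Form.pull f (d0 a) := by
  apply Subtype.ext; funext n u x
  by_cases h : IsSmoothAt u x
  · simp only [d0, Form.pull, AddMonoidHom.mk'_apply, if_pos h, if_pos (f.smooth h)]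
    rfl
  · simp [d0, Form.pull, h]

lemma dlog_pull (f : SMap M N) (a : smoothUnits N) :
    dlog (smoothUnits.pull f a) = Form.pull f (dlog a) := by
  apply Subtype.ext; funext n u x
  by_cases h : IsSmoothAt u x
  · simp only [dlog, Form.pull, AddMonoidHom.mk'_apply, if_pos h, if_pos (f.smooth h)]
    rfl
  · simp [dlog, Form.pull, h]

end PullLemmas

section Sheaves

variable (G : EtaleGroupoid.{u})

/-- The groups of `p`-forms on the spaces étale over `G`. -/
noncomputable def formFunctor (p : ℕ) : (EtSp G)ᵒᵖ ⥤ AddCommGrpCat.{u} where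
  obj E := AddCommGrpCat.of (Form p E.unop)
  map f := AddCommGrpCat.ofHom (Form.pull (EtSp.smap f.unop))
  map_id E := by
    refine AddCommGrpCat.hom_ext (AddMonoidHom.ext fun α => Subtype.ext ?_)
    funext n u x
    by_cases h : IsSmoothAt u x
    · exact if_pos h
    · exact (if_neg h).trans (α.2.1 n u x h).symm
  map_comp f g := by
    refine AddCommGrpCat.hom_ext (AddMonoidHom.ext fun α => Subtype.ext ?_)
    funext n u x
    by_cases h : IsSmoothAt u x
    · exact (if_pos h).trans
        ((if_pos h).trans (if_pos ((EtSp.smap g.unop).smooth h))).symm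
    · exact (if_neg h).trans (if_neg h).symm

/-- The groups of smooth functions on the spaces étale over `G`. -/
noncomputable def funFunctor : (EtSp G)ᵒᵖ ⥤ AddCommGrpCat.{u} where
  obj E := AddCommGrpCat.of (smoothFun E.unop)
  map f := AddCommGrpCat.ofHom (smoothFun.pull (EtSp.smap f.unop))

/-- The groups of smooth `ℂ^×`-valued functions on the spaces étale over `G`. -/
noncomputable def unitsFunctor : (EtSp G)ᵒᵖ ⥤ AddCommGrpCat.{u} where
  obj E := AddCommGrpCat.of (smoothUnits E.unop)
  map f := AddCommGrpCat.ofHom (smoothUnits.pull (EtSp.smap f.unop))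

/-- The groups of locally constant `c · ℤ(p)`-valued functions on the spaces étale over `G`. -/
noncomputable def latticeFunctor (p : ℕ) (c : ℂ) : (EtSp G)ᵒᵖ ⥤ AddCommGrpCat.{u} where
  obj E := AddCommGrpCat.of (latticeFun p c E.unop)
  map f := AddCommGrpCat.ofHom (AddMonoidHom.mk' (fun a => ⟨fun x => a.1 (f.unop.map x),
    a.2.1.comp_continuous f.unop.continuous_map, fun x => a.2.2 _⟩) fun _ _ => rfl)

lemma formFunctor_map_incl {p : ℕ} {U W : Opens G.Obj} (h : W ≤ U) (α : Form p U) {n : ℕ}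
    {u : Eu n → W} {x : Eu n} (hu : IsSmoothAt u x) :
    (((inducedFunctor (openSp G)).op ⋙ formFunctor G p).map (incl h).op α).1 n u x =
      α.1 n (fun y => ⟨(u y).1, h (u y).2⟩) x :=
  if_pos hu

lemma formFunctor_map_incl_toOpen {p : ℕ} {U W : Opens G.Obj} (h : W ≤ U) (α : Form p U) {n : ℕ}
    {u : Eu n → U} {x : Eu n} (hu : IsSmoothAt u x) (hx : (u x).1 ∈ W) (w : W) :
    (((inducedFunctor (openSp G)).op ⋙ formFunctor G p).map (incl h).op α).1 n (toOpen W w u) x =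
      α.1 n u x :=
  (formFunctor_map_incl G h α (isSmoothAt_toOpen w hu hx)).trans
    (Form.congr α ((val_toOpen w hu hx).mono fun _ hy => Subtype.ext hy))

open scoped Classical in
lemma isSheaf_form (p : ℕ) : Presheaf.IsSheaf (siteTopology G)
    ((inducedFunctor (openSp G)).op ⋙ formFunctor G p) := by
  refine isSheaf_of_local _ (fun U (s : Form p U) (t : Form p U) hst => ?_) (fun U W hW hxW
    (s : ∀ x, Form p (W x)) hs => ?_)
  · apply Subtype.ext; funext n u x
    by_cases hu : IsSmoothAt u x
    · obtain ⟨V, h, hxV, e⟩ := hst (u x).1 (u x).2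
      have h3 := congrFun (congrFun (congrFun (congrArg Subtype.val e) n) (toOpen V ⟨_, hxV⟩ u)) x
      exact (formFunctor_map_incl_toOpen G h s hu hxV _).symm.trans
        (h3.trans (formFunctor_map_incl_toOpen G h t hu hxV _))
    · exact (s.2.1 n u x hu).trans (t.2.1 n u x hu).symm
  · -- the local expressions agree where they are defined
    have key : ∀ (a b : U) (n : ℕ) (u : Eu n → U) (x : Eu n) (_ : IsSmoothAt u x)
        (ha : (u x).1 ∈ W a) (_ : (u x).1 ∈ W b) (wa : W a) (wb : W b),
        (s a).1 n (toOpen (W a) wa u) x = (s b).1 n (toOpen (W b) wb u) x := by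
      intro a b n u x hu ha hb wa wb
      have e := hs a b
      let w : (W a ⊓ W b : Opens G.Obj) := ⟨(u x).1, ha, hb⟩
      have h1 := isSmoothAt_toOpen w hu w.2
      have h3 := congrFun (congrFun (congrFun (congrArg Subtype.val e) n)
        (toOpen (W a ⊓ W b) w u)) x
      have h4 := (formFunctor_map_incl G inf_le_left (s a) h1).symm.trans
        (h3.trans (formFunctor_map_incl G inf_le_right (s b) h1))
      refine (Form.congr (s a) ?_).trans (h4.trans (Form.congr (s b) ?_))
      · filter_upwards [val_toOpen wa hu ha, val_toOpen w hu w.2] with y hy hy'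
        exact Subtype.ext (hy.trans hy'.symm)
      · filter_upwards [val_toOpen wb hu hb, val_toOpen w hu w.2] with y hy hy'
        exact Subtype.ext (hy'.trans hy.symm)
    let t : ∀ (n : ℕ) (u : Eu n → U) (x : Eu n), (Eu n) [⋀^Fin p]→L[ℝ] ℂ := fun n u x =>
      if IsSmoothAt u x then (s (u x)).1 n (toOpen (W (u x)) ⟨_, hxW _⟩ u) x else 0
    have ht : ∀ (a : U) (n : ℕ) (u : Eu n → U) (x : Eu n) (_ : IsSmoothAt u x)
        (_ : (u x).1 ∈ W a) (w : W a), t n u x = (s a).1 n (toOpen (W a) w u) x :=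
      fun a n u x hu ha w => (if_pos hu).trans (key _ _ n u x hu (hxW _) ha _ w)
    have near : ∀ (a : U) (n : ℕ) (u : Eu n → U) (x : Eu n) (_ : IsSmoothAt u x)
        (_ : (u x).1 ∈ W a), ∀ᶠ y in 𝓝 x, (u y).1 ∈ W a := fun a n u x hu ha =>
      (continuous_subtype_val.continuousAt.comp (SmoothSpace.continuousAt hu)).eventually
        ((W a).isOpen.mem_nhds ha)
    have hform : t ∈ formSubgroup p U := by
      refine ⟨fun n u x h => if_neg h, fun n u x h => ?_, fun m n u v f y h hf hv => ?_⟩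
      · have hx := hxW (u x)
        refine ((s (u x)).2.2.1 n _ x (isSmoothAt_toOpen ⟨_, hx⟩ h hx)).congr_of_eventuallyEq ?_
        filter_upwards [SmoothSpace.eventually h, near (u x) n u x h hx] with y h1 h2
        exact ht _ n u y h1 h2 _
      · have hv' : IsSmoothAt v y := SmoothSpace.congr (SmoothSpace.comp h hf) hv
        have hx := hxW (u (f y))
        have hx' : (v y).1 ∈ W (u (f y)) := by
          have e : v y = u (f y) := hv.self_of_nhds
          rw [e]; exact hx
        rw [ht (u (f y)) m v y hv' hx' ⟨_, hx⟩, ht (u (f y)) n u (f y) h hx ⟨_, hx⟩]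
        refine (s (u (f y))).2.2.2 m n _ _ f y (isSmoothAt_toOpen ⟨_, hx⟩ h hx) hf ?_
        filter_upwards [val_toOpen ⟨_, hx⟩ hv' hx', hv,
          hf.continuousAt.eventually (val_toOpen ⟨_, hx⟩ h hx)] with z h1 h2 h3
        refine Subtype.ext (h1.trans (Eq.trans ?_ h3.symm))
        rw [h2]; rfl
    refine ⟨⟨t, hform⟩, fun a => ?_⟩
    apply Subtype.ext; funext n (u : Eu n → W a) x
    by_cases hu : IsSmoothAt u x
    · refine (formFunctor_map_incl G (hW a) ⟨t, hform⟩ hu).trans ?_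
      have h1 : IsSmoothAt (fun y => (⟨(u y).1, hW a (u y).2⟩ : U)) x :=
        isSmoothAt_val_iff.2 hu.2
      refine (ht a n _ x h1 (u x).2 (u x)).trans (Form.congr (s a) ?_)
      exact (val_toOpen (u x) h1 (u x).2).mono fun y hy => Subtype.ext hy
    · exact (if_neg hu).trans ((s a).2.1 n u x hu).symm

lemma isSheaf_fun : Presheaf.IsSheaf (siteTopology G)
    ((inducedFunctor (openSp G)).op ⋙ funFunctor G) := by
  refine isSheaf_of_local _ (fun U (s : smoothFun U) (t : smoothFun U) hst => ?_)
    (fun U W hW hxW (s : ∀ x, smoothFun (W x)) hs => ?_)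
  · apply Subtype.ext; funext x
    obtain ⟨V, h, hxV, e⟩ := hst x.1 x.2
    exact congrFun (congrArg Subtype.val e) ⟨x.1, hxV⟩
  · have key : ∀ (a b x : U) (ha : x.1 ∈ W a) (hb : x.1 ∈ W b),
        (s a).1 ⟨x.1, ha⟩ = (s b).1 ⟨x.1, hb⟩ := fun a b x ha hb =>
      congrFun (congrArg Subtype.val (hs a b)) ⟨x.1, ha, hb⟩
    refine ⟨⟨fun x => (s x).1 ⟨x.1, hxW x⟩, fun n u x h => ?_⟩, fun a => ?_⟩
    · have hx := hxW (u x)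
      refine ((s (u x)).2 n _ x (isSmoothAt_toOpen ⟨_, hx⟩ h hx)).congr_of_eventuallyEq ?_
      filter_upwards [val_toOpen ⟨_, hx⟩ h hx] with y hy
      have hy' : (u y).1 ∈ W (u x) := hy ▸ (toOpen (W (u x)) ⟨_, hx⟩ u y).2
      exact (key _ (u x) (u y) (hxW _) hy').trans (congrArg (s (u x)).1 (Subtype.ext hy.symm))
    · apply Subtype.ext; funext (x : W a)
      exact key _ a ⟨x.1, hW a x.2⟩ (hxW _) x.2

lemma isSheaf_units : Presheaf.IsSheaf (siteTopology G)
    ((inducedFunctor (openSp G)).op ⋙ unitsFunctor G) := by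
  refine isSheaf_of_local _ (fun U (s : smoothUnits U) (t : smoothUnits U) hst => ?_)
    (fun U W hW hxW (s : ∀ x, smoothUnits (W x)) hs => ?_)
  · apply Subtype.ext; funext x
    obtain ⟨V, h, hxV, e⟩ := hst x.1 x.2
    exact congrFun (congrArg Subtype.val e) ⟨x.1, hxV⟩
  · have key : ∀ (a b x : U) (ha : x.1 ∈ W a) (hb : x.1 ∈ W b),
        (s a).1 ⟨x.1, ha⟩ = (s b).1 ⟨x.1, hb⟩ := fun a b x ha hb =>
      congrFun (congrArg Subtype.val (hs a b)) ⟨x.1, ha, hb⟩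
    refine ⟨⟨fun x => (s x).1 ⟨x.1, hxW x⟩, fun n u x h => ?_⟩, fun a => ?_⟩
    · have hx := hxW (u x)
      refine ((s (u x)).2 n _ x (isSmoothAt_toOpen ⟨_, hx⟩ h hx)).congr_of_eventuallyEq ?_
      filter_upwards [val_toOpen ⟨_, hx⟩ h hx] with y hy
      have hy' : (u y).1 ∈ W (u x) := hy ▸ (toOpen (W (u x)) ⟨_, hx⟩ u y).2
      exact congrArg (fun z : Additive ℂˣ => (z.toMul : ℂ))
        ((key _ (u x) (u y) (hxW _) hy').trans (congrArg (s (u x)).1 (Subtype.ext hy.symm)))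
    · apply Subtype.ext; funext (x : W a)
      exact key _ a ⟨x.1, hW a x.2⟩ (hxW _) x.2

lemma isSheaf_lattice (p : ℕ) (c : ℂ) : Presheaf.IsSheaf (siteTopology G)
    ((inducedFunctor (openSp G)).op ⋙ latticeFunctor G p c) := by
  refine isSheaf_of_local _ (fun U (s : latticeFun p c U) (t : latticeFun p c U) hst => ?_)
    (fun U W hW hxW (s : ∀ x, latticeFun p c (W x)) hs => ?_)
  · apply Subtype.ext; funext x
    obtain ⟨V, h, hxV, e⟩ := hst x.1 x.2
    exact congrFun (congrArg Subtype.val e) ⟨x.1, hxV⟩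
  · have key : ∀ (a b x : U) (ha : x.1 ∈ W a) (hb : x.1 ∈ W b),
        (s a).1 ⟨x.1, ha⟩ = (s b).1 ⟨x.1, hb⟩ := fun a b x ha hb =>
      congrFun (congrArg Subtype.val (hs a b)) ⟨x.1, ha, hb⟩
    refine ⟨⟨fun x => (s x).1 ⟨x.1, hxW x⟩, ?_, fun x => (s x).2.2 _⟩, fun a => ?_⟩
    · rw [IsLocallyConstant.iff_eventually_eq]
      intro x
      have h1 := (s x).2.1.eventually_eq ⟨x.1, hxW x⟩
      rw [Topology.IsInducing.subtypeVal.nhds_eq_comap, Filter.eventually_comap] at h1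
      have h2 := (continuous_subtype_val.continuousAt (x := x)).eventually
        (Filter.Eventually.and (f := 𝓝 x.1) h1 ((W x).isOpen.mem_nhds (hxW x)))
      filter_upwards [h2] with y hy
      exact (key _ x y (hxW _) hy.2).trans (hy.1 ⟨y.1, hy.2⟩ rfl)
    · apply Subtype.ext; funext (x : W a)
      exact key _ a ⟨x.1, hW a x.2⟩ (hxW _) x.2

/-- The `G`-sheaf `𝒜^p` of complex-valued `p`-forms; arrows act by pull-back. -/
noncomputable def formSheaf (p : ℕ) : GSheaf G := ⟨_, isSheaf_form G p⟩

/-- The `G`-sheaf `𝒜⁰` of complex-valued smooth functions. -/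
noncomputable def funSheaf : GSheaf G := ⟨_, isSheaf_fun G⟩

/-- The `G`-sheaf `ℂ^×` of smooth `ℂ^×`-valued functions. -/
noncomputable def unitsSheaf : GSheaf G := ⟨_, isSheaf_units G⟩

/-- The constant `G`-sheaf `c · ℤ(p)`. -/
noncomputable def latticeSheaf (p : ℕ) (c : ℂ) : GSheaf G := ⟨_, isSheaf_lattice G p c⟩

/-- The exterior derivative `𝒜^p ⟶ 𝒜^{p+1}`. -/
noncomputable def dSheaf (p : ℕ) : formSheaf G p ⟶ formSheaf G (p + 1) where
  hom :=
    { app := fun _ => AddCommGrpCat.ofHom Form.d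
      naturality := fun _ _ f => AddCommGrpCat.hom_ext (AddMonoidHom.ext fun α =>
        Form.d_pull (EtSp.smap f.unop.hom) α) }

/-- The differential `𝒜⁰ ⟶ 𝒜¹` of functions. -/
noncomputable def d0Sheaf : funSheaf G ⟶ formSheaf G 1 where
  hom :=
    { app := fun _ => AddCommGrpCat.ofHom d0
      naturality := fun _ _ f => AddCommGrpCat.hom_ext (AddMonoidHom.ext fun α =>
        d0_pull (EtSp.smap f.unop.hom) α) }

/-- The logarithmic differential `ℂ^× ⟶ 𝒜¹`. -/
noncomputable def dlogSheaf : unitsSheaf G ⟶ formSheaf G 1 where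
  hom :=
    { app := fun _ => AddCommGrpCat.ofHom dlog
      naturality := fun _ _ f => AddCommGrpCat.hom_ext (AddMonoidHom.ext fun α =>
        dlog_pull (EtSp.smap f.unop.hom) α) }

/-- The exponential map `𝒜⁰ ⟶ ℂ^×`. -/
noncomputable def expSheaf : funSheaf G ⟶ unitsSheaf G where
  hom :=
    { app := fun _ => AddCommGrpCat.ofHom expFun
      naturality := fun _ _ _ => rfl }

/-- The inclusion `c · ℤ(p) ⟶ 𝒜⁰`. -/
noncomputable def latticeSheafIncl (p : ℕ) (c : ℂ) : latticeSheaf G p c ⟶ funSheaf G where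
  hom :=
    { app := fun _ => AddCommGrpCat.ofHom (latticeIncl p c)
      naturality := fun _ _ _ => rfl }

lemma dSheaf_dSheaf (p : ℕ) : dSheaf G p ≫ dSheaf G (p + 1) = 0 :=
  Sheaf.hom_ext (NatTrans.ext (funext fun _ =>
    AddCommGrpCat.hom_ext (AddMonoidHom.ext fun α => Form.d_d α)))

lemma d0Sheaf_dSheaf : d0Sheaf G ≫ dSheaf G 1 = 0 :=
  Sheaf.hom_ext (NatTrans.ext (funext fun _ =>
    AddCommGrpCat.hom_ext (AddMonoidHom.ext fun α => d_d0 α)))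

lemma dlogSheaf_dSheaf : dlogSheaf G ≫ dSheaf G 1 = 0 :=
  Sheaf.hom_ext (NatTrans.ext (funext fun _ =>
    AddCommGrpCat.hom_ext (AddMonoidHom.ext fun α => d_dlog α)))

lemma expSheaf_dlogSheaf : expSheaf G ≫ dlogSheaf G = d0Sheaf G :=
  Sheaf.hom_ext (NatTrans.ext (funext fun _ =>
    AddCommGrpCat.hom_ext (AddMonoidHom.ext fun α => dlog_expFun α)))

lemma latticeSheafIncl_d0Sheaf (p : ℕ) (c : ℂ) : latticeSheafIncl G p c ≫ d0Sheaf G = 0 :=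
  Sheaf.hom_ext (NatTrans.ext (funext fun _ =>
    AddCommGrpCat.hom_ext (AddMonoidHom.ext fun α => d0_latticeIncl p c α)))

end Sheaves

/-! ### Complexes -/

section Truncation

open Limits

variable {C : Type u} [Category.{v} C] [HasZeroMorphisms C] [HasZeroObject C]

open scoped ZeroObject in
/-- The objects of the truncation `X⁰ → X¹ → ⋯ → X^{p-1} → 0 → ⋯` of a sequence. -/
noncomputable def truncX : (ℕ → C) → ℕ → ℕ → C
  | _, 0, _ => 0
  | X, _ + 1, 0 => X 0
  | X, p + 1, n + 1 => truncX (fun k => X (k + 1)) p n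

/-- The first differential of the truncation of a sequence. -/
noncomputable def truncD₀ (X : ℕ → C) (d : ∀ n, X n ⟶ X (n + 1)) :
    ∀ p, X 0 ⟶ truncX (fun k => X (k + 1)) p 0
  | 0 => 0
  | _ + 1 => d 0

/-- The differentials of the truncation `X⁰ → X¹ → ⋯ → X^{p-1} → 0 → ⋯` of a sequence. -/
noncomputable def truncD : ∀ (X : ℕ → C) (_ : ∀ n, X n ⟶ X (n + 1)) (p n : ℕ),
    truncX X p n ⟶ truncX X p (n + 1)
  | _, _, 0, _ => 0
  | X, d, p + 1, 0 => truncD₀ X d p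
  | X, d, p + 1, n + 1 => truncD (fun k => X (k + 1)) (fun k => d (k + 1)) p n

lemma truncD_comp : ∀ (X : ℕ → C) (d : ∀ n, X n ⟶ X (n + 1)) (_ : ∀ n, d n ≫ d (n + 1) = 0)
    (p n : ℕ), truncD X d p n ≫ truncD X d p (n + 1) = 0
  | _, _, _, 0, _ => zero_comp
  | _, _, _, 1, 0 => zero_comp
  | _, _, _, 2, 0 => comp_zero
  | _, _, h, _ + 3, 0 => h 0
  | X, d, h, p + 1, n + 1 =>
    truncD_comp (fun k => X (k + 1)) (fun k => d (k + 1)) (fun k => h (k + 1)) p n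

/-- The morphism between truncations induced by a morphism of sequences. -/
noncomputable def truncMap : ∀ (X Y : ℕ → C) (_ : ∀ n, X n ⟶ Y n) (p n : ℕ),
    truncX X p n ⟶ truncX Y p n
  | _, _, _, 0, _ => 𝟙 _
  | _, _, φ, _ + 1, 0 => φ 0
  | X, Y, φ, p + 1, n + 1 =>
    truncMap (fun k => X (k + 1)) (fun k => Y (k + 1)) (fun k => φ (k + 1)) p n

lemma truncMap_comm : ∀ (X Y : ℕ → C) (d : ∀ n, X n ⟶ X (n + 1)) (d' : ∀ n, Y n ⟶ Y (n + 1))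
    (φ : ∀ n, X n ⟶ Y n) (_ : ∀ n, φ n ≫ d' n = d n ≫ φ (n + 1)) (p n : ℕ),
    truncMap X Y φ p n ≫ truncD Y d' p n = truncD X d p n ≫ truncMap X Y φ p (n + 1)
  | _, _, _, _, _, _, 0, _ => comp_zero.trans zero_comp.symm
  | _, _, _, _, _, _, 1, 0 => comp_zero.trans zero_comp.symm
  | _, _, _, _, _, h, _ + 2, 0 => h 0
  | X, Y, d, d', φ, h, p + 1, n + 1 => truncMap_comm (fun k => X (k + 1)) (fun k => Y (k + 1))
    (fun k => d (k + 1)) (fun k => d' (k + 1)) (fun k => φ (k + 1)) (fun k => h (k + 1)) p n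

/-- The complex `X⁰ → X¹ → ⋯ → X^{p-1} → 0 → ⋯`, with `X⁰` in degree `0`. -/
noncomputable def truncComplex (X : ℕ → C) (d : ∀ n, X n ⟶ X (n + 1))
    (h : ∀ n, d n ≫ d (n + 1) = 0) (p : ℕ) : CochainComplex C ℕ :=
  CochainComplex.of (truncX X p) (truncD X d p) (truncD_comp X d h p)

lemma truncComplex_d (X : ℕ → C) (d : ∀ n, X n ⟶ X (n + 1)) (h : ∀ n, d n ≫ d (n + 1) = 0)
    (p n : ℕ) : (truncComplex X d h p).d n (n + 1) = truncD X d p n :=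
  CochainComplex.of_d _ _ n

open scoped ZeroObject in
/-- The complex `F[-1]`, i.e. `0 → F⁰ → F¹ → ⋯` with `F⁰` in degree `1`. -/
noncomputable def sh (F : CochainComplex C ℕ) : CochainComplex C ℕ where
  X
    | 0 => 0
    | n + 1 => F.X n
  d
    | 0, _ => 0
    | _ + 1, 0 => 0
    | m + 1, n + 1 => F.d m n
  shape
    | 0, _, _ => rfl
    | _ + 1, 0, _ => rfl
    | m + 1, n + 1, h => F.shape m n fun h' => h (congrArg (· + 1) h')
  d_comp_d'
    | 0, _, _, _, _ => zero_comp
    | _ + 1, 0, _, _, _ => zero_comp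
    | _ + 1, _ + 1, 0, _, _ => comp_zero
    | _ + 1, _ + 1, _ + 1, _, _ => F.d_comp_d _ _ _

/-- The morphism `F[-1] ⟶ F'[-1]` induced by a morphism. -/
noncomputable def shMap {F F' : CochainComplex C ℕ} (φ : F ⟶ F') : sh F ⟶ sh F' where
  f
    | 0 => 𝟙 _
    | n + 1 => φ.f n
  comm'
    | 0, _, _ => comp_zero.trans zero_comp.symm
    | _ + 1, 0, _ => comp_zero.trans zero_comp.symm
    | m + 1, n + 1, _ => φ.comm m n

end Truncation

section Complexes

variable (G : EtaleGroupoid.{u})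

/-- The sequence of `G`-sheaves `ℂ^×, 𝒜¹, 𝒜², …`. -/
noncomputable def cxX : ℕ → GSheaf G
  | 0 => unitsSheaf G
  | n + 1 => formSheaf G (n + 1)

/-- The differentials `ℂ^× → 𝒜¹ → 𝒜² → ⋯`. -/
noncomputable def cxD : ∀ n, cxX G n ⟶ cxX G (n + 1)
  | 0 => dlogSheaf G
  | n + 1 => dSheaf G (n + 1)

lemma cxD_comp : ∀ n, cxD G n ≫ cxD G (n + 1) = 0
  | 0 => dlogSheaf_dSheaf G
  | n + 1 => dSheaf_dSheaf G (n + 1)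

/-- The complex `ℂ^×(p)` of `G`-sheaves: `ℂ^× → 𝒜¹ → ⋯ → 𝒜^{p-1}`, with `ℂ^×` in degree `0`. -/
noncomputable def Cx (p : ℕ) : CochainComplex (GSheaf G) ℕ :=
  truncComplex (cxX G) (cxD G) (cxD_comp G) p

/-- The factor `(2πi)^{-p+1}`. -/
noncomputable def deligneFactor (p : ℕ) : ℂ := (2 * Real.pi * Complex.I) ^ (1 - (p : ℤ))

/-- The sequence of `G`-sheaves `(2πi)^{-p+1} · ℤ(p), 𝒜⁰, 𝒜¹, 𝒜², …`. -/
noncomputable def deligneX (p : ℕ) : ℕ → GSheaf G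
  | 0 => latticeSheaf G p (deligneFactor p)
  | 1 => funSheaf G
  | n + 2 => formSheaf G (n + 1)

/-- The differentials `(2πi)^{-p+1} · ℤ(p) → 𝒜⁰ → 𝒜¹ → ⋯`. -/
noncomputable def deligneD (p : ℕ) : ∀ n, deligneX G p n ⟶ deligneX G p (n + 1)
  | 0 => latticeSheafIncl G p (deligneFactor p)
  | 1 => d0Sheaf G
  | n + 2 => dSheaf G (n + 1)

lemma deligneD_comp (p : ℕ) : ∀ n, deligneD G p n ≫ deligneD G p (n + 1) = 0
  | 0 => latticeSheafIncl_d0Sheaf G p _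
  | 1 => d0Sheaf_dSheaf G
  | n + 2 => dSheaf_dSheaf G (n + 1)

/-- The smooth Deligne complex, scaled by `(2πi)^{-p+1}`:
`(2πi)^{-p+1} · ℤ(p) → 𝒜⁰ → 𝒜¹ → ⋯ → 𝒜^{p-1}`, with `𝒜⁰` in degree `1`. -/
noncomputable def Deligne (p : ℕ) : CochainComplex (GSheaf G) ℕ :=
  truncComplex (deligneX G p) (deligneD G p) (deligneD_comp G p) (p + 1)

/-- The morphism of sequences `𝒜⁰, 𝒜¹, …` to `ℂ^×, 𝒜¹, …` given by the exponential map. -/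
noncomputable def expSeq (p : ℕ) : ∀ n, deligneX G p (n + 1) ⟶ cxX G n
  | 0 => expSheaf G
  | _ + 1 => 𝟙 _

lemma expSeq_comm (p : ℕ) : ∀ n, expSeq G p n ≫ cxD G n = deligneD G p (n + 1) ≫ expSeq G p (n + 1)
  | 0 => (expSheaf_dlogSheaf G).trans (Category.comp_id _).symm
  | _ + 1 => (Category.id_comp _).trans (Category.comp_id _).symm

lemma latticeSheafIncl_expSheaf (p : ℕ) :
    latticeSheafIncl G p (deligneFactor p) ≫ expSheaf G = 0 := by
  refine Sheaf.hom_ext (NatTrans.ext (funext fun U =>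
    AddCommGrpCat.hom_ext (AddMonoidHom.ext fun f => Subtype.ext (funext fun x => ?_))))
  obtain ⟨k, hk⟩ := f.2.2 x
  have h2 : (2 * Real.pi * Complex.I : ℂ) ≠ 0 := Complex.two_pi_I_ne_zero
  have h1 : deligneFactor p * ((2 * Real.pi * Complex.I) ^ p * k) = k * (2 * Real.pi * Complex.I) := by
    rw [← mul_assoc, deligneFactor, ← zpow_natCast, ← zpow_add₀ h2]
    simp [mul_comm]
  refine Additive.toMul.injective (Units.ext ?_)
  change Complex.exp (f.1 x) = 1
  rw [hk, h1]
  exact Complex.exp_int_mul_two_pi_mul_I k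

/-- The morphism of complexes from the scaled Deligne complex to `ℂ^×(p)[-1]` given by the
exponential map `𝒜⁰ → ℂ^×` and the identities of `𝒜¹, …, 𝒜^{p-1}`. -/
noncomputable def expComplex (p : ℕ) : Deligne G p ⟶ sh (Cx G p) where
  f
    | 0 => 0
    | n + 1 => truncMap (fun k => deligneX G p (k + 1)) (cxX G) (expSeq G p) p n
  comm' := by
    rintro (_ | i) _ (rfl : _ = _)
    · refine Limits.zero_comp.trans ?_
      refine Eq.trans ?_ (congrArg (· ≫ _) (truncComplex_d _ _ (deligneD_comp G p) (p + 1) 0).symm)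
      rcases p with _ | p
      · exact Limits.zero_comp.symm
      · exact (latticeSheafIncl_expSheaf G (p + 1)).symm
    · refine (congrArg (truncMap _ _ (expSeq G p) p i ≫ ·)
        (truncComplex_d _ _ (cxD_comp G) p i)).trans ?_
      refine (truncMap_comm _ _ (fun k => deligneD G p (k + 1)) (cxD G) (expSeq G p)
        (expSeq_comm G p) p i).trans ?_
      exact congrArg (· ≫ _) (truncComplex_d _ _ (deligneD_comp G p) (p + 1) (i + 1)).symm

/-- The morphism `κ : ℂ^×(2) ⟶ 𝒜²[-1]` given by `d : 𝒜¹ ⟶ 𝒜²` (the curvature). -/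
noncomputable def curvComplex :
    Cx G 2 ⟶ (HomologicalComplex.single (GSheaf G) (ComplexShape.up ℕ) 1).obj (formSheaf G 2) :=
  HomologicalComplex.mkHomToSingle (show (Cx G 2).X 1 ⟶ formSheaf G 2 from dSheaf G 1) (by
    rintro _ (h : _ + 1 = 1)
    obtain rfl := Nat.succ_injective h
    refine (congrArg (· ≫ _) (truncComplex_d _ _ (cxD_comp G) 2 0)).trans ?_
    exact dlogSheaf_dSheaf G)

end Complexes

/-! ### Hypercohomology -/

section Resolutions

variable {C : Type u} [Category.{v} C] [Abelian C]

/-- In an abelian category with enough injectives, every cochain complex in non-negative degrees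
has a quasi-isomorphism into a complex of injectives in non-negative degrees. -/
lemma exists_injectiveResolution [EnoughInjectives C] (F : CochainComplex C ℕ) :
    ∃ (T : CochainComplex C ℕ) (ι : F ⟶ T), QuasiIso ι ∧ ∀ n, Injective (T.X n) := by
  let e := ComplexShape.embeddingUpNat
  have h0 : ∀ j : ℕ, e.f j = (j : ℤ) := fun j => rfl
  have : CochainComplex.IsStrictlyGE (F.extend e) 0 := by
    rw [CochainComplex.isStrictlyGE_iff]
    intro i hi
    exact F.isZero_extend_X e i fun j => by rw [h0]; omega
  obtain ⟨L, i, hi, hL, hL0⟩ :=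
    CochainComplex.Plus.modelCategoryQuillen.exists_quasiIso_injective (F.extend e) 0
  have hlift : e.HasLift (𝟙 (L.restriction e)) := by
    intro j hj i' hi'
    have hz : Limits.IsZero (L.X i') := by
      refine CochainComplex.isZero_of_isStrictlyGE L 0 i' ?_
      have h1 : i' + 1 = e.f j := hi'
      by_contra hn
      obtain ⟨k, rfl⟩ := Int.eq_ofNat_of_zero_le (not_lt.1 hn)
      exact hj.2 k hi'
    exact hz.eq_of_src _ _
  let q := e.liftExtend (𝟙 (L.restriction e)) hlift
  have hq : IsIso q := by
    have : ∀ n, IsIso (q.f n) := by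
      intro n
      by_cases hn : 0 ≤ n
      · obtain ⟨k, rfl⟩ := Int.eq_ofNat_of_zero_le hn
        rw [e.isIso_liftExtend_f_iff _ hlift (h0 k)]
        infer_instance
      · have h1 : Limits.IsZero (L.X n) :=
          CochainComplex.isZero_of_isStrictlyGE L 0 n (not_le.1 hn)
        have h2 : Limits.IsZero (((L.restriction e).extend e).X n) :=
          HomologicalComplex.isZero_extend_X _ e n fun j => by rw [h0]; omega
        exact ⟨0, h1.eq_of_src _ _, h2.eq_of_src _ _⟩
    exact HomologicalComplex.Hom.isIso_of_components q
  obtain ⟨ι, hι⟩ := (e.extendFunctor C).map_surjective (i ≫ q)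
  refine ⟨L.restriction e, ι, ?_, fun n => hL _⟩
  rw [← HomologicalComplex.quasiIso_extendMap_iff ι e]
  change QuasiIso ((e.extendFunctor C).map ι)
  rw [hι]
  have : QuasiIso q := inferInstance
  exact quasiIso_comp i q

attribute [local instance] HasDerivedCategory.standard in
open DerivedCategory in
/-- Maps into complexes of injectives extend along quasi-isomorphisms, up to homotopy. -/
lemma exists_lift {F T I : CochainComplex C ℕ} (ι : F ⟶ T) (hι : QuasiIso ι) (f : F ⟶ I)
    (hI : ∀ n, Injective (I.X n)) : ∃ g : T ⟶ I, Nonempty (Homotopy (ι ≫ g) f) := by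
  let e := ComplexShape.embeddingUpNat
  have h0 : ∀ j : ℕ, e.f j = (j : ℤ) := fun j => rfl
  have hge : CochainComplex.IsStrictlyGE (I.extend e) 0 := by
    rw [CochainComplex.isStrictlyGE_iff]
    intro i hi
    exact I.isZero_extend_X e i fun j => by rw [h0]; omega
  have hinj : ∀ n : ℤ, Injective ((I.extend e).X n) := by
    intro n
    by_cases hn : 0 ≤ n
    · obtain ⟨k, rfl⟩ := Int.eq_ofNat_of_zero_le hn
      exact Injective.of_iso (I.extendXIso e (h0 k)).symm (hI k)
    · exact (HomologicalComplex.isZero_extend_X I e n fun j => by rw [h0]; omega).injective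
  have : CochainComplex.IsKInjective (I.extend e) :=
    CochainComplex.isKInjective_of_injective _ 0
  let ι' := (e.extendFunctor C).map ι
  have hι' : QuasiIso ι' := (HomologicalComplex.quasiIso_extendMap_iff ι e).2 hι
  obtain ⟨g, hg⟩ := (CochainComplex.IsKInjective.Qh_map_bijective
    ((HomotopyCategory.quotient _ _).obj ((e.extendFunctor C).obj T)) (I.extend e)).surjective
    ((quotientCompQhIso C).hom.app _ ≫ inv (Q.map ι') ≫ Q.map ((e.extendFunctor C).map f) ≫
      (quotientCompQhIso C).inv.app _)
  obtain ⟨g, rfl⟩ := (HomotopyCategory.quotient _ _).map_surjective g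
  obtain ⟨g, rfl⟩ := (e.extendFunctor C).map_surjective g
  refine ⟨g, ⟨Homotopy.ofExtend (e := e) (HomotopyCategory.homotopyOfEq _ _ ?_)⟩⟩
  refine (CochainComplex.IsKInjective.Qh_map_bijective _ _).injective ?_
  change Qh.map ((HomotopyCategory.quotient _ _).map ((e.extendFunctor C).map (ι ≫ g))) =
    Qh.map ((HomotopyCategory.quotient _ _).map ((e.extendFunctor C).map f))
  rw [Functor.map_comp, Functor.map_comp, Functor.map_comp]
  refine (congrArg (Qh.map ((HomotopyCategory.quotient _ _).map ι') ≫ ·) hg).trans ?_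
  have n1 := (quotientCompQhIso C).hom.naturality ι'
  have n2 := (quotientCompQhIso C).inv.naturality ((e.extendFunctor C).map f)
  simp only [Functor.comp_map] at n1
  rw [reassoc_of% n1, IsIso.hom_inv_id_assoc]
  refine (congrArg ((quotientCompQhIso C).hom.app _ ≫ ·) n2).trans ?_
  exact Iso.hom_inv_id_app_assoc (quotientCompQhIso C) _ _


variable [EnoughInjectives C]

/-- A chosen quasi-isomorphic complex of injectives `F → T`. -/
noncomputable def injRes (F : CochainComplex C ℕ) : CochainComplex C ℕ :=
  (exists_injectiveResolution F).choose

/-- The quasi-isomorphism `F → T`. -/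
noncomputable def injResι (F : CochainComplex C ℕ) : F ⟶ injRes F :=
  (exists_injectiveResolution F).choose_spec.choose

lemma quasiIso_injResι (F : CochainComplex C ℕ) : QuasiIso (injResι F) :=
  (exists_injectiveResolution F).choose_spec.choose_spec.1

lemma injective_injRes (F : CochainComplex C ℕ) (n : ℕ) : Injective ((injRes F).X n) :=
  (exists_injectiveResolution F).choose_spec.choose_spec.2 n

/-- The extension `T ⟶ I` of a morphism `F ⟶ I` into a complex of injectives to the chosen
resolution of `F`, which is unique up to homotopy. -/
noncomputable def injLift {F I : CochainComplex C ℕ} (f : F ⟶ I) (hI : ∀ n, Injective (I.X n)) :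
    injRes F ⟶ I :=
  (exists_lift (injResι F) (quasiIso_injResι F) f hI).choose

end Resolutions

section Hypercohomology

variable (G : EtaleGroupoid.{u})

/-- The group `Γ_inv(G, F)` of invariant sections of a `G`-sheaf `F`: the global sections whose
pull-back under a local continuous family of arrows `U ⟶ ⊤` is always equal to the restriction. -/
noncomputable def invSections (F : GSheaf G) : AddSubgroup (F.obj.obj (op (st (⊤ : Opens G.Obj)))) where
  carrier := {σ | ∀ (U : Opens G.Obj) (f : st U ⟶ st (⊤ : Opens G.Obj)),
    F.obj.map f.op σ = F.obj.map (incl (le_top : U ≤ ⊤)).op σ}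
  add_mem' ha hb U f := by simp only [map_add, ha U f, hb U f]
  zero_mem' U f := by simp only [map_zero]
  neg_mem' ha U f := by simp only [map_neg, ha U f]

/-- The functor `Γ_inv(G, ·)`. -/
noncomputable def Γinv : GSheaf G ⥤ AddCommGrpCat.{u} where
  obj F := AddCommGrpCat.of (invSections G F)
  map {F F'} φ := AddCommGrpCat.ofHom (AddMonoidHom.mk' (fun σ => ⟨φ.hom.app _ σ.1, fun U f => by
    rw [← NatTrans.naturality_apply, ← NatTrans.naturality_apply, σ.2 U f]⟩) fun σ τ =>
      Subtype.ext (map_add _ _ _))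

instance : (Γinv G).Additive where

/-- The complex `Γ_inv(G, T)`. -/
noncomputable def ΓinvComplex (T : CochainComplex (GSheaf G) ℕ) : CochainComplex AddCommGrpCat.{u} ℕ :=
  ((Γinv G).mapHomologicalComplex (ComplexShape.up ℕ)).obj T

variable {G}

/-- The hypercohomology `ℍⁿ(G, F)`: the cohomology of `Γ_inv(G, T)` for a quasi-isomorphism
`F → T` into a complex of injective `G`-sheaves. -/
noncomputable def HH (n : ℕ) (F : CochainComplex (GSheaf G) ℕ) : AddCommGrpCat.{u} :=
  (ΓinvComplex G (injRes F)).homology n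

/-- The morphism `ℍⁿ(G, F) → ℍⁿ(G, F')` induced by a morphism of complexes of `G`-sheaves. -/
noncomputable def HH.map (n : ℕ) {F F' : CochainComplex (GSheaf G) ℕ} (φ : F ⟶ F') :
    HH n F →+ HH n F' :=
  (HomologicalComplex.homologyMap (((Γinv G).mapHomologicalComplex (ComplexShape.up ℕ)).map
    (injLift (φ ≫ injResι F') (injective_injRes F'))) n).hom

lemma injective_sh {T : CochainComplex (GSheaf G) ℕ} (h : ∀ n, Injective (T.X n)) :
    ∀ n, Injective ((sh T).X n)
  | 0 => (Limits.isZero_zero _).injective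
  | n + 1 => h n

/-- The identification of the cohomology of `Γ_inv(T[-1])` in degree `n + 2` with that of
`Γ_inv(T)` in degree `n + 1`. -/
noncomputable def shHomologyIso (T : CochainComplex (GSheaf G) ℕ) (n : ℕ) :
    (ΓinvComplex G (sh T)).homology (n + 2) ≅ (ΓinvComplex G T).homology (n + 1) :=
  (ΓinvComplex G (sh T)).homologyIsoSc' (n + 1) (n + 2) (n + 3) (by simp) (by simp) ≪≫
    Iso.symm ((ΓinvComplex G T).homologyIsoSc' n (n + 1) (n + 2) (by simp) (by simp))

variable (G)

/-- The homomorphism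
`(2πi)^{-p+1} · ℍ^{n+2}(G, ℤ(p)_D^∞) → ℍ^{n+2}(G, ℂ^×(p)[-1]) = ℍ^{n+1}(G, ℂ^×(p))`
induced by the exponential map. -/
noncomputable def deligneExp (p n : ℕ) : HH (n + 2) (Deligne G p) →+ HH (n + 1) (Cx G p) :=
  (HomologicalComplex.homologyMap (((Γinv G).mapHomologicalComplex (ComplexShape.up ℕ)).map
    (injLift (expComplex G p ≫ shMap (injResι (Cx G p)))
      (injective_sh (injective_injRes (Cx G p))))) (n + 2) ≫ (shHomologyIso _ n).hom).hom

end Hypercohomology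

/-! ### Composable arrows, étale functors -/

lemma isLocalHomeomorph_pullback {P X Y Z : Type u} [TopologicalSpace P] [TopologicalSpace X]
    [TopologicalSpace Y] [TopologicalSpace Z] {f : X → Z} (hf : IsLocalHomeomorph f) {g : Y → Z}
    (hg : Continuous g) {a : P → Y} {b : P → X} (hi : IsInducing fun p => (a p, b p))
    (hc : ∀ p, g (a p) = f (b p)) (m : ∀ y x, g y = f x → P) (ha : ∀ y x h, a (m y x h) = y)
    (hb : ∀ y x h, b (m y x h) = x) (hm : ∀ p, m (a p) (b p) (hc p) = p) :
    IsLocalHomeomorph a := by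
  have hab := hi.continuous
  have hca : Continuous a := continuous_fst.comp hab
  have hcb : Continuous b := continuous_snd.comp hab
  classical
  refine IsLocalHomeomorph.mk a fun p₀ => ?_
  obtain ⟨e, he, hfe⟩ := hf (b p₀)
  have hfe' : ∀ x, f x = e x := fun x => by rw [hfe]
  have hinv : ∀ y, g y ∈ e.target → g y = f (e.symm (g y)) := fun y hy => by
    rw [hfe', e.right_inv hy]
  refine ⟨{
    toFun := a
    invFun := fun y => if hy : g y ∈ e.target then m y (e.symm (g y)) (hinv y hy) else p₀
    source := b ⁻¹' e.source
    target := g ⁻¹' e.target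
    map_source' := fun p hp => by
      change g (a p) ∈ e.target
      rw [hc, hfe']
      exact e.map_source hp
    map_target' := fun y hy => by
      have hy' : g y ∈ e.target := hy
      change b (dite _ _ _) ∈ e.source
      rw [dif_pos hy', hb]
      exact e.map_target hy
    left_inv' := fun p hp => by
      have h1 : g (a p) ∈ e.target := by
        rw [hc, hfe']
        exact e.map_source hp
      rw [dif_pos h1]
      have h2 : e.symm (g (a p)) = b p := by rw [hc, hfe', e.left_inv hp]
      refine Eq.trans ?_ (hm p)
      congr 1
    right_inv' := fun y hy => by
      have hy' : g y ∈ e.target := hy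
      rw [dif_pos hy', ha]
    open_source := e.open_source.preimage hcb
    open_target := e.open_target.preimage hg
    continuousOn_toFun := hca.continuousOn
    continuousOn_invFun := by
      rw [hi.continuousOn_iff]
      have : ContinuousOn (fun y => (y, e.symm (g y))) (g ⁻¹' e.target) :=
        continuousOn_id.prodMk (e.continuousOn_symm.comp hg.continuousOn fun _ h => h)
      refine this.congr fun y hy => ?_
      have hy' : g y ∈ e.target := hy
      simp only [Function.comp_apply, dif_pos hy', ha, hb] }, he, fun _ _ => rfl⟩

section Etale

variable {M N P : Type u} [TopologicalSpace M] [SmoothSpace M] [TopologicalSpace N] [SmoothSpace N]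
  [TopologicalSpace P] [SmoothSpace P]

/-- An étale map is smooth. -/
def IsEtale.smap {f : M → N} (h : IsEtale f) : SMap M N where
  toFun := f
  continuous := h.isLocalHomeomorph.continuous
  smooth hu := (h.smooth_iff (IsSmoothAt.continuousNear hu)).2 hu

lemma IsEtale.comp {f : M → N} {g : N → P} (hg : IsEtale g) (hf : IsEtale f) :
    IsEtale fun x => g (f x) where
  isLocalHomeomorph := hg.isLocalHomeomorph.comp hf.isLocalHomeomorph
  smooth_iff {_ u _} h := (hg.smooth_iff (u := f ∘ u) (h.mono fun _ hy =>
    hf.isLocalHomeomorph.continuous.continuousAt.comp hy)).trans (hf.smooth_iff h)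

lemma IsEtale.induced {M N : Type u} [TopologicalSpace M] [TopologicalSpace N] [SmoothSpace N]
    {f : M → N} (h : IsLocalHomeomorph f) :
    letI : SmoothSpace M := SmoothSpace.induced f
    IsEtale f :=
  letI : SmoothSpace M := SmoothSpace.induced f
  { isLocalHomeomorph := h
    smooth_iff := fun hu => ⟨fun h' => ⟨hu, h'⟩, fun h' => h'.2⟩ }

lemma IsEtale.of_comp {f : M → N} {g : N → P} (hg : IsEtale g) (hf : Continuous f)
    (h : IsEtale fun x => g (f x)) : IsEtale f where
  isLocalHomeomorph := h.isLocalHomeomorph.of_comp hg.isLocalHomeomorph hf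
  smooth_iff {_ u _} hu := (hg.smooth_iff (u := f ∘ u) (hu.mono fun _ hy =>
    hf.continuousAt.comp hy)).symm.trans (h.smooth_iff hu)

end Etale

namespace EtaleGroupoid

variable (G : EtaleGroupoid.{u})

/-- The space `G₂` of composable pairs of arrows `x₀ → x₁ → x₂`. -/
def Arr₂ : Type u := {p : G.Arr × G.Arr // G.tgt p.1 = G.src p.2}

instance : TopologicalSpace G.Arr₂ := inferInstanceAs (TopologicalSpace {_p : G.Arr × G.Arr // _})

/-- The smooth structure for which the étale map `(g₁, g₂) ↦ g₂` is smooth. -/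
instance : SmoothSpace G.Arr₂ := SmoothSpace.induced fun p => p.1.2

lemma continuous_fst : Continuous fun p : G.Arr₂ => p.1.1 :=
  _root_.continuous_fst.comp continuous_subtype_val

lemma etale_snd : IsEtale fun p : G.Arr₂ => p.1.2 := by
  refine IsEtale.induced (isLocalHomeomorph_pullback (b := fun p : G.Arr₂ => p.1.1)
    G.etale_tgt.isLocalHomeomorph G.etale_src.isLocalHomeomorph.continuous
    ?_ (fun p => p.2.symm) (fun y x h => ⟨(x, y), h.symm⟩) (fun _ _ _ => rfl) (fun _ _ _ => rfl)
    fun _ => rfl)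
  exact (Homeomorph.prodComm _ _).isInducing.comp IsInducing.subtypeVal

lemma etale_fst : IsEtale fun p : G.Arr₂ => p.1.1 := by
  refine G.etale_tgt.of_comp G.continuous_fst ?_
  rw [show (fun p : G.Arr₂ => G.tgt p.1.1) = fun p => G.src p.1.2 from funext fun p => p.2]
  exact G.etale_src.comp G.etale_snd

lemma etale_comp : IsEtale fun p : G.Arr₂ => G.mul p.1.1 p.1.2 p.2 := by
  refine G.etale_tgt.of_comp G.continuous_mul ?_
  simp only [G.tgt_mul]
  exact G.etale_tgt.comp G.etale_snd

end EtaleGroupoid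

/-- A morphism of étale groupoids given by étale maps. -/
structure EtaleFunctor (K G : EtaleGroupoid.{u}) where
  obj : K.Obj → G.Obj
  arr : K.Arr → G.Arr
  src_arr : ∀ k, G.src (arr k) = obj (K.src k)
  tgt_arr : ∀ k, G.tgt (arr k) = obj (K.tgt k)
  arr_one : ∀ x, arr (K.one x) = G.one (obj x)
  arr_mul : ∀ k l p, arr (K.mul k l p) =
    G.mul (arr k) (arr l) ((tgt_arr k).trans ((congrArg obj p).trans (src_arr l).symm))
  etale_obj : IsEtale obj
  continuous_arr : Continuous arr

/-- The étale Morita morphisms: `(src, tgt) : K₁ → K₀ × K₀` is the pull-back of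
`(src, tgt) : G₁ → G₀ × G₀` (as sets, and then also as spaces, since all the maps are étale), and
the étale map `K₀ ×_{G₀} G₁ → G₀`, `(x, g) ↦ src g`, is surjective. -/
structure EtaleFunctor.IsMorita {K G : EtaleGroupoid.{u}} (φ : EtaleFunctor K G) : Prop where
  cartesian : ∀ (x y : K.Obj) (g : G.Arr), G.src g = φ.obj x → G.tgt g = φ.obj y →
    ∃! k : K.Arr, K.src k = x ∧ K.tgt k = y ∧ φ.arr k = g
  surjective : ∀ y : G.Obj, ∃ (x : K.Obj) (g : G.Arr), φ.obj x = G.tgt g ∧ G.src g = y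

/-! ### The inertia groupoid -/

section Inertia

variable (G : EtaleGroupoid.{u})

namespace EtaleGroupoid

/-- The space `∧G₀` of loops, i.e. of arrows `a` with `src a = tgt a`. -/
def Loop : Type u := {a : G.Arr // G.src a = G.tgt a}

instance : TopologicalSpace G.Loop := inferInstanceAs (TopologicalSpace {_a : G.Arr // _})

/-- The smooth structure of the subspace `∧G₀ ⊆ G₁`. -/
instance : SmoothSpace G.Loop := SmoothSpace.induced Subtype.val

/-- The space `∧G₁` of composable pairs `(a, b)` with `a` a loop. -/
def LoopArr : Type u := {p : G.Arr₂ // G.src p.1.1 = G.tgt p.1.1}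

instance : TopologicalSpace G.LoopArr := inferInstanceAs (TopologicalSpace {_p : G.Arr₂ // _})

variable {G}

/-- The loop `a` underlying `(a, b)`. -/
def LoopArr.fst (p : G.LoopArr) : G.Loop := ⟨p.1.1.1, p.2⟩

/-- The arrow `b` underlying `(a, b)`. -/
def LoopArr.snd (p : G.LoopArr) : G.Arr := p.1.1.2

lemma LoopArr.eq (p : G.LoopArr) : G.tgt p.fst.1 = G.src p.snd := p.1.2

@[ext] lemma LoopArr.ext {p q : G.LoopArr} (h : p.fst.1 = q.fst.1) (h' : p.snd = q.snd) : p = q :=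
  Subtype.ext (Subtype.ext (Prod.ext h h'))

/-- The smooth structure for which the étale map `(a, b) ↦ a` is smooth. -/
instance : SmoothSpace G.LoopArr := SmoothSpace.induced LoopArr.fst

/-- The pair `(a, b)`. -/
def LoopArr.mk (a : G.Loop) (b : G.Arr) (h : G.tgt a.1 = G.src b) : G.LoopArr :=
  ⟨⟨(a.1, b), h⟩, a.2⟩

/-- The loop `b⁻¹ab`. -/
def LoopArr.conj (p : G.LoopArr) : G.Loop :=
  ⟨G.mul (G.mul (G.inv p.snd) p.fst.1 ((G.tgt_inv _).trans (p.eq.symm.trans p.fst.2.symm))) p.snd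
    ((G.tgt_mul _ _ _).trans p.eq), by
    rw [G.src_mul, G.tgt_mul, G.src_mul, G.src_inv]⟩

lemma LoopArr.src_conj (p : G.LoopArr) : G.src p.conj.1 = G.tgt p.snd := by
  simp only [LoopArr.conj, G.src_mul, G.src_inv]

lemma LoopArr.tgt_conj (p : G.LoopArr) : G.tgt p.conj.1 = G.tgt p.snd := by
  simp only [LoopArr.conj, G.tgt_mul]

lemma LoopArr.mul_conj (p : G.LoopArr) :
    G.mul p.snd p.conj.1 p.src_conj.symm = G.mul p.fst.1 p.snd p.eq := by
  have h1 : G.src (G.mul p.fst.1 p.snd p.eq) = G.src p.snd := by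
    rw [G.src_mul, p.fst.2, p.eq]
  have h2 : p.conj.1 = G.mul (G.inv p.snd) (G.mul p.fst.1 p.snd p.eq)
      ((G.tgt_inv _).trans h1.symm) := G.mul_assoc _ _ _ _ _
  rw [mul_congr rfl h2, ← G.mul_assoc _ _ _ (G.src_inv _).symm, mul_congr (G.mul_inv _) rfl,
    one_mul']

lemma mul_left_cancel {a b c : G.Arr} {p : G.tgt a = G.src b} {q : G.tgt a = G.src c}
    (h : G.mul a b p = G.mul a c q) : b = c := by
  have key : ∀ (b : G.Arr) (p : G.tgt a = G.src b), b = G.mul (G.inv a) (G.mul a b p)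
      ((G.tgt_inv a).trans (G.src_mul _ _ _).symm) := fun b p => by
    rw [← G.mul_assoc _ _ _ (G.tgt_inv a), mul_congr (G.inv_mul _) rfl, one_mul']
  rw [key b p, key c q]
  exact mul_congr rfl h

/-- `b⁻¹ab` is characterised by `b · b⁻¹ab = ab`. -/
lemma LoopArr.conj_eq {p : G.LoopArr} {c : G.Loop} (h : G.tgt p.snd = G.src c.1)
    (e : G.mul p.snd c.1 h = G.mul p.fst.1 p.snd p.eq) : p.conj = c :=
  Subtype.ext (mul_left_cancel (p.mul_conj.trans e.symm))

lemma LoopArr.continuous_fst : Continuous (LoopArr.fst (G := G)) :=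
  (G.continuous_fst.comp continuous_subtype_val).subtype_mk _

lemma LoopArr.continuous_snd : Continuous (LoopArr.snd (G := G)) :=
  G.etale_snd.isLocalHomeomorph.continuous.comp continuous_subtype_val

lemma continuous_mul' {X : Type u} [TopologicalSpace X] {f g : X → G.Arr} (hf : Continuous f)
    (hg : Continuous g) (h : ∀ x, G.tgt (f x) = G.src (g x)) :
    Continuous fun x => G.mul (f x) (g x) (h x) :=
  G.continuous_mul.comp ((hf.prodMk hg).subtype_mk h)

lemma LoopArr.continuous_mk {X : Type u} [TopologicalSpace X] {f : X → G.Loop} {g : X → G.Arr}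
    (hf : Continuous f) (hg : Continuous g) (h : ∀ x, G.tgt (f x).1 = G.src (g x)) :
    Continuous fun x => LoopArr.mk (f x) (g x) (h x) :=
  (((continuous_subtype_val.comp hf).prodMk hg).subtype_mk _).subtype_mk _

lemma LoopArr.continuous_conj : Continuous (LoopArr.conj (G := G)) := by
  refine Continuous.subtype_mk ?_ _
  exact continuous_mul' (continuous_mul' (G.continuous_inv.comp LoopArr.continuous_snd)
    (continuous_subtype_val.comp LoopArr.continuous_fst) _) LoopArr.continuous_snd _

lemma LoopArr.etale_fst : IsEtale (LoopArr.fst (G := G)) := by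
  refine IsEtale.induced (isLocalHomeomorph_pullback (b := LoopArr.snd)
    (g := fun a : G.Loop => G.tgt a.1)
    G.etale_src.isLocalHomeomorph
    (G.etale_tgt.isLocalHomeomorph.continuous.comp continuous_subtype_val)
    ?_ LoopArr.eq LoopArr.mk (fun _ _ _ => rfl) (fun _ _ _ => rfl) fun _ => rfl)
  refine IsInducing.of_comp (g := fun q : G.Loop × G.Arr => (q.1.1, q.2))
    (LoopArr.continuous_fst.prodMk LoopArr.continuous_snd) ?_
    (IsInducing.subtypeVal.comp IsInducing.subtypeVal)
  exact (continuous_subtype_val.comp _root_.continuous_fst).prodMk _root_.continuous_snd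

/-- The inverse `(b⁻¹ab, b⁻¹)` of `(a, b)`. -/
def LoopArr.inv (p : G.LoopArr) : G.LoopArr :=
  LoopArr.mk p.conj (G.inv p.snd) (p.tgt_conj.trans (G.src_inv _).symm)

lemma LoopArr.conj_inv (p : G.LoopArr) : p.inv.conj = p.fst := by
  refine LoopArr.conj_eq ((G.tgt_inv _).trans (p.eq.symm.trans p.fst.2.symm)) ?_
  have h1 : G.mul p.conj.1 (G.inv p.snd) (p.tgt_conj.trans (G.src_inv _).symm) = _ :=
    G.mul_assoc _ _ _ _ (G.src_inv _).symm
  refine Eq.trans ?_ h1.symm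
  rw [mul_congr (g := G.mul _ _ _) rfl (G.mul_inv _), mul_one']
  rfl

lemma LoopArr.inv_inv (p : G.LoopArr) : p.inv.inv = p := by
  refine LoopArr.ext (congrArg Subtype.val p.conj_inv) ?_
  change G.inv (G.inv p.snd) = p.snd
  refine mul_left_cancel (a := G.inv p.snd) (p := (G.src_inv _).symm) (q := G.tgt_inv _) ?_
  rw [G.mul_inv, G.inv_mul, G.src_inv]

lemma LoopArr.continuous_inv : Continuous (LoopArr.inv (G := G)) :=
  LoopArr.continuous_mk LoopArr.continuous_conj (G.continuous_inv.comp LoopArr.continuous_snd) _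

end EtaleGroupoid

end Inertia

section Inertia

namespace EtaleGroupoid

variable {G : EtaleGroupoid.{u}}

lemma Loop.isSmoothAt_iff {n : ℕ} {u : Eu n → G.Loop} {x : Eu n}
    (hu : ∀ᶠ y in 𝓝 x, ContinuousAt u y) :
    IsSmoothAt u x ↔ IsSmoothAt (fun y => (u y).1) x :=
  ⟨fun h => h.2, fun h => ⟨hu, h⟩⟩

lemma Loop.isInducing (G : EtaleGroupoid.{u}) : IsInducing fun a : G.Loop => a.1 :=
  IsInducing.subtypeVal

lemma LoopArr.isSmoothAt_iff_snd {n : ℕ} {u : Eu n → G.LoopArr} {x : Eu n}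
    (hu : ∀ᶠ y in 𝓝 x, ContinuousAt u y) :
    IsSmoothAt u x ↔ IsSmoothAt (fun y => (u y).snd) x := by
  have h1 : ∀ᶠ y in 𝓝 x, ContinuousAt (fun y => (u y).fst) y :=
    hu.mono fun _ hy => LoopArr.continuous_fst.continuousAt.comp hy
  have h2 : ∀ᶠ y in 𝓝 x, ContinuousAt (fun y => (u y).fst.1) y :=
    h1.mono fun _ hy => continuous_subtype_val.continuousAt.comp hy
  have h3 : ∀ᶠ y in 𝓝 x, ContinuousAt (fun y => (u y).snd) y :=
    hu.mono fun _ hy => LoopArr.continuous_snd.continuousAt.comp hy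
  refine (LoopArr.etale_fst.smooth_iff hu).symm.trans ((Loop.isSmoothAt_iff h1).trans
    ((G.etale_tgt.smooth_iff h2).symm.trans (Iff.trans ?_ (G.etale_src.smooth_iff h3))))
  rw [show (G.tgt ∘ fun y => (u y).fst.1) = G.src ∘ fun y => (u y).snd from
    funext fun y => (u y).eq]

lemma LoopArr.etale_conj : IsEtale (LoopArr.conj (G := G)) where
  isLocalHomeomorph := by
    have h : IsLocalHomeomorph (LoopArr.inv (G := G)) :=
      Homeomorph.isLocalHomeomorph
        { toFun := LoopArr.inv
          invFun := LoopArr.inv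
          left_inv := LoopArr.inv_inv
          right_inv := LoopArr.inv_inv
          continuous_toFun := LoopArr.continuous_inv
          continuous_invFun := LoopArr.continuous_inv }
    exact LoopArr.etale_fst.isLocalHomeomorph.comp h
  smooth_iff {n u x} hu := by
    have h1 : ∀ᶠ y in 𝓝 x, ContinuousAt (fun y => (u y).conj) y :=
      hu.mono fun _ hy => LoopArr.continuous_conj.continuousAt.comp hy
    have h2 : ∀ᶠ y in 𝓝 x, ContinuousAt (fun y => (u y).conj.1) y :=
      h1.mono fun _ hy => continuous_subtype_val.continuousAt.comp hy
    have h3 : ∀ᶠ y in 𝓝 x, ContinuousAt (fun y => (u y).snd) y :=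
      hu.mono fun _ hy => LoopArr.continuous_snd.continuousAt.comp hy
    refine (Loop.isSmoothAt_iff h1).trans ((G.etale_tgt.smooth_iff h2).symm.trans
      (Iff.trans ?_ ((G.etale_tgt.smooth_iff h3).trans (LoopArr.isSmoothAt_iff_snd hu).symm)))
    rw [show (G.tgt ∘ fun y => (u y).conj.1) = G.tgt ∘ fun y => (u y).snd from
      funext fun y => (u y).tgt_conj]

/-- The unit `(a, 1)`. -/
def LoopArr.one (a : G.Loop) : G.LoopArr := LoopArr.mk a (G.one (G.tgt a.1)) (G.src_one _).symm

lemma LoopArr.conj_one (a : G.Loop) : (LoopArr.one a).conj = a := by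
  refine LoopArr.conj_eq ((G.tgt_one _).trans a.2.symm) ?_
  exact (one_mul' _).trans (mul_one' _).symm

/-- The composite `(a, bd)` of `(a, b)` and `(b⁻¹ab, d)`. -/
def LoopArr.mul (p q : G.LoopArr) (h : p.conj = q.fst) : G.LoopArr :=
  LoopArr.mk p.fst (G.mul p.snd q.snd (by rw [← q.eq, ← h, p.tgt_conj]))
    (p.eq.trans (G.src_mul _ _ _).symm)

lemma LoopArr.conj_mul (p q : G.LoopArr) (h : p.conj = q.fst) : (p.mul q h).conj = q.conj := by
  have h1 : G.tgt p.snd = G.src q.snd := by rw [← q.eq, ← h, p.tgt_conj]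
  refine LoopArr.conj_eq ((G.tgt_mul _ _ _).trans q.src_conj.symm) ?_
  have e1 : G.mul (G.mul p.snd q.snd h1) q.conj.1 ((G.tgt_mul _ _ _).trans q.src_conj.symm) =
    G.mul p.snd (G.mul q.snd q.conj.1 q.src_conj.symm) (h1.trans (G.src_mul _ _ _).symm) :=
    G.mul_assoc _ _ _ _ _
  have e2 := q.mul_conj
  have e3 : G.mul q.fst.1 q.snd q.eq = G.mul p.conj.1 q.snd (by rw [h]; exact q.eq) :=
    mul_congr (by rw [h]) rfl
  have h2 : G.tgt p.snd = G.src p.conj.1 := p.src_conj.symm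
  have e4 : G.mul (G.mul p.snd p.conj.1 h2) q.snd _ = G.mul p.snd (G.mul p.conj.1 q.snd _) _ :=
    G.mul_assoc p.snd p.conj.1 q.snd h2 (by rw [h]; exact q.eq)
  have e5 : G.mul (G.mul p.fst.1 p.snd p.eq) q.snd _ = G.mul p.fst.1 (G.mul p.snd q.snd _) _ :=
    G.mul_assoc p.fst.1 p.snd q.snd p.eq h1
  refine e1.trans ?_
  rw [mul_congr rfl (e2.trans e3), ← e4, mul_congr p.mul_conj rfl]
  exact e5

lemma LoopArr.continuous_mul : Continuous
    fun p : {p : G.LoopArr × G.LoopArr // p.1.conj = p.2.fst} => LoopArr.mul p.1.1 p.1.2 p.2 := by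
  have h1 : Continuous fun p : {p : G.LoopArr × G.LoopArr // p.1.conj = p.2.fst} => p.1.1 :=
    _root_.continuous_fst.comp continuous_subtype_val
  have h2 : Continuous fun p : {p : G.LoopArr × G.LoopArr // p.1.conj = p.2.fst} => p.1.2 :=
    _root_.continuous_snd.comp continuous_subtype_val
  exact LoopArr.continuous_mk (LoopArr.continuous_fst.comp h1)
    (continuous_mul' (LoopArr.continuous_snd.comp h1) (LoopArr.continuous_snd.comp h2) _) _

end EtaleGroupoid

open EtaleGroupoid

/-- The inertia groupoid `∧G`: its objects are the loops `a ∈ G₁`, its arrows the composable pairs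
`(a, b)` with `a` a loop, and `(a, b)` goes from `a` to `b⁻¹ab`. -/
def inertia (G : EtaleGroupoid.{u}) : EtaleGroupoid.{u} where
  Obj := G.Loop
  Arr := G.LoopArr
  src := LoopArr.fst
  tgt := LoopArr.conj
  one := LoopArr.one
  inv := LoopArr.inv
  mul := LoopArr.mul
  src_one _ := rfl
  tgt_one := LoopArr.conj_one
  src_inv _ := rfl
  tgt_inv := LoopArr.conj_inv
  src_mul _ _ _ := rfl
  tgt_mul := LoopArr.conj_mul
  one_mul _ := LoopArr.ext rfl (one_mul' _)
  mul_one _ := LoopArr.ext rfl (mul_one' _)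
  inv_mul p := LoopArr.ext rfl ((G.inv_mul _).trans (congrArg G.one p.tgt_conj.symm))
  mul_inv p := LoopArr.ext rfl ((G.mul_inv _).trans (congrArg G.one p.eq.symm))
  mul_assoc _ _ _ _ _ := LoopArr.ext rfl (G.mul_assoc _ _ _ _ _)
  continuous_one := LoopArr.continuous_mk continuous_id (G.continuous_one.comp
    (G.etale_tgt.isLocalHomeomorph.continuous.comp continuous_subtype_val)) _
  continuous_inv := LoopArr.continuous_inv
  continuous_mul := LoopArr.continuous_mul
  etale_src := LoopArr.etale_fst
  etale_tgt := LoopArr.etale_conj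

namespace EtaleFunctor

variable {K G : EtaleGroupoid.{u}} (φ : EtaleFunctor K G)

lemma etale_arr : IsEtale φ.arr := by
  refine G.etale_src.of_comp φ.continuous_arr ?_
  simp only [φ.src_arr]
  exact φ.etale_obj.comp K.etale_src

/-- The action on loops. -/
def loop (a : K.Loop) : G.Loop := ⟨φ.arr a.1, by rw [φ.src_arr, φ.tgt_arr, a.2]⟩

lemma continuous_loop : Continuous φ.loop :=
  (φ.continuous_arr.comp continuous_subtype_val).subtype_mk _

lemma etale_loop : IsEtale φ.loop where
  isLocalHomeomorph := by
    -- near a loop, the loops of `K` are the preimages of the loops of `G`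
    classical
    refine IsLocalHomeomorph.mk _ fun a => ?_
    obtain ⟨e, he, hfe⟩ := φ.etale_arr.isLocalHomeomorph a.1
    have hfe' : ∀ x, φ.arr x = e x := fun x => by rw [hfe]
    obtain ⟨V', hVo, haV, hinj⟩ := φ.etale_obj.isLocalHomeomorph.isLocallyInjective (K.src a.1)
    let O : Set K.Arr := K.src ⁻¹' V' ∩ K.tgt ⁻¹' V'
    have hO : IsOpen O := (hVo.preimage K.etale_src.isLocalHomeomorph.continuous).inter
      (hVo.preimage K.etale_tgt.isLocalHomeomorph.continuous)
    have haO : a.1 ∈ O := ⟨haV, by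
      change K.tgt a.1 ∈ V'
      rw [← a.2]; exact haV⟩
    have hloop : ∀ k ∈ O, G.src (φ.arr k) = G.tgt (φ.arr k) → K.src k = K.tgt k := by
      intro k hk h
      rw [φ.src_arr, φ.tgt_arr] at h
      exact hinj hk.1 hk.2 h
    let e' := e.restrOpen O hO
    have he' : ∀ g : G.Loop, g.1 ∈ e'.target →
        K.src (e'.symm g.1) = K.tgt (e'.symm g.1) := by
      intro g hg
      have h1 : e'.symm g.1 ∈ e'.source := e'.map_target hg
      refine hloop _ h1.2 ?_
      have h2 : φ.arr (e'.symm g.1) = g.1 := (hfe' _).trans (e'.right_inv hg)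
      rw [h2, g.2]
    let r : G.Loop → K.Loop := fun g =>
      if hg : e'.symm g.1 ∈ {k | K.src k = K.tgt k} then ⟨e'.symm g.1, hg⟩ else a
    have hr : ∀ g : G.Loop, g.1 ∈ e'.target → (r g).1 = e'.symm g.1 := fun g hg =>
      congrArg Subtype.val (dif_pos (he' g hg))
    have hl : ∀ b : K.Loop, (φ.loop b).1 = e' b.1 := fun b => hfe' b.1
    refine ⟨{
      toFun := φ.loop
      invFun := r
      source := {b | b.1 ∈ e'.source}
      target := {g | g.1 ∈ e'.target}
      map_source' := fun b hb => by
        change (φ.loop b).1 ∈ e'.target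
        rw [hl]
        exact e'.map_source hb
      map_target' := fun g hg => by
        change (r g).1 ∈ e'.source
        rw [hr g hg]
        exact e'.map_target hg
      left_inv' := fun b hb => by
        have h1 : (φ.loop b).1 ∈ e'.target := by
          rw [hl]
          exact e'.map_source hb
        refine Subtype.ext ((hr _ h1).trans ?_)
        rw [hl]
        exact e'.left_inv hb
      right_inv' := fun g hg => by
        refine Subtype.ext ((hl _).trans ?_)
        rw [hr g hg]
        exact e'.right_inv hg
      open_source := e'.open_source.preimage continuous_subtype_val
      open_target := e'.open_target.preimage continuous_subtype_val
      continuousOn_toFun := φ.continuous_loop.continuousOn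
      continuousOn_invFun := by
        refine (Loop.isInducing K).continuousOn_iff.2 ?_
        have : ContinuousOn (fun g : G.Loop => e'.symm g.1) {g | g.1 ∈ e'.target} :=
          e'.continuousOn_symm.comp continuous_subtype_val.continuousOn fun _ h => h
        exact this.congr fun g hg => hr g hg }, ⟨he, haO⟩, fun _ _ => rfl⟩
  smooth_iff {n u x} hu := by
    have h1 : ∀ᶠ y in 𝓝 x, ContinuousAt (fun y => (u y).1) y :=
      hu.mono fun _ hy => continuous_subtype_val.continuousAt.comp hy
    have h2 : ∀ᶠ y in 𝓝 x, ContinuousAt (fun y => φ.loop (u y)) y :=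
      hu.mono fun _ hy => φ.continuous_loop.continuousAt.comp hy
    exact (Loop.isSmoothAt_iff h2).trans ((φ.etale_arr.smooth_iff h1).trans
      (Loop.isSmoothAt_iff hu).symm)

/-- The action on the arrows of the inertia groupoids. -/
def loopArr (p : K.LoopArr) : G.LoopArr := LoopArr.mk (φ.loop p.fst) (φ.arr p.snd)
  ((φ.tgt_arr _).trans ((congrArg φ.obj p.eq).trans (φ.src_arr _).symm))

lemma conj_loopArr (p : K.LoopArr) : (φ.loopArr p).conj = φ.loop p.conj := by
  refine LoopArr.conj_eq ((φ.tgt_arr _).trans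
    ((congrArg φ.obj p.src_conj.symm).trans (φ.src_arr _).symm)) ?_
  exact (φ.arr_mul _ _ p.src_conj.symm).symm.trans
    ((congrArg φ.arr p.mul_conj).trans (φ.arr_mul _ _ _))

/-- The functor `∧K → ∧G` induced by `K → G`. -/
def inertia : EtaleFunctor (inertia K) (inertia G) where
  obj := φ.loop
  arr := φ.loopArr
  src_arr _ := rfl
  tgt_arr := φ.conj_loopArr
  arr_one _ := LoopArr.ext rfl ((φ.arr_one _).trans (congrArg G.one (φ.tgt_arr _).symm))
  arr_mul _ _ _ := LoopArr.ext rfl (φ.arr_mul _ _ _)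
  etale_obj := φ.etale_loop
  continuous_arr := LoopArr.continuous_mk (φ.continuous_loop.comp LoopArr.continuous_fst)
    (φ.continuous_arr.comp LoopArr.continuous_snd) _

end EtaleFunctor

end Inertia

/-! ### Gerbes and line bundles with connection -/

section Cech

/-- A gerbe with connection on `K`: a triple `(h, A, B)` with `h : K₂ → ℂ^×`, `A ∈ A¹(K₁)` and
`B ∈ A²(K₀)` such that `s^*B - t^*B = dA`, `pr₂^*A - m^*A + pr₁^*A = d log h` and
`h(k₂, k₃) h(k₁k₂, k₃)⁻¹ h(k₁, k₂k₃) h(k₁, k₂)⁻¹ = 1`. -/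
structure GerbeConn (K : EtaleGroupoid.{u}) where
  h : smoothUnits K.Arr₂
  A : Form 1 K.Arr
  B : Form 2 K.Obj
  δB : Form.pull K.etale_src.smap B - Form.pull K.etale_tgt.smap B = Form.d A
  δA : Form.pull K.etale_snd.smap A - Form.pull K.etale_comp.smap A +
    Form.pull K.etale_fst.smap A = dlog h
  δh : ∀ (k l m : K.Arr) (p : K.tgt k = K.src l) (q : K.tgt l = K.src m),
    h.1 ⟨(l, m), q⟩ - h.1 ⟨(K.mul k l p, m), (K.tgt_mul _ _ _).trans q⟩ +
      h.1 ⟨(k, K.mul l m q), p.trans (K.src_mul _ _ _).symm⟩ - h.1 ⟨(k, l), p⟩ = 0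

/-- A line bundle with connection on `K`: a morphism of groupoids `ρ : K → ℂ^×` and a form
`∇ ∈ A¹(K₀)` such that `s^*∇ - t^*∇ = d log ρ`. -/
structure LineBundleConn (K : EtaleGroupoid.{u}) where
  ρ : smoothUnits K.Arr
  conn : Form 1 K.Obj
  ρ_mul : ∀ (k l : K.Arr) (p : K.tgt k = K.src l), ρ.1 (K.mul k l p) = ρ.1 k + ρ.1 l
  δconn : Form.pull K.etale_src.smap conn - Form.pull K.etale_tgt.smap conn = dlog ρ

variable {K G : EtaleGroupoid.{u}}

/-- The sections over `E` of the pull-back of a `G`-sheaf `F` to a space `E` étale over `G`, i.e. the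
compatible families of sections `c(j) ∈ F(U)` for all morphisms `j : U ⟶ E` from open subsets
(`c(j)` is the pull-back of the section along `j`). -/
structure Sec (E : EtSp G) (F : GSheaf G) where
  val : ∀ U : Opens G.Obj, (openSp G U ⟶ E) → F.obj.obj (op (st U))
  val_comp : ∀ (U V : Opens G.Obj) (f : st U ⟶ st V) (j : openSp G V ⟶ E),
    val U (f.hom ≫ j) = F.obj.map f.op (val V j)

namespace EtaleFunctor

variable (φ : EtaleFunctor K G)

/-- `K₀` as a space étale over `G`. -/
def E₀ : EtSp G where
  carrier := K.Obj
  proj := φ.obj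
  etale := φ.etale_obj

/-- `K₁` as a space étale over `G`, by `ε₁ = tgt`. -/
def E₁ : EtSp G where
  carrier := K.Arr
  proj k := φ.obj (K.tgt k)
  etale := φ.etale_obj.comp K.etale_tgt

/-- `K₂` as a space étale over `G`, by `ε₂(k₁, k₂) = tgt k₂`. -/
def E₂ : EtSp G where
  carrier := K.Arr₂
  proj p := φ.obj (K.tgt p.1.2)
  etale := (φ.etale_obj.comp K.etale_tgt).comp K.etale_snd

/-- The face `k ↦ tgt k`. -/
def face₁₀ : φ.E₁ ⟶ φ.E₀ where
  map := K.tgt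
  arr k := G.one (φ.obj (K.tgt k))
  continuous_map := K.etale_tgt.isLocalHomeomorph.continuous
  continuous_arr := G.continuous_one.comp φ.E₁.etale.isLocalHomeomorph.continuous
  src_arr _ := G.src_one _
  tgt_arr _ := G.tgt_one _

/-- The face `k ↦ src k`; sections over `K₀` are moved by the arrow `k`. -/
def face₁₁ : φ.E₁ ⟶ φ.E₀ where
  map := K.src
  arr := φ.arr
  continuous_map := K.etale_src.isLocalHomeomorph.continuous
  continuous_arr := φ.continuous_arr
  src_arr := φ.src_arr
  tgt_arr := φ.tgt_arr

/-- The face `(k₁, k₂) ↦ k₂`. -/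
def face₂₀ : φ.E₂ ⟶ φ.E₁ where
  map p := p.1.2
  arr p := G.one (φ.obj (K.tgt p.1.2))
  continuous_map := K.etale_snd.isLocalHomeomorph.continuous
  continuous_arr := G.continuous_one.comp φ.E₂.etale.isLocalHomeomorph.continuous
  src_arr _ := G.src_one _
  tgt_arr _ := G.tgt_one _

/-- The face `(k₁, k₂) ↦ k₁k₂`. -/
def face₂₁ : φ.E₂ ⟶ φ.E₁ where
  map p := K.mul p.1.1 p.1.2 p.2
  arr p := G.one (φ.obj (K.tgt p.1.2))
  continuous_map := K.continuous_mul
  continuous_arr := G.continuous_one.comp φ.E₂.etale.isLocalHomeomorph.continuous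
  src_arr _ := (G.src_one _).trans (congrArg φ.obj (K.tgt_mul _ _ _).symm)
  tgt_arr _ := G.tgt_one _

/-- The face `(k₁, k₂) ↦ k₁`; sections over `K₁` are moved by the arrow `k₂`. -/
def face₂₂ : φ.E₂ ⟶ φ.E₁ where
  map p := p.1.1
  arr p := φ.arr p.1.2
  continuous_map := K.continuous_fst
  continuous_arr := φ.continuous_arr.comp K.etale_snd.isLocalHomeomorph.continuous
  src_arr p := (φ.src_arr _).trans (congrArg φ.obj p.2.symm)
  tgt_arr _ := φ.tgt_arr _

end EtaleFunctor

/-- The pull-back of a form on `E` along `j : U ⟶ E`, as a section of `𝒜^p` over `U`. -/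
noncomputable def pullForm {E : EtSp G} {p : ℕ} (α : Form p E) {U : Opens G.Obj}
    (j : openSp G U ⟶ E) : (formSheaf G p).obj.obj (op (st U)) :=
  Form.pull (EtSp.smap j) α

/-- The pull-back of a `ℂ^×`-valued function on `E` along `j : U ⟶ E`, as a section over `U`. -/
noncomputable def pullUnits {E : EtSp G} (f : smoothUnits E) {U : Opens G.Obj}
    (j : openSp G U ⟶ E) : (unitsSheaf G).obj.obj (op (st U)) :=
  smoothUnits.pull (EtSp.smap j) f

/-- The map on sections over `U` given by a morphism of `G`-sheaves. -/
noncomputable def onSec {F F' : GSheaf G} (f : F ⟶ F') {U : Opens G.Obj} :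
    F.obj.obj (op (st U)) →+ F'.obj.obj (op (st U)) :=
  (f.hom.app (op (st U))).hom

/-- The restriction to `U` of a global section of a `G`-sheaf. -/
noncomputable def restr {F : GSheaf G} (σ : F.obj.obj (op (st (⊤ : Opens G.Obj)))) (U : Opens G.Obj) :
    F.obj.obj (op (st U)) :=
  F.obj.map (incl (le_top : U ≤ ⊤)).op σ

/-- The invariant global section of `Tⁿ` given by an `n`-cocycle of `Γ_inv(G, T)`. -/
noncomputable def cocycleSec {T : CochainComplex (GSheaf G) ℕ} {n : ℕ}
    (z : (ΓinvComplex G T).cycles n) : (T.X n).obj.obj (op (st (⊤ : Opens G.Obj))) :=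
  ((show invSections G (T.X n) from ((ΓinvComplex G T).iCycles n).hom z)).1

/-- The gerbe with connection `(h, A, B)` on `K`, where `φ : K → G`, represents the class
`x ∈ ℍ²(G, ℂ^× → 𝒜¹ → 𝒜²)`: for the resolution `ι : (ℂ^× → 𝒜¹ → 𝒜²) → T` by injectives, the class
`x` is given by an invariant cocycle `t` of `T²` whose image in the double complex of the sections
of `T^•` over `K_•` is cohomologous to `ι(h, A, B)`. -/
def GerbeConn.Represents (φ : EtaleFunctor K G) (𝒢 : GerbeConn K) (x : HH 2 (Cx G 3)) : Prop :=
  ∃ (t : (ΓinvComplex G (injRes (Cx G 3))).cycles 2)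
    (c₁ : Sec φ.E₁ ((injRes (Cx G 3)).X 0)) (c₀ : Sec φ.E₀ ((injRes (Cx G 3)).X 1)),
    ((ΓinvComplex G (injRes (Cx G 3))).homologyπ 2).hom t = x ∧
    (∀ (U : Opens G.Obj) (j : openSp G U ⟶ φ.E₂),
      onSec ((injResι (Cx G 3)).f 0) (pullUnits 𝒢.h j) =
        c₁.val U (j ≫ φ.face₂₀) - c₁.val U (j ≫ φ.face₂₁) + c₁.val U (j ≫ φ.face₂₂)) ∧
    (∀ (U : Opens G.Obj) (j : openSp G U ⟶ φ.E₁),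
      onSec ((injResι (Cx G 3)).f 1) (pullForm 𝒢.A j) =
        onSec ((injRes (Cx G 3)).d 0 1) (c₁.val U j) +
          (c₀.val U (j ≫ φ.face₁₁) - c₀.val U (j ≫ φ.face₁₀))) ∧
    (∀ (U : Opens G.Obj) (j : openSp G U ⟶ φ.E₀),
      onSec ((injResι (Cx G 3)).f 2) (pullForm 𝒢.B j) =
        restr (cocycleSec t) U + onSec ((injRes (Cx G 3)).d 1 2) (c₀.val U j))

/-- The line bundle with connection `(ρ, ∇)` on `K`, where `φ : K → G`, represents the class
`x ∈ ℍ¹(G, ℂ^× → 𝒜¹)`: for the resolution `ι : (ℂ^× → 𝒜¹) → T` by injectives, the class `x` is given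
by an invariant cocycle `t` of `T¹` whose image in the double complex of the sections of `T^•` over
`K_•` is cohomologous to `ι(ρ, ∇)`. -/
def LineBundleConn.Represents (φ : EtaleFunctor K G) (L : LineBundleConn K) (x : HH 1 (Cx G 2)) :
    Prop :=
  ∃ (t : (ΓinvComplex G (injRes (Cx G 2))).cycles 1)
    (c₀ : Sec φ.E₀ ((injRes (Cx G 2)).X 0)),
    ((ΓinvComplex G (injRes (Cx G 2))).homologyπ 1).hom t = x ∧
    (∀ (U : Opens G.Obj) (j : openSp G U ⟶ φ.E₁),
      onSec ((injResι (Cx G 2)).f 0) (pullUnits L.ρ j) =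
        c₀.val U (j ≫ φ.face₁₁) - c₀.val U (j ≫ φ.face₁₀)) ∧
    (∀ (U : Opens G.Obj) (j : openSp G U ⟶ φ.E₀),
      onSec ((injResι (Cx G 2)).f 1) (pullForm L.conn j) =
        restr (cocycleSec t) U + onSec ((injRes (Cx G 2)).d 0 1) (c₀.val U j))

/-- The inclusion `∧K₀ → K₁` is smooth. -/
def loopIncl (K : EtaleGroupoid.{u}) : SMap K.Loop K.Arr where
  toFun := Subtype.val
  continuous := continuous_subtype_val
  smooth h := h.2

end Cech

end Holonomy

open Holonomy

/-!
Write `β : ∧G → G` for the map `a ↦ s(a)`. The holonomy is the composite of the restriction along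
`β`, an operation of degree `-1` on the cohomology of `∧G`, and the truncation `ℂ^×(3) → ℂ^×(2)`.

The operation of degree `-1` comes from the centre of the inertia groupoid. The loop `a` is an
automorphism of the object `a` of `∧G`, and it commutes with all arrows, so it acts on every sheaf
on `∧G` by a natural automorphism `Θ`. The underlying map of spaces being the identity, `Θ` is the
identity on functions and on forms; and it fixes all invariant sections. Let `m : ℂ^×(3) → M` be a
monomorphism into a complex of injective sheaves, and a quasi-isomorphism. Then `Θ - 1` vanishes on
the subcomplex, hence has a null-homotopy `H` with `m H = 0` (`exists_relative_homotopy`). As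
`Θ = 1` on invariant sections, `H` anticommutes there with the differential (`Γmap_d_H`), and so
lowers the degree in cohomology by one (`HolonomyData.op`, `HolonomyData.exists_holo`). The
restriction along `β` is a map `ℂ^×(3) → β_* ℂ^×(3)` on `G`; it extends to resolutions because
`β_*` preserves injective sheaves (`injective_push`).

To compute this for a gerbe on `K`, one works in the double complex of sections of `M` over the
nerve of `∧K`. The maps which insert `(a, a)` into a chain of arrows give another homotopy from `Θ`
to `1` (`EtaleFunctor.pull_diag₀_δ₀`, `EtaleFunctor.pull_diag_δ₁`). It takes the restriction of
`(h, A, B)` to the pair `(ρ, ∇)`, while `H` vanishes on the image of `m`; the difference of the two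
homotopies shows that `(ρ, ∇)` represents the holonomy class (`exists_restricted_cochain`,
`exists_looped_cochain`, `exists_truncated_cochain`, `represents_holo`).

The classes are flat because the composite `ℂ^×(3) → ℂ^×(2) → 𝒜²[-1]` of the truncation and the
curvature is null-homotopic, by the identity of `𝒜²` (`curvatureHomotopy`, `curvature_holo`). The
vertical maps are isomorphisms because of the exponential sequence: on a manifold, smooth functions
are continuous and have local logarithms (`quasiIso_expComplex`, `bijective_deligneExp`).

That a cocycle on `K` has a unique class means that the Čech complex of a Morita morphism `K → G`
with values in an injective sheaf is a resolution of the invariant sections. In degree `0` this is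
descent (`exists_ofInv_eq`), valid for all sheaves. In higher degrees one may replace the injective
sheaf, a retract of a product of skyscraper sheaves (`exists_retract_skySheaf`), by such a product;
the sections over a space are then the functions on its fibres, and the fibres of the nerve of `K`
are the simplicial sets of tuples of points of a non-empty set, which are contractible
(`exists_δ₀_eq_sky`, `exists_δ₁_eq_sky`). The same description of sections shows that `β_*`
preserves injective sheaves.
-/

namespace Holonomy

open Limits
open Holonomy.SmoothSpace (IsSmoothAt)

/-! ### Complexes of injectives -/

section HomologicalAlgebra

variable {C : Type u} [Category.{v} C] [Abelian C]

attribute [local instance] HasDerivedCategory.standard in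
open DerivedCategory in
/-- Maps into complexes of injectives are determined, up to homotopy, by their composites with a
quasi-isomorphism. -/
lemma nullHomotopic_of_quasiIso_comp {F T I : CochainComplex C ℕ} (ι : F ⟶ T) (hι : QuasiIso ι)
    (hI : ∀ n, Injective (I.X n)) (g : T ⟶ I) (h : Homotopy (ι ≫ g) 0) :
    Nonempty (Homotopy g 0) := by
  let e := ComplexShape.embeddingUpNat
  let q := HomotopyCategory.quotient C (ComplexShape.up ℤ)
  let ι' := (e.extendFunctor C).map ι
  have hι' : QuasiIso ι' := (HomologicalComplex.quasiIso_extendMap_iff ι e).2 hι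
  have : IsIso (Qh.map (q.map ι')) := by
    have h1 : IsIso (Q.map ι') := inferInstance
    exact (NatIso.isIso_map_iff (quotientCompQhIso C) ι').2 h1
  have h0 : q.map (ι' ≫ (e.extendFunctor C).map g) = 0 := by
    rw [← Functor.map_comp]
    have := HomotopyCategory.eq_of_homotopy _ _ (h.extend e)
    exact this.trans ((e.extendFunctor C ⋙ q).map_zero _ _)
  refine ⟨Homotopy.ofExtend (e := e) (HomotopyCategory.homotopyOfEq _ _ ?_)⟩
  refine (CochainComplex.IsKInjective.Qh_map_bijective _ _).injective ?_
  change Qh.map (q.map ((e.extendFunctor C).map g)) = Qh.map (q.map ((e.extendFunctor C).map 0))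
  rw [← cancel_epi (Qh.map (q.map ι')), ← Functor.map_comp, ← Functor.map_comp, h0,
    Functor.map_zero, Functor.map_zero, Functor.map_zero, Functor.map_zero, comp_zero]

lemma nullHomotopic_of_acyclic {Q I : CochainComplex C ℕ} (hQ : Q.Acyclic)
    (hI : ∀ n, Injective (I.X n)) (f : Q ⟶ I) : Nonempty (Homotopy f 0) := by
  have h : QuasiIso (0 : Q ⟶ Q) := ⟨fun n => by
    rw [quasiIsoAt_iff_isIso_homologyMap]
    have hz := (Q.exactAt_iff_isZero_homology n).1 (hQ n)
    exact ⟨0, hz.eq_of_src _ _, hz.eq_of_src _ _⟩⟩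
  exact nullHomotopic_of_quasiIso_comp 0 h hI f (Homotopy.ofEq zero_comp)

open CochainComplex.Plus.modelCategoryQuillen in
/-- Every cochain complex in non-negative degrees has a quasi-isomorphism into a complex of
injectives which is a monomorphism in each degree. -/
lemma exists_mono_injectiveResolution [EnoughInjectives C] (F : CochainComplex C ℕ) :
    ∃ (T : CochainComplex C ℕ) (ι : F ⟶ T), QuasiIso ι ∧ (∀ n, Mono (ι.f n)) ∧
      ∀ n, Injective (T.X n) := by
  let I : ℕ → C := fun n => Injective.under (F.X n)
  let J : CochainComplex C ℕ := CochainComplex.of (fun n => I n ⊞ I (n + 1))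
    (fun n => biprod.snd ≫ biprod.inl) (fun n => by simp)
  -- the embedding `x ↦ (x, dx)` into a complex of injectives
  let j : F ⟶ J :=
    { f := fun n => biprod.lift (Injective.ι (F.X n)) (F.d n (n + 1) ≫ Injective.ι (F.X (n + 1)))
      comm' := by
        rintro n _ (rfl : _ = _)
        rw [show J.d n (n + 1) = biprod.snd ≫ biprod.inl from
          CochainComplex.of_d (fun n => I n ⊞ I (n + 1)) (fun n => biprod.snd ≫ biprod.inl) n]
        ext <;> simp [I] }
  let e := ComplexShape.embeddingUpNat
  have h0 : ∀ j : ℕ, e.f j = (j : ℤ) := fun j => rfl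
  have hge : ∀ K : CochainComplex C ℕ, CochainComplex.IsStrictlyGE (K.extend e) 0 := by
    intro K
    rw [CochainComplex.isStrictlyGE_iff]
    intro i hi
    exact K.isZero_extend_X e i fun j => by rw [h0]; omega
  have h1 := hge F
  have h2 := hge J
  have hj' : Mono (HomologicalComplex.extendMap j e) :=
    HomologicalComplex.mono_of_mono_f _ fun n => by
      by_cases hn : 0 ≤ n
      · obtain ⟨k, rfl⟩ := Int.eq_ofNat_of_zero_le hn
        rw [HomologicalComplex.extendMap_f j e (h0 k)]
        have : Mono (j.f k) := mono_of_mono_fac (biprod.lift_fst _ _)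
        infer_instance
      · exact ⟨fun _ _ _ => (HomologicalComplex.isZero_extend_X F e n
          fun j => by rw [h0]; omega).eq_of_tgt _ _⟩
  obtain ⟨L, hL0, i, p, him, hi, hp, -⟩ := cm5a_cof (HomologicalComplex.extendMap j e) 0
  have hL : ∀ n : ℤ, Injective (L.X n) := by
    intro n
    have hJ : Injective ((J.extend e).X n) := by
      by_cases hn : 0 ≤ n
      · obtain ⟨k, rfl⟩ := Int.eq_ofNat_of_zero_le hn
        exact Injective.of_iso (J.extendXIso e (h0 k)).symm
          (inferInstanceAs (Injective (I k ⊞ I (k + 1))))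
      · exact (HomologicalComplex.isZero_extend_X J e n fun j => by rw [h0]; omega).injective
    obtain ⟨A, hA, f, w, ⟨σ⟩⟩ := (Abelian.epiWithInjectiveKernel_iff _).1 (hp n)
    have := σ.isoBinaryBiproduct
    exact Injective.of_iso this.symm (inferInstanceAs (Injective (A ⊞ _)))
  have hlift : e.HasLift (𝟙 (L.restriction e)) := by
    intro j hj i' hi'
    have hz : Limits.IsZero (L.X i') := by
      refine CochainComplex.isZero_of_isStrictlyGE L 0 i' ?_
      have h1 : i' + 1 = e.f j := hi'
      by_contra hn
      obtain ⟨k, rfl⟩ := Int.eq_ofNat_of_zero_le (not_lt.1 hn)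
      exact hj.2 k hi'
    exact hz.eq_of_src _ _
  let q := e.liftExtend (𝟙 (L.restriction e)) hlift
  have hq : IsIso q := by
    have : ∀ n, IsIso (q.f n) := by
      intro n
      by_cases hn : 0 ≤ n
      · obtain ⟨k, rfl⟩ := Int.eq_ofNat_of_zero_le hn
        rw [e.isIso_liftExtend_f_iff _ hlift (h0 k)]
        infer_instance
      · have h1 : Limits.IsZero (L.X n) :=
          CochainComplex.isZero_of_isStrictlyGE L 0 n (not_le.1 hn)
        have h2 : Limits.IsZero (((L.restriction e).extend e).X n) :=
          HomologicalComplex.isZero_extend_X _ e n fun j => by rw [h0]; omega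
        exact ⟨0, h1.eq_of_src _ _, h2.eq_of_src _ _⟩
    exact HomologicalComplex.Hom.isIso_of_components q
  obtain ⟨ι, hι⟩ := (e.extendFunctor C).map_surjective (i ≫ q)
  refine ⟨L.restriction e, ι, ?_, fun n => ?_, fun n => hL _⟩
  · rw [← HomologicalComplex.quasiIso_extendMap_iff ι e]
    change QuasiIso ((e.extendFunctor C).map ι)
    rw [hι]
    have : QuasiIso q := inferInstance
    exact quasiIso_comp i q
  · have h3 : Mono ((e.extendFunctor C).map ι) := by
      rw [hι]
      exact mono_comp i q
    have h4 : Mono (HomologicalComplex.extendMap ι e) := h3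
    have h5 : Mono ((HomologicalComplex.extendMap ι e).f (n : ℤ)) := inferInstance
    rw [HomologicalComplex.extendMap_f ι e (h0 n)] at h5
    have h6 : Mono ((F.extendXIso e (h0 n)).inv ≫ (F.extendXIso e (h0 n)).hom ≫ ι.f n ≫
      ((L.restriction e).extendXIso e (h0 n)).inv) := mono_comp _ _
    rw [Iso.inv_hom_id_assoc] at h6
    exact mono_of_mono _ ((L.restriction e).extendXIso e (h0 n)).inv

/-- A map into a complex of injectives which vanishes on a subcomplex is, if the inclusion is a
quasi-isomorphism, homotopic to zero relative to the subcomplex. -/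
lemma exists_relative_homotopy {F T I : CochainComplex C ℕ} (ι : F ⟶ T) (hι : QuasiIso ι)
    (hm : ∀ n, Mono (ι.f n)) (hI : ∀ n, Injective (I.X n)) (g : T ⟶ I) (h : ι ≫ g = 0) :
    ∃ H : Homotopy g 0, ∀ i j, ι.f i ≫ H.hom i j = 0 := by
  have : Mono ι := HomologicalComplex.mono_of_mono_f ι hm
  let S : ShortComplex (CochainComplex C ℕ) := ShortComplex.mk ι (cokernel.π ι) (by simp)
  have hS : S.ShortExact :=
    { exact := ShortComplex.exact_of_g_is_cokernel _ (cokernelIsCokernel ι)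
      mono_f := by dsimp [S]; infer_instance
      epi_g := by dsimp [S]; infer_instance }
  obtain ⟨K⟩ := nullHomotopic_of_acyclic (hS.acyclic_X₃ hι) hI (cokernel.desc ι g h)
  have e1 : cokernel.π ι ≫ cokernel.desc ι g h = g := cokernel.π_desc _ _ _
  have e2 : cokernel.π ι ≫ (0 : S.X₃ ⟶ I) = 0 := comp_zero
  refine ⟨((Homotopy.ofEq e1.symm).trans (K.compLeft (cokernel.π ι))).trans
    (Homotopy.ofEq e2), fun i j => ?_⟩
  have h3 : ι.f i ≫ (cokernel.π ι).f i = 0 := by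
    rw [← HomologicalComplex.comp_f, cokernel.condition]; rfl
  simp [reassoc_of% h3]

/-- A morphism of complexes `f` which is an epimorphism in each degree is a quasi-isomorphism if the
cocycles in its kernel are boundaries of elements of its kernel. -/
lemma quasiIso_of_epi_of_kernel {A B : CochainComplex C ℕ} (f : A ⟶ B) (he : ∀ n, Epi (f.f n))
    (hk0 : ∀ ⦃X : C⦄ (a : X ⟶ A.X 0), a ≫ f.f 0 = 0 → a ≫ A.d 0 1 = 0 → a = 0)
    (hk : ∀ (n : ℕ) ⦃X : C⦄ (a : X ⟶ A.X (n + 1)), a ≫ f.f (n + 1) = 0 →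
      a ≫ A.d (n + 1) (n + 2) = 0 → ∃ b : X ⟶ A.X n, b ≫ f.f n = 0 ∧ b ≫ A.d n (n + 1) = a) :
    QuasiIso f := by
  have key : ∀ (n : ℕ) ⦃X : C⦄ (a : X ⟶ A.X n), a ≫ f.f n = 0 → a ≫ A.d n (n + 1) = 0 →
      ∃ b : X ⟶ A.X (n - 1), b ≫ f.f (n - 1) = 0 ∧ b ≫ A.d (n - 1) n = a := by
    rintro (_ | n) X a h h'
    · exact ⟨0, zero_comp, zero_comp.trans (hk0 a h h').symm⟩
    · exact hk n a h h'
  refine ⟨fun n => ?_⟩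
  rw [quasiIsoAt_iff_isIso_homologyMap]
  have hp : (ComplexShape.up ℕ).prev n = n - 1 := by cases n <;> simp
  have hn : (ComplexShape.up ℕ).next n = n + 1 := by simp
  have h1 : Mono (HomologicalComplex.homologyMap f n) := by
    rw [HomologicalComplex.mono_homologyMap_iff_up_to_refinements f (n - 1) n (n + 1) hp hn]
    intro X x hx y hy
    have := he (n - 1)
    obtain ⟨X', π, hπ, x₁, h1⟩ := surjective_up_to_refinements_of_epi (f.f (n - 1)) y
    obtain ⟨b, -, hb⟩ := key n (π ≫ x - x₁ ≫ A.d (n - 1) n) (by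
      rw [Preadditive.sub_comp, Category.assoc, Category.assoc, ← f.comm, hy, ← Category.assoc,
        ← Category.assoc, h1, sub_self]) (by simp [hx])
    exact ⟨X', π, hπ, x₁ + b, by rw [Preadditive.add_comp, hb]; abel⟩
  have h2 : Epi (HomologicalComplex.homologyMap f n) := by
    rw [HomologicalComplex.epi_homologyMap_iff_up_to_refinements f (n - 1) n (n + 1) hp hn]
    intro X y hy
    have := he n
    obtain ⟨X', π, hπ, x, h1⟩ := surjective_up_to_refinements_of_epi (f.f n) y
    obtain ⟨b, hb, hb'⟩ := key (n + 1) (x ≫ A.d n (n + 1)) (by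
      rw [Category.assoc, ← f.comm, ← Category.assoc, ← h1, Category.assoc, hy, comp_zero])
      (by simp)
    change X' ⟶ A.X n at b
    change b ≫ f.f n = 0 at hb
    change b ≫ A.d n (n + 1) = _ at hb'
    exact ⟨X', π, hπ, x - b, by rw [Preadditive.sub_comp, hb', sub_self], 0, by
      rw [Preadditive.sub_comp, hb, sub_zero, zero_comp, add_zero, h1]⟩
  exact isIso_of_mono_of_epi _

/-- The shift `F ↦ F[-1]` preserves quasi-isomorphisms. -/
lemma quasiIso_shMap {F F' : CochainComplex C ℕ} (φ : F ⟶ F') (hφ : QuasiIso φ) :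
    QuasiIso (shMap φ) := by
  refine ⟨fun n => ?_⟩
  rw [quasiIsoAt_iff_isIso_homologyMap]
  rcases n with _ | n
  · have hz : ∀ K : CochainComplex C ℕ, IsZero ((sh K).homology 0) := fun K => by
      refine ((sh K).exactAt_iff_isZero_homology 0).1 ?_
      exact ShortComplex.exact_of_isZero_X₂ _ (isZero_zero C)
    exact ⟨0, (hz _).eq_of_src _ _, (hz _).eq_of_src _ _⟩
  have hp : (ComplexShape.up ℕ).prev n = n - 1 := by cases n <;> simp
  have hn : (ComplexShape.up ℕ).next n = n + 1 := by simp
  have hp' : (ComplexShape.up ℕ).prev (n + 1) = n := by simp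
  have hn' : (ComplexShape.up ℕ).next (n + 1) = n + 2 := by simp
  have hi : IsIso (HomologicalComplex.homologyMap φ n) :=
    (quasiIsoAt_iff_isIso_homologyMap φ n).1 (hφ.quasiIsoAt n)
  -- the boundaries of `F[-1]` in degree `n + 1` are those of `F` in degree `n`
  have hto : ∀ (K : CochainComplex C ℕ) (n : ℕ) ⦃X : C⦄ (y : X ⟶ (sh K).X n),
      ∃ y' : X ⟶ K.X (n - 1), y ≫ (sh K).d n (n + 1) = y' ≫ K.d (n - 1) n := by
    rintro K (_ | n) X y
    · refine ⟨0, Eq.trans ?_ zero_comp.symm⟩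
      rw [(isZero_zero C).eq_of_tgt y 0]
      exact zero_comp
    · exact ⟨y, rfl⟩
  have hfrom : ∀ (K : CochainComplex C ℕ) (n : ℕ) ⦃X : C⦄ (y' : X ⟶ K.X (n - 1)),
      ∃ y : X ⟶ (sh K).X n, y ≫ (sh K).d n (n + 1) = y' ≫ K.d (n - 1) n := by
    rintro K (_ | n) X y'
    · exact ⟨0, zero_comp.trans ((congrArg (y' ≫ ·) (K.shape 0 0 (by simp))).trans comp_zero).symm⟩
    · exact ⟨y', rfl⟩
  have h1 : Mono (HomologicalComplex.homologyMap (shMap φ) (n + 1)) := by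
    rw [HomologicalComplex.mono_homologyMap_iff_up_to_refinements (shMap φ) n (n + 1) (n + 2)
      hp' hn']
    intro X x hx y hy
    obtain ⟨y', hy'⟩ := hto F' n y
    obtain ⟨X', π, hπ, x₁, h⟩ := (HomologicalComplex.mono_homologyMap_iff_up_to_refinements φ
      (n - 1) n (n + 1) hp hn).1 (inferInstanceAs (Mono (HomologicalComplex.homologyMap φ n)))
      x hx y' (hy.trans hy')
    obtain ⟨y, h'⟩ := hfrom F n x₁
    exact ⟨X', π, hπ, y, h.trans h'.symm⟩
  have h2 : Epi (HomologicalComplex.homologyMap (shMap φ) (n + 1)) := by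
    rw [HomologicalComplex.epi_homologyMap_iff_up_to_refinements (shMap φ) n (n + 1) (n + 2)
      hp' hn']
    intro X x hx
    obtain ⟨X', π, hπ, x₂, hx₂, y₁, h⟩ := (HomologicalComplex.epi_homologyMap_iff_up_to_refinements
      φ (n - 1) n (n + 1) hp hn).1 (inferInstanceAs (Epi (HomologicalComplex.homologyMap φ n))) x hx
    obtain ⟨y, h'⟩ := hfrom F' n y₁
    exact ⟨X', π, hπ, x₂, hx₂, y, h.trans (congrArg (x₂ ≫ φ.f n + ·) h'.symm)⟩
  exact isIso_of_mono_of_epi _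

lemma quasiIso_of_homotopy {A B : CochainComplex C ℕ} {f g : A ⟶ B} (h : Homotopy f g)
    (hf : QuasiIso f) : QuasiIso g := by
  refine ⟨fun n => ?_⟩
  rw [quasiIsoAt_iff_isIso_homologyMap, ← h.homologyMap_eq n,
    ← quasiIsoAt_iff_isIso_homologyMap]
  exact hf.quasiIsoAt n

/-- A quasi-isomorphism between complexes of injectives is a homotopy equivalence. -/
lemma exists_homotopyEquiv {T I : CochainComplex C ℕ} (f : T ⟶ I) (hf : QuasiIso f)
    (hT : ∀ n, Injective (T.X n)) (hI : ∀ n, Injective (I.X n)) :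
    ∃ e : HomotopyEquiv T I, e.hom = f := by
  obtain ⟨g, ⟨h⟩⟩ := exists_lift f hf (𝟙 T) hT
  have h1 : Homotopy (f ≫ (g ≫ f - 𝟙 I)) 0 :=
    (Homotopy.ofEq (by simp)).trans (Homotopy.equivSubZero ((h.compRight f).trans
      (Homotopy.ofEq (Category.id_comp f))))
  obtain ⟨h2⟩ := nullHomotopic_of_quasiIso_comp f hf hI (g ≫ f - 𝟙 I) h1
  exact ⟨⟨f, g, h, Homotopy.equivSubZero.symm h2⟩, rfl⟩

end HomologicalAlgebra

/-! ### The exponential sequence -/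

section ExponentialSequence

variable {M : Type u} [TopologicalSpace M] [SmoothSpace M]

/-- On a manifold, smoothness in all smooth parametrisations implies continuity. -/
lemma continuous_of_smooth_parametrisations (hM : IsManifold M) {U : Opens M} (g : U → ℂ)
    (hg : ∀ (n : ℕ) (u : Eu n → U) (x : Eu n), IsSmoothAt u x →
      ContDiffAt ℝ ∞ (fun y => g (u y)) x) : Continuous g := by
  rw [continuous_iff_continuousAt]
  intro p
  obtain ⟨n, e, hp, he⟩ := hM p.1
  classical
  let u : Eu n → U := fun y => if h : e.symm y ∈ U then ⟨e.symm y, h⟩ else p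
  have hx : e p.1 ∈ e.target := e.map_source hp
  have h1 : ∀ᶠ y in 𝓝 (e p.1), y ∈ e.target ∧ e.symm y ∈ U := by
    refine Filter.Eventually.and (e.open_target.mem_nhds hx)
      ((e.continuousAt_symm hx).eventually (U.isOpen.mem_nhds ?_))
    rw [e.left_inv hp]
    exact p.2
  have h2 : IsSmoothAt e.symm (e p.1) := by
    refine (he n e.symm (e p.1) (e.map_target hx)).2 ?_
    filter_upwards [h1.eventually_nhds] with y hy
    refine ⟨e.continuousAt_symm hy.self_of_nhds.1, contDiffAt_id.congr_of_eventuallyEq ?_⟩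
    filter_upwards [hy] with z hz using e.right_inv hz.1
  have h3 : IsSmoothAt u (e p.1) := by
    refine isSmoothAt_val_iff.2 (SmoothSpace.congr h2 ?_)
    filter_upwards [h1] with y hy
    simp [u, hy.2]
  have h4 : ContinuousAt (fun y => g (u y)) (e p.1) := (hg n u _ h3).continuousAt
  have h5 : ContinuousAt (fun q : U => e q.1) p :=
    (e.continuousAt hp).comp continuous_subtype_val.continuousAt
  refine (ContinuousAt.comp (f := fun q : U => e q.1) h4 h5).congr ?_
  have h6 : ∀ᶠ q : U in 𝓝 p, q.1 ∈ e.source :=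
    continuous_subtype_val.continuousAt.eventually (e.open_source.mem_nhds hp)
  filter_upwards [h6] with q hq
  have : u (e q.1) = q := by
    have h7 : e.symm (e q.1) = q.1 := e.left_inv hq
    exact Subtype.ext (by simp [u, h7])
  simp [this]

lemma smoothUnits.continuous (hM : IsManifold M) {U : Opens M} (f : smoothUnits U) :
    Continuous fun x => ((f.1 x).toMul : ℂ) :=
  continuous_of_smooth_parametrisations hM _ f.2

lemma smoothFun.continuous (hM : IsManifold M) {U : Opens M} (f : smoothFun U) :
    Continuous f.1 :=
  continuous_of_smooth_parametrisations hM _ f.2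

variable (G : EtaleGroupoid.{u})

/-- Smooth `ℂ^×`-valued functions on a manifold have smooth logarithms locally. -/
lemma epi_expSheaf (hG : G.IsSmooth) : Epi (expSheaf G) := by
  rw [← Sheaf.isLocallySurjective_iff_epi']
  refine ⟨fun {U} (f : smoothUnits (Site.opens U)) x hx => ?_⟩
  have hc := smoothUnits.continuous hG f
  set c : ℂ := ((f.1 ⟨x, hx⟩).toMul : ℂ) with hcdef
  have hc0 : c ≠ 0 := Units.ne_zero _
  let W : Opens G.Obj := ⟨Subtype.val '' {y : Site.opens U | ((f.1 y).toMul : ℂ) / c ∈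
    Complex.slitPlane}, (Site.opens U).isOpen.isOpenMap_subtype_val _
      (Complex.isOpen_slitPlane.preimage (hc.div_const c))⟩
  have hW : W ≤ U := by rintro _ ⟨y, _, rfl⟩; exact y.2
  have hslit : ∀ y : W, ((f.1 ⟨y.1, hW y.2⟩).toMul : ℂ) / c ∈ Complex.slitPlane := by
    rintro ⟨_, y, hy, rfl⟩; exact hy
  have hsm : ∀ (n : ℕ) (u : Eu n → W) (z : Eu n), IsSmoothAt u z →
      IsSmoothAt (fun y => (⟨(u y).1, hW (u y).2⟩ : Site.opens U)) z := fun n u z hu =>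
    isSmoothAt_val_iff.2 hu.2
  refine ⟨W, hW, ⟨⟨x, hx⟩, ?_, rfl⟩, (⟨fun y => Complex.log (((f.1 ⟨y.1, hW y.2⟩).toMul : ℂ) / c) +
    Complex.log c, fun n u z hu => ?_⟩ : smoothFun W), ?_⟩
  · change c / c ∈ Complex.slitPlane
    rw [div_self hc0]
    exact Complex.one_mem_slitPlane
  · refine ContDiffAt.add ?_ contDiffAt_const
    exact ((Complex.contDiffAt_log (hslit (u z))).restrict_scalars ℝ).comp z
      ((f.2 n _ z (hsm n u z hu)).div_const c)
  · refine Subtype.ext (funext fun (y : W) => Additive.toMul.injective (Units.ext ?_))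
    change Complex.exp (Complex.log (((f.1 ⟨y.1, hW y.2⟩).toMul : ℂ) / c) + Complex.log c) =
      ((f.1 ⟨y.1, hW y.2⟩).toMul : ℂ)
    rw [Complex.exp_add, Complex.exp_log (Complex.slitPlane_ne_zero (hslit y)),
      Complex.exp_log hc0, div_mul_cancel₀ _ hc0]

lemma mono_latticeSheafIncl (p : ℕ) (c : ℂ) : Mono (latticeSheafIncl G p c) := by
  refine Sheaf.mono_of_injective _ fun U => ?_
  change Function.Injective (latticeIncl p c (M := Site.opens U.unop))
  exact AddSubgroup.inclusion_injective (latticeFun_le p c (Site.opens U.unop))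

/-- The kernel of the exponential map consists of locally constant functions, since smooth
functions on a manifold are continuous. -/
lemma exists_lift_latticeSheafIncl (hG : G.IsSmooth) (p : ℕ) {X : GSheaf G}
    (a : X ⟶ funSheaf G) (ha : a ≫ expSheaf G = 0) :
    ∃ b : X ⟶ latticeSheaf G p (deligneFactor p),
      b ≫ latticeSheafIncl G p (deligneFactor p) = a := by
  have h2 : (2 * Real.pi * Complex.I : ℂ) ≠ 0 := Complex.two_pi_I_ne_zero
  have hmem : ∀ (U : (Site G)ᵒᵖ) (σ : X.obj.obj U),
      (show smoothFun (Site.opens U.unop) from a.hom.app U σ).1 ∈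
        latticeFun p (deligneFactor p) (Site.opens U.unop) := by
    intro U σ
    set f : smoothFun (Site.opens U.unop) := a.hom.app U σ with hf
    have h0 : expFun f = 0 :=
      congrArg (fun k : X ⟶ unitsSheaf G => k.hom.app U σ) ha
    have h3 : ∀ x, ∃ k : ℤ, f.1 x = k * (2 * Real.pi * Complex.I) := fun x => by
      have h4 : Complex.exp (f.1 x) = 1 :=
        congrArg (fun g : smoothUnits (Site.opens U.unop) => ((g.1 x).toMul : ℂ)) h0
      exact Complex.exp_eq_one_iff.1 h4
    refine ⟨?_, fun x => ?_⟩
    · rw [IsLocallyConstant.iff_eventually_eq]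
      intro x
      have hc := (smoothFun.continuous hG f).continuousAt (x := x)
      have h5 : ∀ᶠ y in 𝓝 x, dist (f.1 y) (f.1 x) < 2 * Real.pi :=
        hc.eventually (Metric.ball_mem_nhds _ Real.two_pi_pos)
      filter_upwards [h5] with y hy
      obtain ⟨k, hk⟩ := h3 x
      obtain ⟨l, hl⟩ := h3 y
      rw [hk, hl, dist_eq_norm, ← sub_mul, norm_mul] at hy
      have h6 : ‖(2 * Real.pi * Complex.I : ℂ)‖ = 2 * Real.pi := by
        simp [abs_of_pos Real.pi_pos]
      rw [h6] at hy
      have h7 : ‖((l : ℂ) - k)‖ < 1 := by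
        have := Real.two_pi_pos
        by_contra hn
        nlinarith [not_lt.1 hn]
      have h8 : l = k := by
        rw [← Int.cast_sub, Complex.norm_intCast] at h7
        have h9 : |l - k| < 1 := by exact_mod_cast h7
        have := abs_lt.1 h9
        omega
      rw [hk, hl, h8]
    · obtain ⟨k, hk⟩ := h3 x
      refine ⟨k, ?_⟩
      have h1 : deligneFactor p * ((2 * Real.pi * Complex.I) ^ p * k) =
          k * (2 * Real.pi * Complex.I) := by
        rw [← mul_assoc, deligneFactor, ← zpow_natCast, ← zpow_add₀ h2]
        simp [mul_comm]
      rw [hk, h1]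
  refine ⟨⟨{ app := fun U => AddCommGrpCat.ofHom (AddMonoidHom.mk' (fun σ => ⟨_, hmem U σ⟩)
      fun σ τ => Subtype.ext ?_), naturality := fun U V f => ?_ }⟩, ?_⟩
  · exact congrArg (fun g : smoothFun (Site.opens U.unop) => g.1) (map_add (a.hom.app U).hom σ τ)
  · refine AddCommGrpCat.hom_ext (AddMonoidHom.ext fun σ => Subtype.ext ?_)
    exact congrArg (fun g : smoothFun (Site.opens V.unop) => g.1)
      (NatTrans.naturality_apply a.hom f σ)
  · rfl

end ExponentialSequence

section DeligneIso

lemma isIso_truncMap {C : Type u} [Category.{v} C] [HasZeroMorphisms C] [HasZeroObject C] :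
    ∀ (X Y : ℕ → C) (φ : ∀ n, X n ⟶ Y n) (_ : ∀ n, IsIso (φ n)) (p n : ℕ),
      IsIso (truncMap X Y φ p n)
  | _, _, _, _, 0, _ => inferInstanceAs (IsIso (𝟙 _))
  | _, _, _, h, _ + 1, 0 => h 0
  | _, _, φ, h, p + 1, n + 1 => isIso_truncMap _ _ (fun k => φ (k + 1)) (fun k => h (k + 1)) p n

variable (G : EtaleGroupoid.{u})

/-- The exponential sequence: the scaled Deligne complex is quasi-isomorphic to `ℂ^×(p)[-1]`. -/
lemma quasiIso_expComplex (hG : G.IsSmooth) (p : ℕ) : QuasiIso (expComplex G (p + 1)) := by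
  have hiso : ∀ n, IsIso ((expComplex G (p + 1)).f (n + 2)) := fun n =>
    isIso_truncMap _ _ (fun k => expSeq G (p + 1) (k + 1))
      (fun k => inferInstanceAs (IsIso (𝟙 (formSheaf G (k + 1))))) p n
  refine quasiIso_of_epi_of_kernel _ ?_ ?_ ?_
  · rintro (_ | _ | n)
    · exact ⟨fun _ _ _ => (isZero_zero (GSheaf G)).eq_of_src _ _⟩
    · exact epi_expSheaf G hG
    · have := hiso n
      infer_instance
  · intro X a _ ha
    have h1 : (Deligne G (p + 1)).d 0 1 = latticeSheafIncl G (p + 1) (deligneFactor (p + 1)) :=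
      truncComplex_d _ _ (deligneD_comp G (p + 1)) (p + 2) 0
    rw [h1] at ha
    have := mono_latticeSheafIncl G (p + 1) (deligneFactor (p + 1))
    exact (cancel_mono (latticeSheafIncl G (p + 1) (deligneFactor (p + 1)))).1
      (ha.trans zero_comp.symm)
  · rintro (_ | n) X a ha -
    · obtain ⟨b, hb⟩ := exists_lift_latticeSheafIncl G hG (p + 1) a ha
      refine ⟨b, comp_zero, Eq.trans ?_ hb⟩
      exact congrArg (b ≫ ·) (truncComplex_d _ _ (deligneD_comp G (p + 1)) (p + 2) 0)
    · have := hiso n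
      have h0 : a = 0 := by
        rw [← cancel_mono ((expComplex G (p + 1)).f (n + 2)), zero_comp]
        exact ha
      exact ⟨0, zero_comp, zero_comp.trans h0.symm⟩

lemma bijective_hom_comp {X Y Z : AddCommGrpCat.{u}} (a : X ⟶ Y) (b : Y ⟶ Z) (ha : IsIso a)
    (hb : IsIso b) : Function.Bijective (a ≫ b).hom :=
  ((ConcreteCategory.isIso_iff_bijective b).1 hb).comp
    ((ConcreteCategory.isIso_iff_bijective a).1 ha)

variable {G} in
lemma isIso_homologyMap_Γinv {T I : CochainComplex (GSheaf G) ℕ} (f : T ⟶ I) (hf : QuasiIso f)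
    (hT : ∀ n, Injective (T.X n)) (hI : ∀ n, Injective (I.X n)) (n : ℕ) :
    IsIso (HomologicalComplex.homologyMap
      (((Γinv G).mapHomologicalComplex (ComplexShape.up ℕ)).map f) n) := by
  obtain ⟨e, rfl⟩ := exists_homotopyEquiv f hf hT hI
  exact (((Γinv G).mapHomotopyEquiv e).toHomologyIso n).isIso_hom

variable {G} in
lemma homotopy_injLift {F I : CochainComplex (GSheaf G) ℕ} (f : F ⟶ I)
    (hI : ∀ n, Injective (I.X n)) : Nonempty (Homotopy (injResι F ≫ injLift f hI) f) :=
  (exists_lift (injResι F) (quasiIso_injResι F) f hI).choose_spec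

variable {G} in
lemma quasiIso_injLift {F I : CochainComplex (GSheaf G) ℕ} (f : F ⟶ I)
    (hI : ∀ n, Injective (I.X n)) (hf : QuasiIso f) : QuasiIso (injLift f hI) := by
  obtain ⟨h⟩ := homotopy_injLift f hI
  have h1 := quasiIso_injResι F
  have h2 := quasiIso_of_homotopy h.symm hf
  exact quasiIso_of_comp_left (injResι F) (injLift f hI)

/-- The exponential map is bijective on hypercohomology: a quasi-isomorphism induces a homotopy
equivalence between complexes of injectives, which the invariant sections preserve. -/
lemma bijective_deligneExp (hG : G.IsSmooth) (p n : ℕ) :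
    Function.Bijective (deligneExp G (p + 1) n) := by
  have hf : QuasiIso (expComplex G (p + 1) ≫ shMap (injResι (Cx G (p + 1)))) := by
    have h1 := quasiIso_expComplex G hG p
    have h2 := quasiIso_shMap _ (quasiIso_injResι (Cx G (p + 1)))
    exact quasiIso_comp _ _
  have hI := injective_sh (injective_injRes (Cx G (p + 1)))
  exact bijective_hom_comp _ _ (isIso_homologyMap_Γinv _ (quasiIso_injLift _ hI hf)
    (injective_injRes _) hI _) (shHomologyIso _ n).isIso_hom

end DeligneIso

/-! ### Fibres and skyscraper sheaves -/

open EtaleGroupoid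

section Fibres

variable {G : EtaleGroupoid.{u}}

/-- The fibre of a space `E` étale over `G` at an object `x`: the pairs of a point `e` of `E` and an
arrow from the projection of `e` to `x`. -/
def fib (x : G.Obj) (E : EtSp G) : Type u :=
  {p : E × G.Arr // G.src p.2 = E.proj p.1 ∧ G.tgt p.2 = x}

lemma fib_ext {x : G.Obj} {E : EtSp G} {p q : fib x E} (h : p.1.1 = q.1.1) (h' : p.1.2 = q.1.2) :
    p = q := Subtype.ext (Prod.ext h h')

/-- The map on fibres induced by a morphism. -/
def fibMap (x : G.Obj) {E E' : EtSp G} (f : E ⟶ E') (p : fib x E) : fib x E' :=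
  ⟨(f.map p.1.1, G.mul (f.arr p.1.1) p.1.2 ((f.tgt_arr _).trans p.2.1.symm)),
    (G.src_mul _ _ _).trans (f.src_arr _), (G.tgt_mul _ _ _).trans p.2.2⟩

lemma fibMap_id (x : G.Obj) (E : EtSp G) (p : fib x E) : fibMap x (𝟙 E) p = p :=
  fib_ext rfl (one_mul' _)

lemma fibMap_comp (x : G.Obj) {E E' E'' : EtSp G} (f : E ⟶ E') (g : E' ⟶ E'') (p : fib x E) :
    fibMap x (f ≫ g) p = fibMap x g (fibMap x f p) :=
  fib_ext rfl (G.mul_assoc _ _ _ _ _)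

/-- The functor of fibres at `x`. -/
def fibFunctor (x : G.Obj) : EtSp G ⥤ Type u where
  obj E := fib x E
  map f := TypeCat.ofHom (fibMap x f)
  map_id E := by ext p; exact fibMap_id x E p
  map_comp f g := by ext p; exact fibMap_comp x f g p

/-- The point `x` itself, in the fibre at `x` of a neighbourhood of `x`. -/
def fibPt {x : G.Obj} {U : Opens G.Obj} (hx : x ∈ U) : fib x (openSp G U) :=
  ⟨(⟨x, hx⟩, G.one x), G.src_one _, G.tgt_one _⟩

lemma fibMap_fibPt {x : G.Obj} {U : Opens G.Obj} (hx : x ∈ U) {E : EtSp G} (j : openSp G U ⟶ E) :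
    fibMap x j (fibPt hx) = ⟨(j.map ⟨x, hx⟩, j.arr ⟨x, hx⟩), j.src_arr _, j.tgt_arr _⟩ :=
  fib_ext rfl (mul_one' _)

lemma fibMap_incl {x : G.Obj} {U V : Opens G.Obj} (h : U ≤ V) (p : fib x (openSp G U)) :
    fibMap x (incl h).hom p = ⟨(⟨p.1.1.1, h p.1.1.2⟩, p.1.2), p.2⟩ :=
  fib_ext rfl (one_mul' _)

lemma incl_comp_arr {U V : Opens G.Obj} (h : U ≤ V) {E : EtSp G} (j : openSp G V ⟶ E)
    (y : openSp G U) : ((incl h).hom ≫ j).arr y = j.arr ⟨y.1, h y.2⟩ :=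
  mul_one' _

/-- A space étale over `G` has local sections through every point of a fibre. -/
lemma exists_section {x : G.Obj} {E : EtSp G} (p : fib x E) :
    ∃ (U : Opens G.Obj) (hx : x ∈ U) (j : openSp G U ⟶ E), fibMap x j (fibPt hx) = p := by
  obtain ⟨⟨e, g⟩, h1, h2⟩ := p
  dsimp only at h1 h2
  obtain ⟨a, hga, ha⟩ := G.etale_tgt.isLocalHomeomorph g
  obtain ⟨b, heb, hb⟩ := E.etale.isLocalHomeomorph e
  have ha' : ∀ y, G.tgt y = a y := fun y => by rw [ha]
  have hb' : ∀ y, E.proj y = b y := fun y => by rw [hb]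
  let U : Opens G.Obj := ⟨a.target ∩ a.symm ⁻¹' (G.src ⁻¹' b.target),
    a.isOpen_inter_preimage_symm
      (b.open_target.preimage G.etale_src.isLocalHomeomorph.continuous)⟩
  have hax : a.symm x = g := by rw [← h2, ha', a.left_inv hga]
  have hx : x ∈ U := by
    refine ⟨?_, ?_⟩
    · rw [← h2, ha']; exact a.map_source hga
    · change G.src (a.symm x) ∈ b.target
      rw [hax, h1, hb']; exact b.map_source heb
  have hca : Continuous fun y : U => a.symm y.1 :=
    a.continuousOn_symm.comp_continuous continuous_subtype_val fun y => y.2.1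
  refine ⟨U, hx,
    { map := fun y => b.symm (G.src (a.symm y.1))
      arr := fun y => a.symm y.1
      continuous_map := b.continuousOn_symm.comp_continuous
        (G.etale_src.isLocalHomeomorph.continuous.comp hca) fun y => y.2.2
      continuous_arr := hca
      src_arr := fun y => by rw [hb', b.right_inv y.2.2]
      tgt_arr := fun y => by rw [ha', a.right_inv y.2.1]; rfl }, ?_⟩
  rw [fibMap_fibPt]
  refine fib_ext ?_ hax
  change b.symm (G.src (a.symm x)) = e
  rw [hax, h1, hb', b.left_inv heb]

lemma eventually_eq_of_isLocalHomeomorph {X Y Z : Type u} [TopologicalSpace X]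
    [TopologicalSpace Y] [TopologicalSpace Z] {f : Y → Z} (hf : IsLocalHomeomorph f) {a b : X → Y}
    {x : X} (ha : ContinuousAt a x) (hb : ContinuousAt b x) (h : a x = b x)
    (hab : ∀ᶠ y in 𝓝 x, f (a y) = f (b y)) : ∀ᶠ y in 𝓝 x, a y = b y := by
  obtain ⟨O, hO, hx, hinj⟩ := hf.isLocallyInjective (a x)
  filter_upwards [ha.eventually (hO.mem_nhds hx), hb.eventually (hO.mem_nhds (h ▸ hx)), hab]
    with y h1 h2 h3 using hinj h1 h2 h3

/-- Two morphisms which agree at a point agree near it. -/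
lemma exists_incl_comp_eq {U : Opens G.Obj} {E : EtSp G} (j j' : openSp G U ⟶ E) {x : G.Obj}
    (hx : x ∈ U) (h : fibMap x j (fibPt hx) = fibMap x j' (fibPt hx)) :
    ∃ (W : Opens G.Obj) (hW : W ≤ U), x ∈ W ∧ (incl hW).hom ≫ j = (incl hW).hom ≫ j' := by
  rw [fibMap_fibPt, fibMap_fibPt] at h
  have h1 : j.map ⟨x, hx⟩ = j'.map ⟨x, hx⟩ := congrArg (fun p : fib x E => p.1.1) h
  have h2 : j.arr ⟨x, hx⟩ = j'.arr ⟨x, hx⟩ := congrArg (fun p : fib x E => p.1.2) h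
  have e2 : ∀ᶠ y in 𝓝 (⟨x, hx⟩ : U), j.arr y = j'.arr y :=
    eventually_eq_of_isLocalHomeomorph G.etale_tgt.isLocalHomeomorph
      j.continuous_arr.continuousAt j'.continuous_arr.continuousAt h2
      (Filter.Eventually.of_forall fun y => (j.tgt_arr y).trans (j'.tgt_arr y).symm)
  have e1 : ∀ᶠ y in 𝓝 (⟨x, hx⟩ : U), j.map y = j'.map y :=
    eventually_eq_of_isLocalHomeomorph E.etale.isLocalHomeomorph
      j.continuous_map.continuousAt j'.continuous_map.continuousAt h1 (by
        filter_upwards [e2] with y hy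
        rw [← j.src_arr, ← j'.src_arr, hy])
  obtain ⟨O, hO, hOo, hxO⟩ := eventually_nhds_iff.1 (e1.and e2)
  refine ⟨⟨Subtype.val '' O, U.isOpen.isOpenMap_subtype_val _ hOo⟩, ?_, ⟨_, hxO, rfl⟩, ?_⟩
  · rintro _ ⟨y, _, rfl⟩; exact y.2
  · have key : ∀ y ∈ Subtype.val '' O, ∃ hy : y ∈ U, (⟨y, hy⟩ : U) ∈ O := by
      rintro _ ⟨y, hy, rfl⟩; exact ⟨y.2, hy⟩
    refine EtSp.hom_ext (funext fun y => ?_) (funext fun y => ?_)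
    · obtain ⟨h, h'⟩ := key y.1 y.2
      exact (hO _ h').1
    · obtain ⟨h, h'⟩ := key y.1 y.2
      rw [incl_comp_arr, incl_comp_arr]
      exact (hO _ h').2

end Fibres

section LocalSections

variable {G : EtaleGroupoid.{u}} (F : GSheaf G)

lemma isSheaf_forget : Presieve.IsSheaf (siteTopology G) (F.obj ⋙ forget AddCommGrpCat.{u}) := by
  rw [← isSheaf_iff_isSheaf_of_type, ← Presheaf.isSheaf_iff_isSheaf_forget]
  exact F.property

/-- Sections of a `G`-sheaf are determined locally. -/
lemma eq_of_locally_eq {U : Opens G.Obj} (s t : F.obj.obj (op (st U)))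
    (h : ∀ x ∈ U, ∃ (W : Opens G.Obj) (h : W ≤ U), x ∈ W ∧
      F.obj.map (incl h).op s = F.obj.map (incl h).op t) : s = t := by
  let S : Sieve (st U) :=
    { arrows := fun V f => F.obj.map f.op s = F.obj.map f.op t
      downward_closed := fun {V W f} hf g => by
        simp only [op_comp, F.obj.map_comp, ConcreteCategory.comp_apply]
        rw [hf] }
  have hS : S ∈ siteTopology G (st U) := h
  exact ((isSheaf_forget F).isSeparated S hS).ext fun V f hf => hf

/-- A morphism over `U` which factors through two open subsets `W₁`, `W₂` of `U` factors through
their intersection. -/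
lemma exists_lift_inf {U W₁ W₂ V : Opens G.Obj} (h₁ : W₁ ≤ U) (h₂ : W₂ ≤ U) (f : st V ⟶ st W₁)
    (g : st V ⟶ st W₂) (h : f ≫ incl h₁ = g ≫ incl h₂) :
    ∃ k : st V ⟶ st (W₁ ⊓ W₂), f = k ≫ incl inf_le_left ∧ g = k ≫ incl inf_le_right := by
  have hm : ∀ y, (f.hom.map y).1 = (g.hom.map y).1 := fun y =>
    congrArg (fun k : st V ⟶ st U => (k.hom.map y).1) h
  have ha : ∀ y, f.hom.arr y = g.hom.arr y := fun y => by
    have h3 := congrArg (fun k : st V ⟶ st U => k.hom.arr y) h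
    exact (one_mul' _).symm.trans (h3.trans (one_mul' _))
  refine ⟨InducedCategory.homMk
    { map := fun y => ⟨(f.hom.map y).1, (f.hom.map y).2, by
        have := (g.hom.map y).2
        rw [← hm] at this
        exact this⟩
      arr := f.hom.arr
      continuous_map := (continuous_subtype_val.comp f.hom.continuous_map).subtype_mk _
      continuous_arr := f.hom.continuous_arr
      src_arr := f.hom.src_arr
      tgt_arr := f.hom.tgt_arr }, ?_, ?_⟩
  · exact InducedCategory.hom_ext (EtSp.hom_ext rfl (funext fun y => (one_mul' _).symm))
  · refine InducedCategory.hom_ext (EtSp.hom_ext (funext fun y => Subtype.ext (hm y).symm)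
      (funext fun y => (ha y).symm.trans (one_mul' _).symm))

/-- Compatible sections of a `G`-sheaf over an open cover can be glued. -/
lemma exists_glue {U : Opens G.Obj} {ι : Type u} (W : ι → Opens G.Obj) (hW : ∀ i, W i ≤ U)
    (hc : ∀ x ∈ U, ∃ i, x ∈ W i) (s : ∀ i, F.obj.obj (op (st (W i))))
    (hs : ∀ i j, F.obj.map (incl (inf_le_left : W i ⊓ W j ≤ W i)).op (s i) =
      F.obj.map (incl (inf_le_right : W i ⊓ W j ≤ W j)).op (s j)) :
    ∃ t : F.obj.obj (op (st U)), ∀ i, F.obj.map (incl (hW i)).op t = s i := by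
  let S : Sieve (st U) :=
    { arrows := fun V f => ∃ (i : ι) (g : V ⟶ st (W i)), g ≫ incl (hW i) = f
      downward_closed := by
        rintro V V' _ ⟨i, g, rfl⟩ k
        exact ⟨i, k ≫ g, Category.assoc _ _ _⟩ }
  have hS : S ∈ siteTopology G (st U) := by
    intro x hx
    obtain ⟨i, hi⟩ := hc x hx
    exact ⟨W i, hW i, hi, i, 𝟙 _, Category.id_comp _⟩
  have key : ∀ (V : Opens G.Obj) (i j : ι) (f : st V ⟶ st (W i)) (g : st V ⟶ st (W j)),
      f ≫ incl (hW i) = g ≫ incl (hW j) → F.obj.map f.op (s i) = F.obj.map g.op (s j) := by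
    intro V i j f g h
    obtain ⟨k, rfl, rfl⟩ := exists_lift_inf _ _ f g h
    simp only [op_comp, F.obj.map_comp, ConcreteCategory.comp_apply]
    rw [hs]
  choose i g hg using fun (V : Site G) (f : V ⟶ st U) (h : S.arrows f) => h
  let fam : Presieve.FamilyOfElements (F.obj ⋙ forget AddCommGrpCat.{u}) S.arrows :=
    fun V f h => F.obj.map (g V f h).op (s (i V f h))
  have hfam : fam.Compatible := by
    intro V₁ V₂ V k₁ k₂ f₁ f₂ h₁ h₂ e
    have h3 := key V _ _ (k₁ ≫ g V₁ f₁ h₁) (k₂ ≫ g V₂ f₂ h₂) (by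
      rw [Category.assoc, Category.assoc, hg, hg, e])
    simp only [op_comp, F.obj.map_comp, ConcreteCategory.comp_apply] at h3
    exact h3
  obtain ⟨t, ht, -⟩ := isSheaf_forget F S hS fam hfam
  refine ⟨t, fun j => ?_⟩
  have hj : S.arrows (incl (hW j)) := ⟨j, 𝟙 _, Category.id_comp _⟩
  refine (ht _ hj).trans ((key _ _ _ _ (𝟙 _) ?_).trans ?_)
  · rw [hg]; exact (Category.id_comp _).symm
  · rw [op_id, F.obj.map_id]; rfl

end LocalSections

section Points

variable {G : EtaleGroupoid.{u}}

/-- The neighbourhoods of `x` are cofiltered: a point of a fibre is in the image of a section near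
`x`, and two morphisms with the same value at a point agree nearby. -/
lemma isCofiltered_fib (x : G.Obj) :
    IsCofiltered (inducedFunctor (openSp G) ⋙ fibFunctor x).Elements := by
  refine @IsCofiltered.mk _ _ ⟨?_, ?_⟩ ⟨⟨st ⊤, fibPt (Opens.mem_top x)⟩⟩
  · rintro ⟨U, (p : fib x (openSp G U))⟩ ⟨V, (q : fib x (openSp G V))⟩
    obtain ⟨U₁, hU, j, rfl⟩ := exists_section p
    obtain ⟨V₁, hV, k, rfl⟩ := exists_section q
    refine ⟨⟨st (U₁ ⊓ V₁), fibPt ⟨hU, hV⟩⟩,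
      ⟨incl inf_le_left ≫ InducedCategory.homMk j, ?_⟩,
      ⟨incl inf_le_right ≫ InducedCategory.homMk k, ?_⟩, trivial⟩
    · exact (fibMap_comp x (incl _).hom j _).trans
        (congrArg (fibMap x j) (fibMap_incl _ _))
    · exact (fibMap_comp x (incl _).hom k _).trans
        (congrArg (fibMap x k) (fibMap_incl _ _))
  · rintro ⟨U, (p : fib x (openSp G U))⟩ ⟨V, (q : fib x (openSp G V))⟩ ⟨f, hf⟩ ⟨g, hg⟩
    obtain ⟨U₁, hU, j, rfl⟩ := exists_section p
    have hf' : fibMap x f.hom (fibMap x j (fibPt hU)) = q := hf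
    have hg' : fibMap x g.hom (fibMap x j (fibPt hU)) = q := hg
    rw [← fibMap_comp] at hf' hg'
    obtain ⟨W, hW, hxW, e⟩ := exists_incl_comp_eq (j ≫ f.hom) (j ≫ g.hom) hU
      (hf'.trans hg'.symm)
    refine ⟨⟨st W, fibPt hxW⟩, ⟨incl hW ≫ InducedCategory.homMk j, ?_⟩, ?_⟩
    · exact (fibMap_comp x (incl _).hom j _).trans
        (congrArg (fibMap x j) (fibMap_incl _ _))
    · refine Subtype.ext (InducedCategory.hom_ext ?_)
      exact (Category.assoc _ _ _).trans (e.trans (Category.assoc _ _ _).symm)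

/-- The point of the site of `G` given by an object `x`. -/
noncomputable def fibPoint (x : G.Obj) : (siteTopology G).Point where
  fiber := inducedFunctor (openSp G) ⋙ fibFunctor x
  isCofiltered := isCofiltered_fib x
  initiallySmall := by
    have : LocallySmall.{u} (inducedFunctor (openSp G) ⋙ fibFunctor x).Elements :=
      ⟨fun _ _ => small_self _⟩
    have : EssentiallySmall.{u} (inducedFunctor (openSp G) ⋙ fibFunctor x).Elements :=
      essentiallySmall_of_small_of_locallySmall _
    exact initiallySmall_of_essentiallySmall _
  jointly_surjective {U} R hR (p : fib x (openSp G U)) := by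
    obtain ⟨W, hW, hxW, h⟩ := hR p.1.1.1 p.1.1.2
    exact ⟨st W, incl hW, h, (⟨(⟨_, hxW⟩, p.1.2), p.2⟩ : fib x (openSp G W)), fibMap_incl hW _⟩

/-- The group of families of functions on the fibres of `E`, with values in given groups `D x`. -/
noncomputable def skyFunctor (D : G.Obj → AddCommGrpCat.{u}) : (EtSp G)ᵒᵖ ⥤ AddCommGrpCat.{u} where
  obj E := AddCommGrpCat.of (∀ x, fib x E.unop → D x)
  map f := AddCommGrpCat.ofHom (AddMonoidHom.mk' (fun s x p => s x (fibMap x f.unop p))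
    fun _ _ => rfl)
  map_id E := by
    refine AddCommGrpCat.hom_ext (AddMonoidHom.ext fun s => funext fun x => funext fun p => ?_)
    exact congrArg (s x) (fibMap_id x _ p)
  map_comp f g := by
    refine AddCommGrpCat.hom_ext (AddMonoidHom.ext fun s => funext fun x => funext fun p => ?_)
    exact congrArg (s x) (fibMap_comp x _ _ p)

lemma isSheaf_sky (D : G.Obj → AddCommGrpCat.{u}) : Presheaf.IsSheaf (siteTopology G)
    ((inducedFunctor (openSp G)).op ⋙ skyFunctor D) := by
  refine isSheaf_of_local _ (fun U (s : ∀ x, fib x (openSp G U) → D x)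
    (t : ∀ x, fib x (openSp G U) → D x) hst => ?_)
    (fun U W hW hxW (s : ∀ y, ∀ x, fib x (openSp G (W y)) → D x) hs => ?_)
  · funext x p
    obtain ⟨W, hW, hpW, e⟩ := hst p.1.1.1 p.1.1.2
    have h := congrFun (congrFun e x) ⟨(⟨p.1.1.1, hpW⟩, p.1.2), p.2⟩
    have h1 : fibMap x (incl hW).hom ⟨(⟨p.1.1.1, hpW⟩, p.1.2), p.2⟩ = p := fibMap_incl hW _
    exact (congrArg (s x) h1).symm.trans (h.trans (congrArg (t x) h1))
  · have key : ∀ (a b : U) (x : G.Obj) (p : fib x (openSp G U)) (ha : p.1.1.1 ∈ W a)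
        (hb : p.1.1.1 ∈ W b), s a x ⟨(⟨p.1.1.1, ha⟩, p.1.2), p.2⟩ =
          s b x ⟨(⟨p.1.1.1, hb⟩, p.1.2), p.2⟩ := by
      intro a b x p ha hb
      have h := congrFun (congrFun (hs a b) x) ⟨(⟨p.1.1.1, ha, hb⟩, p.1.2), p.2⟩
      have h1 : fibMap x (incl (inf_le_left : W a ⊓ W b ≤ W a)).hom
          ⟨(⟨p.1.1.1, ha, hb⟩, p.1.2), p.2⟩ = ⟨(⟨p.1.1.1, ha⟩, p.1.2), p.2⟩ := fibMap_incl _ _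
      have h2 : fibMap x (incl (inf_le_right : W a ⊓ W b ≤ W b)).hom
          ⟨(⟨p.1.1.1, ha, hb⟩, p.1.2), p.2⟩ = ⟨(⟨p.1.1.1, hb⟩, p.1.2), p.2⟩ := fibMap_incl _ _
      exact (congrArg (s a x) h1).symm.trans (h.trans (congrArg (s b x) h2))
    refine ⟨(fun x p => s p.1.1 x ⟨(⟨p.1.1.1, hxW _⟩, p.1.2), p.2⟩ :
      ∀ x, fib x (openSp G U) → D x), fun a => ?_⟩
    funext x (p : fib x (openSp G (W a)))
    exact key _ a x (fibMap x (incl (hW a)).hom p) _ p.1.1.2 |>.trans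
      (congrArg (s a x) (fib_ext rfl (one_mul' _)))

/-- The product of skyscraper `G`-sheaves with values in the groups `D x`. -/
noncomputable def skySheaf (D : G.Obj → AddCommGrpCat.{u}) : GSheaf G := ⟨_, isSheaf_sky D⟩

/-- There are enough points: every `G`-sheaf embeds into a product of skyscraper sheaves with
injective values. -/
lemma exists_mono_skySheaf (F : GSheaf G) :
    ∃ (D : G.Obj → AddCommGrpCat.{u}) (_ : ∀ x, Injective (D x)) (i : F ⟶ skySheaf D), Mono i := by
  let D : G.Obj → AddCommGrpCat.{u} := fun x =>
    Injective.under ((fibPoint x).presheafFiber.obj F.obj)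
  let germ : ∀ (x : G.Obj) (U : (Site G)ᵒᵖ) (p : fib x (openSp G U.unop)), F.obj.obj U →+ D x :=
    fun x U p => ((fibPoint x).toPresheafFiber U.unop p F.obj ≫ Injective.ι _).hom
  let i : F ⟶ skySheaf D :=
    { hom :=
      { app := fun U => AddCommGrpCat.ofHom (AddMonoidHom.mk' (fun σ x p => germ x U p σ)
          fun σ τ => funext fun x => funext fun p => map_add (germ x U p) σ τ)
        naturality := fun U V f => by
          refine AddCommGrpCat.hom_ext (AddMonoidHom.ext fun σ => funext fun x => funext fun p => ?_)
          have := (fibPoint x).toPresheafFiber_w f.unop p F.obj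
          change germ x V p (F.obj.map f σ) = germ x U (fibMap x f.unop.hom p) σ
          exact (congrArg (fun k : F.obj.obj U ⟶ (fibPoint x).presheafFiber.obj F.obj =>
            (k ≫ Injective.ι _ : F.obj.obj U ⟶ D x).hom σ) this) } }
  refine ⟨D, fun x => inferInstanceAs (Injective (Injective.under _)), i, ?_⟩
  refine Sheaf.mono_of_injective _ fun U => (injective_iff_map_eq_zero (i.hom.app U).hom).2 ?_
  intro σ hσ
  change F.obj.obj (op (st (Site.opens U.unop))) at σ
  refine eq_of_locally_eq F σ 0 fun x hx => ?_
  have h1 : germ x U (fibPt hx) σ = 0 := congrFun (congrFun hσ x) (fibPt hx)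
  have h2 : (fibPoint x).toPresheafFiber U.unop (fibPt hx) F.obj σ =
      (fibPoint x).toPresheafFiber U.unop (fibPt hx) F.obj 0 := by
    refine (AddCommGrpCat.mono_iff_injective (Injective.ι _)).1 inferInstance ?_
    refine h1.trans ?_
    rw [map_zero]
    exact (map_zero _).symm
  obtain ⟨V, f, q, hq, e⟩ := ((fibPoint x).toPresheafFiber_eq_iff' _ _ _ _).1 h2
  change fib x (openSp G V) at q
  obtain ⟨V₁, hV, k, rfl⟩ := exists_section q
  have h3 : fibMap x (k ≫ f.hom) (fibPt hV) = fibPt hx := (fibMap_comp x k f.hom _).trans hq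
  obtain ⟨W, hW, hxW, e'⟩ := exists_incl_comp_eq
    ((incl (inf_le_left : V₁ ⊓ Site.opens U.unop ≤ V₁)).hom ≫ k ≫ f.hom)
    (incl (inf_le_right : V₁ ⊓ Site.opens U.unop ≤ _)).hom (x := x) ⟨hV, hx⟩ (by
      have h4 : fibMap x (incl (inf_le_left : V₁ ⊓ Site.opens U.unop ≤ V₁)).hom
        (fibPt ⟨hV, hx⟩) = fibPt hV := fibMap_incl _ _
      have h5 : fibMap x (incl (inf_le_right : V₁ ⊓ Site.opens U.unop ≤ _)).hom
        (fibPt ⟨hV, hx⟩) = fibPt hx := fibMap_incl _ _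
      rw [fibMap_comp, h4, h5, h3])
  refine ⟨W, hW.trans inf_le_right, hxW, ?_⟩
  have e1 : incl (hW.trans inf_le_right) =
      incl (hW.trans inf_le_left) ≫ (InducedCategory.homMk k : st V₁ ⟶ V) ≫ f := by
    rw [← incl_comp hW inf_le_right, ← incl_comp hW inf_le_left]
    exact InducedCategory.hom_ext (e'.symm.trans (Category.assoc _ _ _).symm)
  rw [e1]
  simp only [op_comp, F.obj.map_comp, ConcreteCategory.comp_apply]
  rw [e]

/-- An injective sheaf is a retract of a product of skyscraper sheaves with injective values. -/
lemma exists_retract_skySheaf (T : GSheaf G) (hT : Injective T) :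
    ∃ (D : G.Obj → AddCommGrpCat.{u}) (_ : ∀ x, Injective (D x)) (i : T ⟶ skySheaf D)
      (r : skySheaf D ⟶ T), i ≫ r = 𝟙 T := by
  obtain ⟨D, hD, i, hi⟩ := exists_mono_skySheaf T
  exact ⟨D, hD, i, Injective.factorThru (𝟙 T) i, Injective.comp_factorThru _ _⟩

end Points

/-! ### Cocycles and sections -/

section AbelianGroups

variable (K L : CochainComplex AddCommGrpCat.{u} ℕ)

/-- Elements killed by the differential come from the object of cocycles. -/
lemma exists_cycle {n : ℕ} (x : K.X n) (hx : (K.d n (n + 1)).hom x = 0) :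
    ∃ z : K.cycles n, (K.iCycles n).hom z = x := by
  let g : AddCommGrpCat.of (ULift.{u} ℤ) ⟶ K.X n :=
    AddCommGrpCat.ofHom ((zmultiplesHom _ x).comp AddEquiv.ulift.toAddMonoidHom)
  have hg : ∀ a : ULift.{u} ℤ, g.hom a = a.down • x := fun _ => rfl
  have h : g ≫ K.d n (n + 1) = 0 := by
    refine AddCommGrpCat.hom_ext (AddMonoidHom.ext fun a => ?_)
    change (K.d n (n + 1)).hom (g.hom a) = 0
    rw [hg, map_zsmul, hx, zsmul_zero]
  refine ⟨(K.liftCycles g (n + 1) (by simp) h).hom (ULift.up 1), ?_⟩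
  have := congrArg (fun k => k.hom (ULift.up (1 : ℤ))) (K.liftCycles_i g (n + 1) (by simp) h)
  exact this.trans ((hg _).trans (one_zsmul x))

lemma iCycles_injective (n : ℕ) : Function.Injective (K.iCycles n).hom :=
  (AddCommGrpCat.mono_iff_injective _).1 inferInstance

lemma homologyπ_surjective (n : ℕ) : Function.Surjective (K.homologyπ n).hom :=
  (AddCommGrpCat.epi_iff_surjective _).1 inferInstance

lemma d_iCycles (n : ℕ) (z : K.cycles n) : (K.d n (n + 1)).hom ((K.iCycles n).hom z) = 0 :=
  congrArg (fun k => k.hom z) (K.iCycles_d n (n + 1))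

lemma homologyπ_eq_zero_iff (n : ℕ) (z : K.cycles (n + 1)) :
    (K.homologyπ (n + 1)).hom z = 0 ↔
      ∃ y : K.X n, (K.d n (n + 1)).hom y = (K.iCycles (n + 1)).hom z := by
  constructor
  · intro h
    let S := ShortComplex.mk (K.toCycles n (n + 1)) (K.homologyπ (n + 1)) (by simp)
    have hS : S.Exact := S.exact_of_g_is_cokernel (K.homologyIsCokernel n (n + 1) (by simp))
    obtain ⟨y, hy⟩ := (ShortComplex.ab_exact_iff S).1 hS z h
    refine ⟨y, ?_⟩
    have h1 := congrArg (fun k => k.hom y) (K.toCycles_i n (n + 1))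
    exact h1.symm.trans (congrArg (K.iCycles (n + 1)).hom hy)
  · rintro ⟨y, hy⟩
    have h1 := congrArg (fun k => k.hom y) (K.toCycles_i n (n + 1))
    have h2 : (K.toCycles n (n + 1)).hom y = z :=
      iCycles_injective K _ (h1.trans hy)
    rw [← h2]
    exact congrArg (fun k => k.hom y) (K.toCycles_comp_homologyπ n (n + 1))

lemma homologyMap_homologyπ {K L : CochainComplex AddCommGrpCat.{u} ℕ} (f : K ⟶ L) (n : ℕ)
    (z : K.cycles n) (z' : L.cycles n) (h : (L.iCycles n).hom z' = (f.f n).hom ((K.iCycles n).hom z)) :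
    (HomologicalComplex.homologyMap f n).hom ((K.homologyπ n).hom z) = (L.homologyπ n).hom z' := by
  have h1 := congrArg (fun k => k.hom z) (HomologicalComplex.homologyπ_naturality f n)
  have h2 := congrArg (fun k => k.hom z) (HomologicalComplex.cyclesMap_i f n)
  have h3 : (HomologicalComplex.cyclesMap f n).hom z = z' :=
    iCycles_injective L n (h2.trans h.symm)
  rw [← h3]
  exact h1

/-- An additive map of degree `-1` which preserves cycles and boundaries acts on cohomology. -/
lemma exists_homology_hom (n : ℕ) (f : K.X (n + 2) →+ L.X (n + 1))
    (hf : ∀ x, (K.d (n + 2) (n + 3)).hom x = 0 → (L.d (n + 1) (n + 2)).hom (f x) = 0)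
    (hf' : ∀ y, ∃ w, (L.d n (n + 1)).hom w = f ((K.d (n + 1) (n + 2)).hom y)) :
    ∃ F : K.homology (n + 2) →+ L.homology (n + 1), ∀ z z',
      (L.iCycles (n + 1)).hom z' = f ((K.iCycles (n + 2)).hom z) →
        F ((K.homologyπ (n + 2)).hom z) = (L.homologyπ (n + 1)).hom z' := by
  choose r hr using fun z : K.cycles (n + 2) => exists_cycle L (f ((K.iCycles (n + 2)).hom z))
    (hf _ (d_iCycles K _ z))
  choose s hs using homologyπ_surjective K (n + 2)
  have key : ∀ z z', (L.iCycles (n + 1)).hom z' = f ((K.iCycles (n + 2)).hom z) →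
      ∀ x, x = (K.homologyπ (n + 2)).hom z →
        (L.homologyπ (n + 1)).hom (r (s x)) = (L.homologyπ (n + 1)).hom z' := by
    intro z z' h x hx
    rw [← sub_eq_zero, ← map_sub, homologyπ_eq_zero_iff]
    have h1 : (K.homologyπ (n + 2)).hom (s x - z) = 0 := by
      rw [map_sub, hs, hx, sub_self]
    obtain ⟨y, hy⟩ := (homologyπ_eq_zero_iff K (n + 1) _).1 h1
    obtain ⟨w, hw⟩ := hf' y
    refine ⟨w, ?_⟩
    rw [hw, hy, map_sub, map_sub, map_sub, hr, h]
  refine ⟨AddMonoidHom.mk' (fun x => (L.homologyπ (n + 1)).hom (r (s x))) fun x y => ?_,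
    fun z z' h => key z z' h _ rfl⟩
  refine (key (s x + s y) (r (s x) + r (s y)) ?_ _ ?_).trans (map_add _ _ _)
  · rw [map_add, map_add, map_add, hr, hr]
  · rw [map_add, hs, hs]

end AbelianGroups

namespace Sec

variable {G : EtaleGroupoid.{u}} {E E' E'' : EtSp G} {F F' F'' : GSheaf G}

@[ext] lemma ext {c c' : Sec E F} (h : ∀ U j, c.val U j = c'.val U j) : c = c' := by
  cases c; cases c'
  congr
  exact funext fun U => funext fun j => h U j

instance : Zero (Sec E F) := ⟨⟨fun _ _ => 0, fun _ _ _ _ => (map_zero _).symm⟩⟩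

instance : Add (Sec E F) := ⟨fun c c' => ⟨fun U j => c.val U j + c'.val U j, fun U V f j => by
  rw [c.val_comp, c'.val_comp, map_add]⟩⟩

instance : Neg (Sec E F) := ⟨fun c => ⟨fun U j => -c.val U j, fun U V f j => by
  rw [c.val_comp, map_neg]⟩⟩

@[simp] lemma add_val (c c' : Sec E F) (U : Opens G.Obj) (j : openSp G U ⟶ E) :
    (c + c').val U j = c.val U j + c'.val U j := rfl

instance : AddCommGroup (Sec E F) where
  add_assoc a b c := ext fun U j => add_assoc _ _ _
  zero_add a := ext fun U j => zero_add _
  add_zero a := ext fun U j => add_zero _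
  add_comm a b := ext fun U j => add_comm _ _
  neg_add_cancel a := ext fun U j => neg_add_cancel _
  nsmul := nsmulRec
  zsmul := zsmulRec

@[simp] lemma sub_val (c c' : Sec E F) (U : Opens G.Obj) (j : openSp G U ⟶ E) :
    (c - c').val U j = c.val U j - c'.val U j := by
  rw [sub_eq_add_neg, sub_eq_add_neg]; rfl

/-- Push-forward of sections along a morphism of `G`-sheaves. -/
noncomputable def map (f : F ⟶ F') : Sec E F →+ Sec E F' :=
  AddMonoidHom.mk' (fun c => ⟨fun U j => onSec f (c.val U j), fun U V g j => by
    rw [c.val_comp]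
    exact congrArg (fun k => k.hom (c.val V j)) (f.hom.naturality g.op)⟩)
    fun _ _ => ext fun _ _ => map_add (onSec f) _ _

/-- Pull-back of sections along a morphism of spaces étale over `G`. -/
def pull (g : E' ⟶ E) : Sec E F →+ Sec E' F :=
  AddMonoidHom.mk' (fun c => ⟨fun U j => c.val U (j ≫ g), fun U V f j => by
    rw [Category.assoc, c.val_comp]⟩) fun _ _ => rfl

@[simp] lemma map_val (f : F ⟶ F') (c : Sec E F) (U : Opens G.Obj) (j : openSp G U ⟶ E) :
    (map f c).val U j = onSec f (c.val U j) := rfl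

@[simp] lemma pull_val (g : E' ⟶ E) (c : Sec E F) (U : Opens G.Obj) (j : openSp G U ⟶ E') :
    (pull g c).val U j = c.val U (j ≫ g) := rfl

lemma map_map (f : F ⟶ F') (g : F' ⟶ F'') (c : Sec E F) : map g (map f c) = map (f ≫ g) c := rfl

lemma map_id (c : Sec E F) : map (𝟙 F) c = c := rfl

lemma map_pull (f : F ⟶ F') (g : E' ⟶ E) (c : Sec E F) :
    map f (pull g c) = pull g (map f c) := rfl

lemma pull_pull (g : E' ⟶ E) (g' : E'' ⟶ E') (c : Sec E F) :
    pull g' (pull g c) = pull (g' ≫ g) c :=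
  ext fun U j => by simp only [pull_val, Category.assoc]

/-- The section over `E` given by an invariant section. -/
noncomputable def ofInv (E : EtSp G) : invSections G F →+ Sec E F :=
  AddMonoidHom.mk' (fun σ => ⟨fun U _ => restr σ.1 U, fun U V f _ => by
    have := σ.2 U (f ≫ incl le_top)
    rw [op_comp, F.obj.map_comp, ConcreteCategory.comp_apply] at this
    exact this.symm⟩) fun σ τ => ext fun U _ => map_add _ _ _

lemma map_ofInv (f : F ⟶ F') (σ : invSections G F) :
    map f (ofInv E σ) = ofInv E (((Γinv G).map f).hom σ) :=
  ext fun U _ => congrArg (fun k => k.hom σ.1) (f.hom.naturality (incl (le_top : U ≤ ⊤)).op)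

/-- The section of `𝒜^p` given by a form. -/
noncomputable def ofForm {p : ℕ} : Form p E →+ Sec E (formSheaf G p) :=
  AddMonoidHom.mk' (fun α => ⟨fun _ j => pullForm α j, fun _ _ f j =>
    congrArg (fun k => k.hom α) ((formFunctor G p).map_comp j.op f.hom.op)⟩)
    fun α β => ext fun _ j => map_add (Form.pull (EtSp.smap j)) α β

/-- The section of `ℂ^×` given by a function. -/
noncomputable def ofUnits : smoothUnits E →+ Sec E (unitsSheaf G) :=
  AddMonoidHom.mk' (fun α => ⟨fun _ j => pullUnits α j, fun _ _ _ _ => rfl⟩) fun _ _ => rfl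

lemma pull_ofForm {p : ℕ} (g : E' ⟶ E) (α : Form p E) :
    pull g (ofForm α) = ofForm (Form.pull (EtSp.smap g) α) :=
  ext fun _ j => congrArg (fun k => k.hom α) ((formFunctor G p).map_comp g.op j.op)

lemma pull_ofUnits (g : E' ⟶ E) (h : smoothUnits E) :
    pull g (ofUnits h) = ofUnits (smoothUnits.pull (EtSp.smap g) h) := rfl

lemma map_dSheaf {p : ℕ} (α : Form p E) : map (dSheaf G p) (ofForm α) = ofForm (Form.d α) :=
  ext fun _ j => Form.d_pull (EtSp.smap j) α

lemma map_dlogSheaf (h : smoothUnits E) : map (dlogSheaf G) (ofUnits h) = ofForm (dlog h) :=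
  ext fun _ j => dlog_pull (EtSp.smap j) h

end Sec

/-! ### The Čech complex of a Morita morphism -/

namespace Sec

variable {G : EtaleGroupoid.{u}} {E E' : EtSp G} {F : GSheaf G}

/-- The section of a product of skyscraper sheaves given by functions on the fibres. -/
noncomputable def ofFib (D : G.Obj → AddCommGrpCat.{u}) :
    (∀ x, fib x E → D x) →+ Sec E (skySheaf D) :=
  AddMonoidHom.mk' (fun s =>
    { val := fun _ j => (fun x p => s x (fibMap x j p) : ∀ x, fib x (openSp G _) → D x)
      val_comp := fun _ _ f j => funext fun x => funext fun p =>
        congrArg (s x) (fibMap_comp x f.hom j p) }) fun _ _ => rfl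

lemma pull_ofFib {D : G.Obj → AddCommGrpCat.{u}} (g : E' ⟶ E) (s : ∀ x, fib x E → D x) :
    pull g (ofFib D s) = ofFib D fun x p => s x (fibMap x g p) :=
  ext fun _ j => funext fun x => funext fun p => congrArg (s x) (fibMap_comp x j g p)

lemma ofFib_injective (D : G.Obj → AddCommGrpCat.{u}) :
    Function.Injective (ofFib (E := E) D) := by
  refine fun s t h => funext fun x => funext fun p => ?_
  obtain ⟨U, hx, j, rfl⟩ := exists_section p
  exact congrFun (congrFun (congrArg (fun c : Sec E (skySheaf D) =>
    (c.val U j : ∀ x, fib x (openSp G U) → D x)) h) x) (fibPt hx)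

/-- The sections of a product of skyscraper sheaves over `E` are all functions on the fibres of
`E`. -/
lemma ofFib_surjective (D : G.Obj → AddCommGrpCat.{u}) :
    Function.Surjective (ofFib (E := E) D) := by
  intro c
  let v : ∀ (U : Opens G.Obj) (_ : openSp G U ⟶ E) (x : G.Obj), fib x (openSp G U) → D x :=
    fun U j => c.val U j
  have hv : ∀ (U V : Opens G.Obj) (f : st U ⟶ st V) (j : openSp G V ⟶ E) (x : G.Obj)
      (p : fib x (openSp G U)), v U (f.hom ≫ j) x p = v V j x (fibMap x f.hom p) :=
    fun U V f j x p => congrFun (congrFun (c.val_comp U V f j) x) p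
  choose N hN s hs using fun (x : G.Obj) (p : fib x E) => exists_section p
  refine ⟨fun x p => v (N x p) (s x p) x (fibPt (hN x p)), ext fun U j => funext fun x =>
    funext fun p => ?_⟩
  change fib x (openSp G U) at p
  change v _ _ x (fibPt (hN x (fibMap x j p))) = v U j x p
  obtain ⟨V, hV, k, rfl⟩ := exists_section p
  refine Eq.trans ?_ (hv V U (InducedCategory.homMk k) j x (fibPt hV))
  change _ = v V (k ≫ j) x (fibPt hV)
  have e := hs x (fibMap x j (fibMap x k (fibPt hV)))
  generalize s x (fibMap x j (fibMap x k (fibPt hV))) = s' at e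
  generalize hN x (fibMap x j (fibMap x k (fibPt hV))) = hN' at e
  revert s' hN'
  generalize N x (fibMap x j (fibMap x k (fibPt hV))) = N'
  intro s' hN' e
  have h4 : fibMap x (incl (inf_le_left : N' ⊓ V ≤ N')).hom (fibPt ⟨hN', hV⟩) = fibPt hN' :=
    fibMap_incl _ _
  have h5 : fibMap x (incl (inf_le_right : N' ⊓ V ≤ V)).hom (fibPt ⟨hN', hV⟩) = fibPt hV :=
    fibMap_incl _ _
  obtain ⟨W, hW, hxW, e'⟩ := exists_incl_comp_eq
    ((incl (inf_le_left : N' ⊓ V ≤ N')).hom ≫ s') ((incl (inf_le_right : N' ⊓ V ≤ V)).hom ≫ k ≫ j)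
    (x := x) ⟨hN', hV⟩ (by
      rw [fibMap_comp, fibMap_comp, fibMap_comp, h4, h5, e])
  have h6 : fibMap x (incl hW).hom (fibPt hxW) = fibPt (U := N' ⊓ V) ⟨hN', hV⟩ := fibMap_incl _ _
  have h7 := congrArg (fun k => v W k x (fibPt hxW)) e'
  rw [hv, hv, h6, hv, h4, hv, h6, h5] at h7
  exact h7

end Sec

namespace EtaleFunctor

variable {K G : EtaleGroupoid.{u}} (φ : EtaleFunctor K G)

/-- The space of composable triples of arrows of `K`. -/
def Arr₃ (K : EtaleGroupoid.{u}) : Type u := {p : K.Arr₂ × K.Arr // K.tgt p.1.1.2 = K.src p.2}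

instance (K : EtaleGroupoid.{u}) : TopologicalSpace (Arr₃ K) :=
  inferInstanceAs (TopologicalSpace {_p : K.Arr₂ × K.Arr // _})

/-- The smooth structure for which the étale map to the last arrow is smooth. -/
instance (K : EtaleGroupoid.{u}) : SmoothSpace (Arr₃ K) := SmoothSpace.induced fun p => p.1.2

lemma etale_last (K : EtaleGroupoid.{u}) : IsEtale fun p : Arr₃ K => p.1.2 := by
  refine IsEtale.induced (isLocalHomeomorph_pullback (b := fun p : Arr₃ K => p.1.1)
    (K.etale_tgt.comp K.etale_snd).isLocalHomeomorph K.etale_src.isLocalHomeomorph.continuous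
    ?_ (fun p => p.2.symm) (fun y x h => ⟨(x, y), h.symm⟩) (fun _ _ _ => rfl) (fun _ _ _ => rfl)
    fun _ => rfl)
  exact (Homeomorph.prodComm _ _).isInducing.comp IsInducing.subtypeVal

/-- The space of composable triples, as a space étale over `G`, by the target of the last arrow. -/
def E₃ : EtSp G where
  carrier := Arr₃ K
  proj p := φ.obj (K.tgt p.1.2)
  etale := (φ.etale_obj.comp K.etale_tgt).comp (etale_last K)

lemma continuous_triple_init (K : EtaleGroupoid.{u}) : Continuous fun p : Arr₃ K => p.1.1 :=
  _root_.continuous_fst.comp continuous_subtype_val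

/-- The face `(k₁, k₂, k₃) ↦ (k₂, k₃)`. -/
def face₃₀ : φ.E₃ ⟶ φ.E₂ where
  map p := ⟨(p.1.1.1.2, p.1.2), p.2⟩
  arr p := G.one (φ.obj (K.tgt p.1.2))
  continuous_map := ((K.etale_snd.isLocalHomeomorph.continuous.comp
    (continuous_triple_init K)).prodMk (etale_last K).isLocalHomeomorph.continuous).subtype_mk _
  continuous_arr := G.continuous_one.comp φ.E₃.etale.isLocalHomeomorph.continuous
  src_arr _ := G.src_one _
  tgt_arr _ := G.tgt_one _

/-- The face `(k₁, k₂, k₃) ↦ (k₁k₂, k₃)`. -/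
def face₃₁ : φ.E₃ ⟶ φ.E₂ where
  map p := ⟨(K.mul p.1.1.1.1 p.1.1.1.2 p.1.1.2, p.1.2), (K.tgt_mul _ _ _).trans p.2⟩
  arr p := G.one (φ.obj (K.tgt p.1.2))
  continuous_map := ((K.continuous_mul.comp
    (continuous_triple_init K)).prodMk (etale_last K).isLocalHomeomorph.continuous).subtype_mk _
  continuous_arr := G.continuous_one.comp φ.E₃.etale.isLocalHomeomorph.continuous
  src_arr _ := G.src_one _
  tgt_arr _ := G.tgt_one _

/-- The face `(k₁, k₂, k₃) ↦ (k₁, k₂k₃)`. -/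
def face₃₂ : φ.E₃ ⟶ φ.E₂ where
  map p := ⟨(p.1.1.1.1, K.mul p.1.1.1.2 p.1.2 p.2), p.1.1.2.trans (K.src_mul _ _ _).symm⟩
  arr p := G.one (φ.obj (K.tgt p.1.2))
  continuous_map := ((K.continuous_fst.comp
    (continuous_triple_init K)).prodMk (continuous_mul'
    (K.etale_snd.isLocalHomeomorph.continuous.comp (continuous_triple_init K)) (etale_last K).isLocalHomeomorph.continuous _)).subtype_mk _
  continuous_arr := G.continuous_one.comp φ.E₃.etale.isLocalHomeomorph.continuous
  src_arr _ := (G.src_one _).trans (congrArg φ.obj (K.tgt_mul _ _ _).symm)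
  tgt_arr _ := G.tgt_one _

/-- The face `(k₁, k₂, k₃) ↦ (k₁, k₂)`; sections over `K₂` are moved by the arrow `k₃`. -/
def face₃₃ : φ.E₃ ⟶ φ.E₂ where
  map p := p.1.1
  arr p := φ.arr p.1.2
  continuous_map := continuous_triple_init K
  continuous_arr := φ.continuous_arr.comp (etale_last K).isLocalHomeomorph.continuous
  src_arr p := (φ.src_arr _).trans (congrArg φ.obj p.2.symm)
  tgt_arr _ := φ.tgt_arr _

lemma face₂₀_face₁₁ : φ.face₂₀ ≫ φ.face₁₁ = φ.face₂₂ ≫ φ.face₁₀ :=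
  EtSp.hom_ext (funext fun p => p.2.symm)
    (funext fun _ => (mul_one' _).trans (one_mul' _).symm)

lemma face₂₁_face₁₁ : φ.face₂₁ ≫ φ.face₁₁ = φ.face₂₂ ≫ φ.face₁₁ :=
  EtSp.hom_ext (funext fun _ => K.src_mul _ _ _)
    (funext fun _ => (mul_one' _).trans (φ.arr_mul _ _ _))

lemma face₂₁_face₁₀ : φ.face₂₁ ≫ φ.face₁₀ = φ.face₂₀ ≫ φ.face₁₀ :=
  EtSp.hom_ext (funext fun _ => K.tgt_mul _ _ _)
    (funext fun _ => mul_congr (congrArg (fun y => G.one (φ.obj y)) (K.tgt_mul _ _ _)) rfl)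

lemma face₃₁_face₂₂ : φ.face₃₁ ≫ φ.face₂₂ = φ.face₃₃ ≫ φ.face₂₁ :=
  EtSp.hom_ext rfl (funext fun _ => (mul_one' _).trans (one_mul' _).symm)

lemma face₃₂_face₂₂ : φ.face₃₂ ≫ φ.face₂₂ = φ.face₃₃ ≫ φ.face₂₂ :=
  EtSp.hom_ext rfl (funext fun _ => (mul_one' _).trans (φ.arr_mul _ _ _))

lemma face₃₁_face₂₀ : φ.face₃₁ ≫ φ.face₂₀ = φ.face₃₀ ≫ φ.face₂₀ := rfl

lemma face₃₂_face₂₀ : φ.face₃₂ ≫ φ.face₂₀ = φ.face₃₀ ≫ φ.face₂₁ :=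
  EtSp.hom_ext rfl (funext fun _ =>
    mul_congr (congrArg (fun y => G.one (φ.obj y)) (K.tgt_mul _ _ _)) rfl)

section Differentials

variable {F F' : GSheaf G}

/-- The Čech differential in degree `0`. -/
def δ₀ : Sec φ.E₀ F →+ Sec φ.E₁ F := Sec.pull φ.face₁₁ - Sec.pull φ.face₁₀

/-- The Čech differential in degree `1`. -/
def δ₁ : Sec φ.E₁ F →+ Sec φ.E₂ F :=
  Sec.pull φ.face₂₀ - Sec.pull φ.face₂₁ + Sec.pull φ.face₂₂

/-- The Čech differential in degree `2`. -/
def δ₂ : Sec φ.E₂ F →+ Sec φ.E₃ F :=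
  Sec.pull φ.face₃₀ - Sec.pull φ.face₃₁ + Sec.pull φ.face₃₂ - Sec.pull φ.face₃₃

lemma δ₀_apply (c : Sec φ.E₀ F) : φ.δ₀ c = Sec.pull φ.face₁₁ c - Sec.pull φ.face₁₀ c := rfl

lemma δ₁_apply (c : Sec φ.E₁ F) :
    φ.δ₁ c = Sec.pull φ.face₂₀ c - Sec.pull φ.face₂₁ c + Sec.pull φ.face₂₂ c := rfl

lemma δ₂_apply (c : Sec φ.E₂ F) : φ.δ₂ c = Sec.pull φ.face₃₀ c - Sec.pull φ.face₃₁ c +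
    Sec.pull φ.face₃₂ c - Sec.pull φ.face₃₃ c := rfl

lemma map_δ₀ (f : F ⟶ F') (c : Sec φ.E₀ F) : Sec.map f (φ.δ₀ c) = φ.δ₀ (Sec.map f c) := by
  simp only [δ₀_apply, map_sub, Sec.map_pull]

lemma map_δ₁ (f : F ⟶ F') (c : Sec φ.E₁ F) : Sec.map f (φ.δ₁ c) = φ.δ₁ (Sec.map f c) := by
  simp only [δ₁_apply, map_sub, map_add, Sec.map_pull]

lemma map_δ₂ (f : F ⟶ F') (c : Sec φ.E₂ F) : Sec.map f (φ.δ₂ c) = φ.δ₂ (Sec.map f c) := by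
  simp only [δ₂_apply, map_sub, map_add, Sec.map_pull]

end Differentials

section Exactness

variable {φ} {x : G.Obj}

/-- The points of the fibres of `K₂` are the pairs of composable points of the fibres of `K₁`. -/
lemma exists_fib₂ (r s : fib x φ.E₁) (h : fibMap x φ.face₁₁ s = fibMap x φ.face₁₀ r) :
    ∃ w : fib x φ.E₂, fibMap x φ.face₂₀ w = s ∧ fibMap x φ.face₂₂ w = r := by
  obtain ⟨⟨k, g⟩, hr⟩ := r
  obtain ⟨⟨l, g'⟩, hs⟩ := s
  have h1 : K.src l = K.tgt k := congrArg (fun q : fib x φ.E₀ => q.1.1) h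
  have h2 : G.mul (φ.arr l) g' _ = G.mul (G.one _) g _ :=
    congrArg (fun q : fib x φ.E₀ => q.1.2) h
  refine ⟨⟨(⟨(k, l), h1.symm⟩, g'), hs⟩, fib_ext rfl (one_mul' _), fib_ext rfl ?_⟩
  exact h2.trans (one_mul' _)

/-- The points of the fibres of `K₃` are the triples of composable points of the fibres of `K₁`. -/
lemma exists_fib₃ (r s : fib x φ.E₂) (h : fibMap x φ.face₂₂ s = fibMap x φ.face₂₀ r) :
    ∃ w : fib x φ.E₃, fibMap x φ.face₃₀ w = s ∧ fibMap x φ.face₃₃ w = r := by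
  obtain ⟨⟨⟨⟨k, l⟩, hkl⟩, g⟩, hr⟩ := r
  obtain ⟨⟨⟨⟨l', m⟩, hlm⟩, g'⟩, hs⟩ := s
  have h1 : l' = l := congrArg (fun q : fib x φ.E₁ => q.1.1) h
  subst h1
  have h2 : G.mul (φ.arr m) g' _ = G.mul (G.one _) g _ :=
    congrArg (fun q : fib x φ.E₁ => q.1.2) h
  refine ⟨⟨(⟨(⟨(k, l'), hkl⟩, m), hlm⟩, g'), hs⟩, fib_ext rfl (one_mul' _), fib_ext rfl ?_⟩
  exact h2.trans (one_mul' _)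

/-- For a Morita morphism, the points of the fibre of `K₁` over `x` are the pairs of points of the
fibre of `K₀`. -/
lemma IsMorita.exists_fib₁ (hφ : φ.IsMorita) (p q : fib x φ.E₀) :
    ∃! r : fib x φ.E₁, fibMap x φ.face₁₁ r = p ∧ fibMap x φ.face₁₀ r = q := by
  have hp1 : G.src p.1.2 = φ.obj p.1.1 := p.2.1
  have hq1 : G.src q.1.2 = φ.obj q.1.1 := q.2.1
  have hq : G.tgt p.1.2 = G.src (G.inv q.1.2) := by rw [p.2.2, G.src_inv, q.2.2]
  obtain ⟨k, ⟨hk1, hk2, hk3⟩, hu⟩ := hφ.cartesian p.1.1 q.1.1 (G.mul p.1.2 (G.inv q.1.2) hq)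
    ((G.src_mul _ _ _).trans hp1) ((G.tgt_mul _ _ _).trans ((G.tgt_inv _).trans hq1))
  have hkq : G.src q.1.2 = φ.obj (K.tgt k) := hq1.trans (congrArg φ.obj hk2.symm)
  refine ⟨⟨(k, q.1.2), hkq, q.2.2⟩, ⟨fib_ext hk1 ?_, fib_ext hk2 (one_mul' _)⟩, ?_⟩
  · change G.mul (φ.arr k) q.1.2 ((φ.tgt_arr k).trans hkq.symm) = p.1.2
    rw [mul_congr hk3 rfl, G.mul_assoc _ _ _ hq (G.tgt_inv _), mul_congr rfl (G.inv_mul _),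
      mul_one']
  · rintro ⟨⟨l, g⟩, hl⟩ ⟨e1, e2⟩
    have a1 : K.src l = p.1.1 := congrArg (fun q : fib x φ.E₀ => q.1.1) e1
    have a2 : G.mul (φ.arr l) g _ = p.1.2 := congrArg (fun q : fib x φ.E₀ => q.1.2) e1
    have a3 : K.tgt l = q.1.1 := congrArg (fun q : fib x φ.E₀ => q.1.1) e2
    have a4 : g = q.1.2 :=
      (one_mul' _).symm.trans (congrArg (fun q : fib x φ.E₀ => q.1.2) e2)
    have hl1 : G.src g = φ.obj (K.tgt l) := hl.1
    refine fib_ext (hu l ⟨a1, a3, ?_⟩) a4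
    have a5 : G.mul (φ.arr l) g ((φ.tgt_arr l).trans hl1.symm) = p.1.2 := a2
    rw [← mul_congr a5 (congrArg G.inv a4) (p := by rw [a5, a4]; exact hq),
      G.mul_assoc _ _ _ _ (G.src_inv _).symm, mul_congr rfl (G.mul_inv _), mul_one']

lemma IsMorita.nonempty_fib (hφ : φ.IsMorita) (x : G.Obj) : Nonempty (fib x φ.E₀) := by
  obtain ⟨e, g, h1, h2⟩ := hφ.surjective x
  exact ⟨⟨(e, G.inv g), (G.src_inv _).trans h1.symm, (G.tgt_inv _).trans h2⟩⟩

lemma IsMorita.fib₁_ext (hφ : φ.IsMorita) {r s : fib x φ.E₁}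
    (h : fibMap x φ.face₁₁ r = fibMap x φ.face₁₁ s)
    (h' : fibMap x φ.face₁₀ r = fibMap x φ.face₁₀ s) : r = s :=
  (hφ.exists_fib₁ _ _).unique ⟨rfl, rfl⟩ ⟨h.symm, h'.symm⟩

lemma fib₂_ext {r s : fib x φ.E₂} (h : fibMap x φ.face₂₂ r = fibMap x φ.face₂₂ s)
    (h' : fibMap x φ.face₂₀ r = fibMap x φ.face₂₀ s) : r = s := by
  refine fib_ext (Subtype.ext (Prod.ext ?_ ?_)) ?_
  · exact congrArg (fun q : fib x φ.E₁ => q.1.1) h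
  · exact congrArg (fun q : fib x φ.E₁ => q.1.1) h'
  · exact (one_mul' _).symm.trans ((congrArg (fun q : fib x φ.E₁ => q.1.2) h').trans (one_mul' _))

/-- The Čech complex with values in a product of skyscraper sheaves is exact in degree `1`: after
the choice of a point `o x` in the fibre of `K₀` over each `x`, the value on `p` of a primitive of
`c` is the value of `c` on `(p, o x)`. -/
lemma exists_δ₀_eq_sky (hφ : φ.IsMorita) {D : G.Obj → AddCommGrpCat.{u}}
    (c : Sec φ.E₁ (skySheaf D)) (hc : φ.δ₁ c = 0) : ∃ b, φ.δ₀ b = c := by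
  obtain ⟨s, rfl⟩ := Sec.ofFib_surjective D c
  simp only [δ₁_apply, Sec.pull_ofFib] at hc
  rw [← map_sub, ← map_add, ← map_zero (Sec.ofFib D)] at hc
  have h : ∀ x (w : fib x φ.E₂), s x (fibMap x φ.face₂₀ w) - s x (fibMap x φ.face₂₁ w) +
      s x (fibMap x φ.face₂₂ w) = 0 := fun x w =>
    congrFun (congrFun (Sec.ofFib_injective D hc) x) w
  let o := fun x => (hφ.nonempty_fib x).some
  -- `P x p` is the pair `(p, o x)`
  choose P hP using fun x (p : fib x φ.E₀) => (hφ.exists_fib₁ p (o x)).exists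
  refine ⟨Sec.ofFib D fun x p => s x (P x p), ?_⟩
  simp only [δ₀_apply, Sec.pull_ofFib]
  rw [← map_sub]
  refine congrArg _ (funext fun x => funext fun r => ?_)
  change s x (P x (fibMap x φ.face₁₁ r)) - s x (P x (fibMap x φ.face₁₀ r)) = s x r
  obtain ⟨w, hw1, hw2⟩ := exists_fib₂ r (P x (fibMap x φ.face₁₀ r)) (hP _ _).1
  have hw3 : fibMap x φ.face₂₁ w = P x (fibMap x φ.face₁₁ r) := by
    refine hφ.fib₁_ext ?_ ?_
    · rw [← fibMap_comp, face₂₁_face₁₁, fibMap_comp, hw2, (hP _ _).1]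
    · rw [← fibMap_comp, face₂₁_face₁₀, fibMap_comp, hw1, (hP _ _).2, (hP _ _).2]
  have := h x w
  rw [hw1, hw2, hw3] at this
  rw [← sub_eq_zero, ← neg_eq_zero, ← this]
  abel

/-- The Čech complex with values in a product of skyscraper sheaves is exact in degree `2`: after
the choice of a point `o x` in the fibre of `K₀` over each `x`, the value on `(p, q)` of a primitive
of `c` is the value of `c` on `(p, q, o x)`. -/
lemma exists_δ₁_eq_sky (hφ : φ.IsMorita) {D : G.Obj → AddCommGrpCat.{u}}
    (c : Sec φ.E₂ (skySheaf D)) (hc : φ.δ₂ c = 0) : ∃ b, φ.δ₁ b = c := by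
  obtain ⟨s, rfl⟩ := Sec.ofFib_surjective D c
  simp only [δ₂_apply, Sec.pull_ofFib] at hc
  rw [← map_sub, ← map_add, ← map_sub, ← map_zero (Sec.ofFib D)] at hc
  have h : ∀ x (w : fib x φ.E₃), s x (fibMap x φ.face₃₀ w) - s x (fibMap x φ.face₃₁ w) +
      s x (fibMap x φ.face₃₂ w) - s x (fibMap x φ.face₃₃ w) = 0 := fun x w =>
    congrFun (congrFun (Sec.ofFib_injective D hc) x) w
  let o := fun x => (hφ.nonempty_fib x).some
  -- `W x (p, q)` is the triple `(p, q, o x)`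
  have hW : ∀ x (r : fib x φ.E₁), ∃ w : fib x φ.E₂, fibMap x φ.face₂₂ w = r ∧
      fibMap x φ.face₁₀ (fibMap x φ.face₂₀ w) = o x := fun x r => by
    obtain ⟨t, ht1, ht2⟩ := (hφ.exists_fib₁ (fibMap x φ.face₁₀ r) (o x)).exists
    obtain ⟨w, hw1, hw2⟩ := exists_fib₂ r t ht1
    exact ⟨w, hw2, by rw [hw1, ht2]⟩
  choose W hW1 hW2 using hW
  have hWu : ∀ x (r : fib x φ.E₁) (w : fib x φ.E₂), fibMap x φ.face₂₂ w = r →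
      fibMap x φ.face₁₀ (fibMap x φ.face₂₀ w) = o x → w = W x r := by
    intro x r w h1 h2
    refine fib₂_ext (h1.trans (hW1 x r).symm) (hφ.fib₁_ext ?_ (h2.trans (hW2 x r).symm))
    rw [← fibMap_comp, ← fibMap_comp, face₂₀_face₁₁, fibMap_comp, fibMap_comp, h1, hW1]
  refine ⟨Sec.ofFib D fun x r => s x (W x r), ?_⟩
  simp only [δ₁_apply, Sec.pull_ofFib]
  rw [← map_sub, ← map_add]
  refine congrArg _ (funext fun x => funext fun r => ?_)
  change s x (W x (fibMap x φ.face₂₀ r)) - s x (W x (fibMap x φ.face₂₁ r)) +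
    s x (W x (fibMap x φ.face₂₂ r)) = s x r
  obtain ⟨w, hw1, hw2⟩ := exists_fib₃ r (W x (fibMap x φ.face₂₀ r)) (hW1 _ _)
  have h31 : fibMap x φ.face₃₁ w = W x (fibMap x φ.face₂₁ r) := by
    refine hWu _ _ _ ?_ ?_
    · rw [← fibMap_comp, face₃₁_face₂₂, fibMap_comp, hw2]
    · rw [← fibMap_comp x φ.face₃₁, face₃₁_face₂₀, fibMap_comp, hw1, hW2]
  have h32 : fibMap x φ.face₃₂ w = W x (fibMap x φ.face₂₂ r) := by
    refine hWu _ _ _ ?_ ?_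
    · rw [← fibMap_comp, face₃₂_face₂₂, fibMap_comp, hw2]
    · rw [← fibMap_comp x φ.face₃₂, face₃₂_face₂₀, fibMap_comp, hw1, ← fibMap_comp,
        face₂₁_face₁₀, fibMap_comp, hW2]
  have := h x w
  rw [hw1, hw2, h31, h32] at this
  exact sub_eq_zero.1 this

/-- The Čech complex of a Morita morphism with values in an injective sheaf is exact in
degree `1`. -/
lemma exists_δ₀_eq (hφ : φ.IsMorita) {T : GSheaf G} (hT : Injective T) (c : Sec φ.E₁ T)
    (hc : φ.δ₁ c = 0) : ∃ b, φ.δ₀ b = c := by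
  obtain ⟨D, -, i, r, hir⟩ := exists_retract_skySheaf T hT
  obtain ⟨b, hb⟩ := exists_δ₀_eq_sky hφ (Sec.map i c) (by rw [← map_δ₁, hc, map_zero])
  refine ⟨Sec.map r b, ?_⟩
  rw [← map_δ₀, hb, Sec.map_map, hir, Sec.map_id]

/-- The Čech complex of a Morita morphism with values in an injective sheaf is exact in
degree `2`. -/
lemma exists_δ₁_eq (hφ : φ.IsMorita) {T : GSheaf G} (hT : Injective T) (c : Sec φ.E₂ T)
    (hc : φ.δ₂ c = 0) : ∃ b, φ.δ₁ b = c := by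
  obtain ⟨D, -, i, r, hir⟩ := exists_retract_skySheaf T hT
  obtain ⟨b, hb⟩ := exists_δ₁_eq_sky hφ (Sec.map i c) (by rw [← map_δ₂, hc, map_zero])
  refine ⟨Sec.map r b, ?_⟩
  rw [← map_δ₁, hb, Sec.map_map, hir, Sec.map_id]

lemma ofInv_injective (hφ : φ.IsMorita) (F : GSheaf G) :
    Function.Injective (Sec.ofInv (F := F) φ.E₀) := by
  refine fun σ τ h => Subtype.ext (eq_of_locally_eq F _ _ fun x _ => ?_)
  obtain ⟨p⟩ := hφ.nonempty_fib x
  obtain ⟨U, hx, j, -⟩ := exists_section p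
  exact ⟨U, le_top, hx, congrArg (fun c => c.val U j) h⟩

/-- Descent: the sections over `K₀` whose two pull-backs to `K₁` agree are the invariant
sections. -/
lemma exists_ofInv_eq (hφ : φ.IsMorita) {F : GSheaf G} (c : Sec φ.E₀ F) (hc : φ.δ₀ c = 0) :
    ∃ σ, Sec.ofInv φ.E₀ σ = c := by
  have hc' : ∀ U (j : openSp G U ⟶ φ.E₁), c.val U (j ≫ φ.face₁₁) = c.val U (j ≫ φ.face₁₀) :=
    fun U j => sub_eq_zero.1 ((Sec.sub_val _ _ _ _).symm.trans
      (congrArg (fun c => c.val U j) hc))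
  -- the value of `c` on a morphism `U ⟶ K₀` does not depend on the morphism
  have key : ∀ U (j j' : openSp G U ⟶ φ.E₀), c.val U j = c.val U j' := by
    intro U j j'
    refine eq_of_locally_eq F _ _ fun x hx => ?_
    obtain ⟨r, hr1, hr2⟩ := (hφ.exists_fib₁ (fibMap x j (fibPt hx)) (fibMap x j' (fibPt hx))).exists
    obtain ⟨V, hV, k, rfl⟩ := exists_section r
    have near : ∀ (i : openSp G U ⟶ φ.E₀) (f : φ.E₁ ⟶ φ.E₀),
        fibMap x f (fibMap x k (fibPt hV)) = fibMap x i (fibPt hx) →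
        ∃ (W : Opens G.Obj) (hW : W ≤ U) (hW' : W ≤ V), x ∈ W ∧
          (incl hW).hom ≫ i = (incl hW').hom ≫ k ≫ f := by
      intro i f e
      have h4 : fibMap x (incl (inf_le_left : U ⊓ V ≤ U)).hom (fibPt ⟨hx, hV⟩) = fibPt hx :=
        fibMap_incl _ _
      have h5 : fibMap x (incl (inf_le_right : U ⊓ V ≤ V)).hom (fibPt ⟨hx, hV⟩) = fibPt hV :=
        fibMap_incl _ _
      obtain ⟨W, hW, hxW, e'⟩ := exists_incl_comp_eq
        ((incl (inf_le_left : U ⊓ V ≤ U)).hom ≫ i) ((incl (inf_le_right : U ⊓ V ≤ V)).hom ≫ k ≫ f)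
        (x := x) ⟨hx, hV⟩ (by rw [fibMap_comp, fibMap_comp, fibMap_comp, h4, h5, e])
      refine ⟨W, hW.trans inf_le_left, hW.trans inf_le_right, hxW, ?_⟩
      rw [← incl_comp hW inf_le_left, ← incl_comp hW inf_le_right]
      exact (Category.assoc _ _ _).trans (e'.trans (Category.assoc _ _ _).symm)
    obtain ⟨W₁, h1, h1', hx1, e1⟩ := near j φ.face₁₁ hr1
    obtain ⟨W₂, h2, h2', hx2, e2⟩ := near j' φ.face₁₀ hr2
    refine ⟨W₁ ⊓ W₂, inf_le_left.trans h1, ⟨hx1, hx2⟩, ?_⟩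
    rw [← c.val_comp, ← c.val_comp]
    have e3 : (incl (inf_le_left.trans h1 : W₁ ⊓ W₂ ≤ U)).hom ≫ j =
        (incl (inf_le_left.trans h1' : W₁ ⊓ W₂ ≤ V)).hom ≫ k ≫ φ.face₁₁ := by
      rw [← incl_comp inf_le_left h1, ← incl_comp inf_le_left h1']
      exact (Category.assoc _ _ _).trans
        ((congrArg ((incl inf_le_left).hom ≫ ·) e1).trans (Category.assoc _ _ _).symm)
    have e4 : (incl (inf_le_left.trans h1 : W₁ ⊓ W₂ ≤ U)).hom ≫ j' =
        (incl (inf_le_left.trans h1' : W₁ ⊓ W₂ ≤ V)).hom ≫ k ≫ φ.face₁₀ := by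
      change (incl (inf_le_right.trans h2 : W₁ ⊓ W₂ ≤ U)).hom ≫ j' =
        (incl (inf_le_right.trans h2' : W₁ ⊓ W₂ ≤ V)).hom ≫ k ≫ φ.face₁₀
      rw [← incl_comp inf_le_right h2, ← incl_comp inf_le_right h2']
      exact (Category.assoc _ _ _).trans
        ((congrArg ((incl inf_le_right).hom ≫ ·) e2).trans (Category.assoc _ _ _).symm)
    rw [e3, e4, ← Category.assoc, ← Category.assoc]
    exact hc' _ _
  let p := fun x => (hφ.nonempty_fib x).some
  choose N hN s _ using fun x => exists_section (p x)
  have hcov : ∀ (V : Opens G.Obj) (x : G.Obj), x ∈ V → ∃ i : G.Obj, x ∈ N i :=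
    fun V x _ => ⟨x, hN x⟩
  obtain ⟨σ, hσ⟩ := exists_glue F N (fun i => (le_top : N i ≤ ⊤)) (hcov ⊤)
    (fun i => c.val (N i) (s i)) fun i j => by
      rw [← c.val_comp, ← c.val_comp]
      exact key _ _ _
  have hres : ∀ U (j : openSp G U ⟶ φ.E₀) (f : st U ⟶ st ⊤), F.obj.map f.op σ = c.val U j := by
    intro U j f
    refine eq_of_locally_eq F _ _ fun x hx => ?_
    obtain ⟨W, hWU, g, hxW, e⟩ := exists_incl_comp f _ (le_top : N _ ≤ ⊤) ⟨x, hx⟩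
      (hN (f.hom.map ⟨x, hx⟩).1)
    refine ⟨W, hWU, hxW, ?_⟩
    have h1 : F.obj.map (incl hWU).op (F.obj.map f.op σ) =
        F.obj.map g.op (F.obj.map (incl le_top).op σ) := by
      rw [← ConcreteCategory.comp_apply, ← ConcreteCategory.comp_apply, ← F.obj.map_comp,
        ← F.obj.map_comp, ← op_comp, ← op_comp, e]
    rw [h1, hσ, ← c.val_comp, ← c.val_comp]
    exact key _ _ _
  have hinv : σ ∈ invSections G F := by
    intro U f
    refine eq_of_locally_eq F _ _ fun x hx => ⟨U ⊓ N x, inf_le_left, ⟨hx, hN x⟩, ?_⟩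
    rw [← ConcreteCategory.comp_apply, ← ConcreteCategory.comp_apply, ← F.obj.map_comp,
        ← F.obj.map_comp, ← op_comp, ← op_comp]
    exact (hres _ ((incl inf_le_right).hom ≫ s x) _).trans (hres _ _ _).symm
  exact ⟨⟨σ, hinv⟩, Sec.ext fun U j => hres U j _⟩

end Exactness

end EtaleFunctor

/-! ### The classes of gerbes and line bundles with connection -/

section Classes

variable {K G : EtaleGroupoid.{u}} {φ : EtaleFunctor K G}

/-- The invariant section underlying a cocycle. -/
noncomputable abbrev cocycleInv {T : CochainComplex (GSheaf G) ℕ} {n : ℕ}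
    (z : (ΓinvComplex G T).cycles n) : invSections G (T.X n) :=
  ((ΓinvComplex G T).iCycles n).hom z

lemma Sec.map_d_map_d (T : CochainComplex (GSheaf G) ℕ) (i j k : ℕ) {E : EtSp G}
    (c : Sec E (T.X i)) : Sec.map (T.d j k) (Sec.map (T.d i j) c) = 0 := by
  rw [Sec.map_map, T.d_comp_d]; rfl

lemma Sec.map_f_map_d {F T : CochainComplex (GSheaf G) ℕ} (f : F ⟶ T) (i j : ℕ) {E : EtSp G}
    (c : Sec E (F.X i)) :
    Sec.map (T.d i j) (Sec.map (f.f i) c) = Sec.map (f.f j) (Sec.map (F.d i j) c) := by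
  rw [Sec.map_map, Sec.map_map, f.comm]

lemma Γinv_d_eq_zero {T : CochainComplex (GSheaf G) ℕ} {n : ℕ} {E : EtSp G}
    (hE : Function.Injective (Sec.ofInv (F := T.X (n + 1)) E)) (σ : invSections G (T.X n))
    (h : Sec.map (T.d n (n + 1)) (Sec.ofInv E σ) = 0) :
    ((ΓinvComplex G T).d n (n + 1)).hom σ = 0 :=
  hE ((Sec.map_ofInv (T.d n (n + 1)) σ).symm.trans (h.trans (map_zero _).symm))

/-- Two cocycles of invariant sections are cohomologous if their difference over `E` is the
differential of an invariant section, and invariant sections can be compared over `E`. -/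
lemma homologyπ_eq_homologyπ {T : CochainComplex (GSheaf G) ℕ} {n : ℕ} {E : EtSp G}
    (hE : Function.Injective (Sec.ofInv (F := T.X (n + 1)) E))
    (t t' : (ΓinvComplex G T).cycles (n + 1)) (e : invSections G (T.X n))
    (h : Sec.map (T.d n (n + 1)) (Sec.ofInv E e) =
      Sec.ofInv E (cocycleInv t) - Sec.ofInv E (cocycleInv t')) :
    ((ΓinvComplex G T).homologyπ (n + 1)).hom t = ((ΓinvComplex G T).homologyπ (n + 1)).hom t' := by
  rw [← sub_eq_zero, ← map_sub, homologyπ_eq_zero_iff]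
  refine ⟨e, hE ?_⟩
  refine (Sec.map_ofInv (T.d n (n + 1)) e).symm.trans (h.trans ?_)
  rw [← map_sub]
  exact congrArg _ (map_sub ((ΓinvComplex G T).iCycles (n + 1)).hom t t').symm

lemma Cx_d (G : EtaleGroupoid.{u}) (p n : ℕ) :
    (Cx G p).d n (n + 1) = truncD (cxX G) (cxD G) p n :=
  truncComplex_d _ _ (cxD_comp G) p n

lemma map_Cx_three_d_zero {E : EtSp G} (h : smoothUnits E) :
    Sec.map (F := (Cx G 3).X 0) (F' := (Cx G 3).X 1) ((Cx G 3).d 0 1) (Sec.ofUnits h) =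
      Sec.ofForm (dlog h) := by
  rw [Cx_d G 3 0]
  exact Sec.map_dlogSheaf h

lemma map_Cx_three_d_one {E : EtSp G} (α : Form 1 E) :
    Sec.map (F := (Cx G 3).X 1) (F' := (Cx G 3).X 2) ((Cx G 3).d 1 2) (Sec.ofForm α) =
      Sec.ofForm (Form.d α) := by
  rw [Cx_d G 3 1]
  exact Sec.map_dSheaf α

lemma map_Cx_two_d_zero {E : EtSp G} (h : smoothUnits E) :
    Sec.map (F := (Cx G 2).X 0) (F' := (Cx G 2).X 1) ((Cx G 2).d 0 1) (Sec.ofUnits h) =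
      Sec.ofForm (dlog h) := by
  rw [Cx_d G 2 0]
  exact Sec.map_dlogSheaf h

variable (φ)

lemma EtaleFunctor.δ₀_ofForm {p : ℕ} (α : Form p φ.E₀) : φ.δ₀ (Sec.ofForm α) =
    Sec.ofForm (Form.pull (EtSp.smap φ.face₁₁) α - Form.pull (EtSp.smap φ.face₁₀) α) := by
  rw [φ.δ₀_apply, Sec.pull_ofForm, Sec.pull_ofForm, map_sub]

lemma EtaleFunctor.δ₁_ofForm {p : ℕ} (α : Form p φ.E₁) : φ.δ₁ (Sec.ofForm α) =
    Sec.ofForm (Form.pull (EtSp.smap φ.face₂₀) α - Form.pull (EtSp.smap φ.face₂₁) α +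
      Form.pull (EtSp.smap φ.face₂₂) α) := by
  rw [φ.δ₁_apply, Sec.pull_ofForm, Sec.pull_ofForm, Sec.pull_ofForm, map_add, map_sub]

namespace GerbeConn

variable (𝒢 : GerbeConn K)

/-- The section of `ℂ^×` over `K₂` given by `h`. -/
noncomputable abbrev secH : Sec φ.E₂ ((Cx G 3).X 0) := Sec.ofUnits (E := φ.E₂) 𝒢.h

/-- The section of `𝒜¹` over `K₁` given by `A`. -/
noncomputable abbrev secA : Sec φ.E₁ ((Cx G 3).X 1) := Sec.ofForm (E := φ.E₁) (p := 1) 𝒢.A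

/-- The section of `𝒜²` over `K₀` given by `B`. -/
noncomputable abbrev secB : Sec φ.E₀ ((Cx G 3).X 2) := Sec.ofForm (E := φ.E₀) (p := 2) 𝒢.B

lemma δ₂_secH : φ.δ₂ (𝒢.secH φ) = 0 := by
  have h : smoothUnits.pull (EtSp.smap φ.face₃₀) 𝒢.h - smoothUnits.pull (EtSp.smap φ.face₃₁) 𝒢.h +
      smoothUnits.pull (EtSp.smap φ.face₃₂) 𝒢.h - smoothUnits.pull (EtSp.smap φ.face₃₃) 𝒢.h = 0 :=
    Subtype.ext (funext fun p => 𝒢.δh p.1.1.1.1 p.1.1.1.2 p.1.2 p.1.1.2 p.2)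
  exact congrArg (Sec.ofUnits (E := φ.E₃)) h

lemma δ₁_secA : φ.δ₁ (𝒢.secA φ) = Sec.map ((Cx G 3).d 0 1) (𝒢.secH φ) := by
  exact (φ.δ₁_ofForm (p := 1) 𝒢.A).trans ((congrArg (Sec.ofForm (E := φ.E₂) (p := 1)) 𝒢.δA).trans
    (map_Cx_three_d_zero (E := φ.E₂) 𝒢.h).symm)

lemma δ₀_secB : φ.δ₀ (𝒢.secB φ) = Sec.map ((Cx G 3).d 1 2) (𝒢.secA φ) := by
  exact (φ.δ₀_ofForm (p := 2) 𝒢.B).trans ((congrArg (Sec.ofForm (E := φ.E₁) (p := 2)) 𝒢.δB).trans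
    (map_Cx_three_d_one (E := φ.E₁) 𝒢.A).symm)

lemma represents_iff (x : HH 2 (Cx G 3)) : 𝒢.Represents φ x ↔
    ∃ (t : (ΓinvComplex G (injRes (Cx G 3))).cycles 2)
      (c₁ : Sec φ.E₁ ((injRes (Cx G 3)).X 0)) (c₀ : Sec φ.E₀ ((injRes (Cx G 3)).X 1)),
      ((ΓinvComplex G (injRes (Cx G 3))).homologyπ 2).hom t = x ∧
      Sec.map ((injResι (Cx G 3)).f 0) (𝒢.secH φ) = φ.δ₁ c₁ ∧
      Sec.map ((injResι (Cx G 3)).f 1) (𝒢.secA φ) =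
        Sec.map ((injRes (Cx G 3)).d 0 1) c₁ + φ.δ₀ c₀ ∧
      Sec.map ((injResι (Cx G 3)).f 2) (𝒢.secB φ) =
        Sec.ofInv _ (cocycleInv t) + Sec.map ((injRes (Cx G 3)).d 1 2) c₀ := by
  refine exists_congr fun t => exists_congr fun c₁ => exists_congr fun c₀ =>
    and_congr Iff.rfl (and_congr ?_ (and_congr ?_ ?_))
  · refine Iff.trans ?_ (Sec.ext_iff).symm
    refine forall_congr' fun U => forall_congr' fun j => ?_
    rw [φ.δ₁_apply, Sec.add_val, Sec.sub_val]
    exact Iff.rfl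
  · refine Iff.trans ?_ (Sec.ext_iff).symm
    refine forall_congr' fun U => forall_congr' fun j => ?_
    rw [φ.δ₀_apply, Sec.add_val, Sec.sub_val]
    exact Iff.rfl
  · refine Iff.trans ?_ (Sec.ext_iff).symm
    exact Iff.rfl

/-- A gerbe with connection on `K` has exactly one class, for a Morita morphism `K → G`. -/
lemma existsUnique_represents (hφ : φ.IsMorita) : ∃! x, 𝒢.Represents φ x := by
  have hI := injective_injRes (Cx G 3)
  set T := injRes (Cx G 3) with hT
  set ι := injResι (Cx G 3) with hι
  obtain ⟨c₁, hc₁⟩ := EtaleFunctor.exists_δ₁_eq hφ (hI 0) (Sec.map (ι.f 0) (𝒢.secH φ)) (by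
    rw [← φ.map_δ₂, δ₂_secH, map_zero])
  obtain ⟨c₀, hc₀⟩ := EtaleFunctor.exists_δ₀_eq hφ (hI 1)
    (Sec.map (ι.f 1) (𝒢.secA φ) - Sec.map (T.d 0 1) c₁) (by
      rw [map_sub, ← φ.map_δ₁, ← φ.map_δ₁, δ₁_secA, hc₁, Sec.map_f_map_d, sub_self])
  obtain ⟨σ, hσ⟩ := EtaleFunctor.exists_ofInv_eq hφ
    (Sec.map (ι.f 2) (𝒢.secB φ) - Sec.map (T.d 1 2) c₀) (by
      rw [map_sub, ← φ.map_δ₀, ← φ.map_δ₀, δ₀_secB, hc₀, map_sub, Sec.map_f_map_d,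
        Sec.map_d_map_d, sub_zero, sub_self])
  have hdσ : ((ΓinvComplex G T).d 2 3).hom σ = 0 := by
    refine Γinv_d_eq_zero (EtaleFunctor.ofInv_injective hφ _) σ ?_
    rw [hσ, map_sub, Sec.map_f_map_d, Sec.map_d_map_d, sub_zero, Cx_d G 3 2]
    exact map_zero (Sec.map (ι.f 3))
  obtain ⟨t, ht⟩ := exists_cycle (ΓinvComplex G T) σ hdσ
  replace hσ := (congrArg (Sec.ofInv φ.E₀) ht).trans hσ
  refine ⟨_, (represents_iff φ 𝒢 _).2 ⟨t, c₁, c₀, rfl, hc₁.symm, ?_, ?_⟩, ?_⟩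
  · rw [hc₀]; abel
  · refine Eq.trans ?_ (congrArg (· + _) hσ.symm); abel
  · intro y hy
    obtain ⟨t', c₁', c₀', rfl, h1, h2, h3⟩ := (represents_iff φ 𝒢 y).1 hy
    rw [← hι] at h1 h2 h3
    obtain ⟨b, hb⟩ := EtaleFunctor.exists_δ₀_eq hφ (hI 0) (c₁' - c₁) (by
      rw [map_sub, ← h1, hc₁, sub_self])
    obtain ⟨e, he⟩ := EtaleFunctor.exists_ofInv_eq hφ (c₀' - c₀ + Sec.map (T.d 0 1) b) (by
      rw [map_add, ← φ.map_δ₀, hb, map_sub, hc₀, h2, map_sub]; abel)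
    have h4 : Sec.map (T.d 1 2) (Sec.ofInv φ.E₀ e) =
        Sec.map (T.d 1 2) c₀' - Sec.map (T.d 1 2) c₀ := by
      rw [he, map_add, Sec.map_d_map_d, add_zero, map_sub]
    refine homologyπ_eq_homologyπ (EtaleFunctor.ofInv_injective hφ _) _ _ (-e) ?_
    rw [map_neg, map_neg, h4]
    rw [h3] at hσ
    refine Eq.trans ?_ (congrArg (_ - ·) hσ.symm)
    abel

end GerbeConn

namespace LineBundleConn

variable (L : LineBundleConn K)

/-- The section of `ℂ^×` over `K₁` given by `ρ`. -/
noncomputable abbrev secρ : Sec φ.E₁ ((Cx G 2).X 0) := Sec.ofUnits (E := φ.E₁) L.ρ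

/-- The section of `𝒜¹` over `K₀` given by `∇`. -/
noncomputable abbrev secConn : Sec φ.E₀ ((Cx G 2).X 1) := Sec.ofForm (E := φ.E₀) (p := 1) L.conn

lemma δ₁_secρ : φ.δ₁ (L.secρ φ) = 0 := by
  have h : smoothUnits.pull (EtSp.smap φ.face₂₀) L.ρ - smoothUnits.pull (EtSp.smap φ.face₂₁) L.ρ +
      smoothUnits.pull (EtSp.smap φ.face₂₂) L.ρ = 0 := by
    refine Subtype.ext (funext fun p => ?_)
    change L.ρ.1 p.1.2 - L.ρ.1 (K.mul p.1.1 p.1.2 p.2) + L.ρ.1 p.1.1 = 0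
    rw [L.ρ_mul]
    abel
  exact congrArg (Sec.ofUnits (E := φ.E₂)) h

lemma δ₀_secConn : φ.δ₀ (L.secConn φ) = Sec.map ((Cx G 2).d 0 1) (L.secρ φ) := by
  exact (φ.δ₀_ofForm (p := 1) L.conn).trans
    ((congrArg (Sec.ofForm (E := φ.E₁) (p := 1)) L.δconn).trans
      (map_Cx_two_d_zero (E := φ.E₁) L.ρ).symm)

lemma represents_iff (x : HH 1 (Cx G 2)) : L.Represents φ x ↔
    ∃ (t : (ΓinvComplex G (injRes (Cx G 2))).cycles 1)
      (c₀ : Sec φ.E₀ ((injRes (Cx G 2)).X 0)),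
      ((ΓinvComplex G (injRes (Cx G 2))).homologyπ 1).hom t = x ∧
      Sec.map ((injResι (Cx G 2)).f 0) (L.secρ φ) = φ.δ₀ c₀ ∧
      Sec.map ((injResι (Cx G 2)).f 1) (L.secConn φ) =
        Sec.ofInv _ (cocycleInv t) + Sec.map ((injRes (Cx G 2)).d 0 1) c₀ := by
  refine exists_congr fun t => exists_congr fun c₀ => and_congr Iff.rfl (and_congr ?_ ?_)
  · refine Iff.trans ?_ (Sec.ext_iff).symm
    refine forall_congr' fun U => forall_congr' fun j => ?_
    rw [φ.δ₀_apply, Sec.sub_val]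
    exact Iff.rfl
  · refine Iff.trans ?_ (Sec.ext_iff).symm
    exact Iff.rfl

/-- A line bundle with connection on `K` has exactly one class, for a Morita morphism `K → G`. -/
lemma existsUnique_represents (hφ : φ.IsMorita) : ∃! x, L.Represents φ x := by
  have hI := injective_injRes (Cx G 2)
  set T := injRes (Cx G 2) with hT
  set ι := injResι (Cx G 2) with hι
  obtain ⟨c₀, hc₀⟩ := EtaleFunctor.exists_δ₀_eq hφ (hI 0) (Sec.map (ι.f 0) (L.secρ φ)) (by
    rw [← φ.map_δ₁, δ₁_secρ, map_zero])
  obtain ⟨σ, hσ⟩ := EtaleFunctor.exists_ofInv_eq hφ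
    (Sec.map (ι.f 1) (L.secConn φ) - Sec.map (T.d 0 1) c₀) (by
      rw [map_sub, ← φ.map_δ₀, ← φ.map_δ₀, δ₀_secConn, hc₀, Sec.map_f_map_d, sub_self])
  have hdσ : ((ΓinvComplex G T).d 1 2).hom σ = 0 := by
    refine Γinv_d_eq_zero (EtaleFunctor.ofInv_injective hφ _) σ ?_
    rw [hσ, map_sub, Sec.map_f_map_d, Sec.map_d_map_d, sub_zero, Cx_d G 2 1]
    exact map_zero (Sec.map (ι.f 2))
  obtain ⟨t, ht⟩ := exists_cycle (ΓinvComplex G T) σ hdσ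
  replace hσ := (congrArg (Sec.ofInv φ.E₀) ht).trans hσ
  refine ⟨_, (represents_iff φ L _).2 ⟨t, c₀, rfl, hc₀.symm, ?_⟩, ?_⟩
  · refine Eq.trans ?_ (congrArg (· + _) hσ.symm); abel
  · intro y hy
    obtain ⟨t', c₀', rfl, h1, h2⟩ := (represents_iff φ L y).1 hy
    rw [← hι] at h1 h2
    obtain ⟨e, he⟩ := EtaleFunctor.exists_ofInv_eq hφ (c₀' - c₀) (by
      rw [map_sub, hc₀, h1, sub_self])
    refine homologyπ_eq_homologyπ (EtaleFunctor.ofInv_injective hφ _) _ _ (-e) ?_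
    rw [map_neg, map_neg, he, map_sub]
    rw [h2] at hσ
    refine Eq.trans ?_ (congrArg (_ - ·) hσ.symm)
    abel

end LineBundleConn

end Classes

/-! ### Push-forward from the inertia groupoid -/

section InjectiveSheaves

variable {G : EtaleGroupoid.{u}}

/-- A compatible family of homomorphisms on the sections over the neighbourhoods of `x` induces a
homomorphism on the stalk. -/
lemma exists_stalk_hom (x : G.Obj) (X : (Site G)ᵒᵖ ⥤ AddCommGrpCat.{u}) (D : AddCommGrpCat.{u})
    (v : ∀ (U : Site G) (_ : fib x (openSp G U)), X.obj (op U) →+ D)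
    (hv : ∀ (U V : Site G) (g : U ⟶ V) (p : fib x (openSp G U)) (s : X.obj (op V)),
      v U p (X.map g.op s) = v V (fibMap x g.hom p) s) :
    ∃ φ : (fibPoint x).presheafFiber.obj X ⟶ D, ∀ (U : Site G) (p : fib x (openSp G U))
      (s : X.obj (op U)), φ.hom (((fibPoint x).toPresheafFiber U p X).hom s) = v U p s := by
  let w : ∀ (U : Site G) (_ : (fibPoint x).fiber.obj U), X.obj (op U) ⟶ D :=
    fun U p => AddCommGrpCat.ofHom (v U p)
  have hw : ∀ ⦃U V : Site G⦄ (g : U ⟶ V) (p : (fibPoint x).fiber.obj U),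
      X.map g.op ≫ w U p = w V ((fibPoint x).fiber.map g p) := fun U V g p =>
    AddCommGrpCat.hom_ext (AddMonoidHom.ext fun s => hv U V g p s)
  exact ⟨(fibPoint x).presheafFiberDesc w hw, fun U p s => congrArg (fun k => k.hom s)
    ((fibPoint x).toPresheafFiber_presheafFiberDesc w hw U p)⟩

/-- A sheaf whose sections over `U` are all the functions on some fibres of `U`, with values in
injective groups, is injective. -/
lemma injective_of_fib (P : GSheaf G) {I : Type u} (pt : I → G.Obj) (D : I → AddCommGrpCat.{u})
    (hD : ∀ i, Injective (D i))
    (e : ∀ U : (Site G)ᵒᵖ, P.obj.obj U →+ ∀ i, fib (pt i) (openSp G U.unop) → D i)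
    (he : ∀ U, Function.Bijective (e U))
    (hn : ∀ (U V : (Site G)ᵒᵖ) (f : U ⟶ V) (s : P.obj.obj U) (i : I)
      (p : fib (pt i) (openSp G V.unop)),
      e V (P.obj.map f s) i p = e U s i (fibMap _ f.unop.hom p)) : Injective P := by
  refine ⟨fun {X Y} f j hj => ?_⟩
  have hmono : ∀ i, Mono ((fibPoint (pt i)).presheafFiber.map j.hom) := fun i => by
    have : Presheaf.IsLocallyInjective (siteTopology G) j.hom :=
      (Sheaf.isLocallyInjective_iff_injective j).2 fun U =>
        (AddCommGrpCat.mono_iff_injective _).1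
          (inferInstanceAs (Mono (((sheafToPresheaf _ _).map j).app U)))
    exact (AddCommGrpCat.mono_iff_injective _).2 ((fibPoint (pt i)).toPresheafFiber_map_injective _)
  -- `f` is given by homomorphisms on stalks, which are extended one by one
  choose φ hφ using fun i => exists_stalk_hom (pt i) X.obj (D i)
    (fun U p => AddMonoidHom.mk' (fun s => e (op U) ((f.hom.app (op U)).hom s) i p)
      fun s t => by rw [map_add, map_add]; rfl) (fun U V g p s => by
        have := congrArg (fun k => k.hom s) (f.hom.naturality g.op)
        exact (congrArg (fun s => e (op U) s i p) this).trans (hn (op V) (op U) g.op _ i p))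
  let ψ : ∀ i, (fibPoint (pt i)).presheafFiber.obj Y.obj ⟶ D i := fun i =>
    Injective.factorThru (φ i) ((fibPoint (pt i)).presheafFiber.map j.hom)
  have hψ : ∀ i, (fibPoint (pt i)).presheafFiber.map j.hom ≫ ψ i = φ i := fun i =>
    Injective.comp_factorThru _ _
  let germ : ∀ i (U : (Site G)ᵒᵖ) (p : fib (pt i) (openSp G U.unop)), Y.obj.obj U →+ D i :=
    fun i U p => ((fibPoint (pt i)).toPresheafFiber U.unop p Y.obj ≫ ψ i).hom
  have hgerm : ∀ i (U V : (Site G)ᵒᵖ) (g : U ⟶ V) (p : fib (pt i) (openSp G V.unop))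
      (s : Y.obj.obj U), germ i V p (Y.obj.map g s) = germ i U (fibMap _ g.unop.hom p) s :=
    fun i U V g p s => congrArg (fun k : Y.obj.obj U ⟶ (fibPoint (pt i)).presheafFiber.obj Y.obj =>
      (k ≫ ψ i).hom s) ((fibPoint (pt i)).toPresheafFiber_w g.unop p Y.obj)
  have hgf : ∀ i (U : (Site G)ᵒᵖ) (p : fib (pt i) (openSp G U.unop)) (s : X.obj.obj U),
      germ i U p ((j.hom.app U).hom s) = e U ((f.hom.app U).hom s) i p := by
    intro i U p s
    have h1 := congrArg (fun k : X.obj.obj U ⟶ (fibPoint (pt i)).presheafFiber.obj Y.obj =>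
      (k ≫ ψ i).hom s) ((fibPoint (pt i)).toPresheafFiber_naturality j.hom U.unop p)
    have h2 := congrArg (fun k => ((fibPoint (pt i)).toPresheafFiber U.unop p X.obj ≫ k).hom s)
      (hψ i)
    exact h1.symm.trans (h2.trans (hφ i U.unop p s))
  choose r hr using fun U => (he U).2
  let g : Y ⟶ P :=
    { hom :=
      { app := fun U => AddCommGrpCat.ofHom (AddMonoidHom.mk'
          (fun s => r U fun i p => germ i U p s) fun s t => (he U).1 (by
            rw [map_add, hr, hr, hr]
            exact funext fun i => funext fun p => map_add (germ i U p) s t))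
        naturality := fun U V k => by
          refine AddCommGrpCat.hom_ext (AddMonoidHom.ext fun s => (he V).1 ?_)
          change e V (r V _) = e V (P.obj.map k (r U fun i p => germ i U p s))
          rw [hr]
          refine funext fun i => funext fun p => ?_
          rw [hn, hr]
          exact hgerm i U V k p s } }
  refine ⟨g, ?_⟩
  refine Sheaf.hom_ext (NatTrans.ext (funext fun U => AddCommGrpCat.hom_ext
    (AddMonoidHom.ext fun s => (he U).1 ?_)))
  change e U (r U fun i p => germ i U p ((j.hom.app U).hom s)) = e U ((f.hom.app U).hom s)
  rw [hr]
  exact funext fun i => funext fun p => hgf i U p s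

end InjectiveSheaves

section InertiaSite

variable {G : EtaleGroupoid.{u}}

/-- The object at which a loop is based. -/
def loopPt (a : (inertia G).Obj) : G.Obj := G.src (show G.Loop from a).1

/-- The arrow of `G` underlying an arrow of `∧G`. -/
def under (p : (inertia G).Arr) : G.Arr := LoopArr.snd (show G.LoopArr from p)

lemma continuous_loopPt : Continuous (loopPt (G := G)) :=
  G.etale_src.isLocalHomeomorph.continuous.comp continuous_subtype_val

lemma continuous_under : Continuous (under (G := G)) := LoopArr.continuous_snd

lemma src_under (p : (inertia G).Arr) : G.src (under p) = loopPt ((inertia G).src p) :=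
  (show G.LoopArr from p).eq.symm.trans (show G.LoopArr from p).fst.2.symm

lemma tgt_under (p : (inertia G).Arr) : G.tgt (under p) = loopPt ((inertia G).tgt p) :=
  (show G.LoopArr from p).src_conj.symm

lemma under_one (a : (inertia G).Obj) : under ((inertia G).one a) = G.one (loopPt a) :=
  congrArg G.one (show G.Loop from a).2.symm

lemma under_mul (p q : (inertia G).Arr) (h) : under ((inertia G).mul p q h) =
    G.mul (under p) (under q) ((tgt_under p).trans ((congrArg loopPt h).trans (src_under q).symm)) :=
  rfl

/-- An arrow of `∧G` is determined by its target and the underlying arrow of `G`. -/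
lemma inertia_arr_ext {p q : (inertia G).Arr} (h : (inertia G).tgt p = (inertia G).tgt q)
    (h' : under p = under q) : p = q := by
  have h1 : (inertia G).inv p = (inertia G).inv q :=
    LoopArr.ext (congrArg Subtype.val h) (congrArg G.inv h')
  rw [← LoopArr.inv_inv p, ← LoopArr.inv_inv q]
  exact congrArg LoopArr.inv h1

/-- The arrow of `∧G` with target `a` and underlying arrow `g`. -/
def arrTo (a : (inertia G).Obj) (g : G.Arr) (h : G.tgt g = loopPt a) : (inertia G).Arr :=
  (inertia G).inv (LoopArr.mk (show G.Loop from a) (G.inv g)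
    ((show G.Loop from a).2.symm.trans (h.symm.trans (G.src_inv g).symm)))

lemma tgt_arrTo (a : (inertia G).Obj) (g : G.Arr) (h : G.tgt g = loopPt a) :
    (inertia G).tgt (arrTo a g h) = a := (inertia G).tgt_inv _

lemma inv_inv' (g : G.Arr) : G.inv (G.inv g) = g := by
  refine mul_left_cancel (a := G.inv g) (p := (G.src_inv _).symm) (q := G.tgt_inv _) ?_
  rw [G.mul_inv, G.inv_mul, G.src_inv]

lemma under_arrTo (a : (inertia G).Obj) (g : G.Arr) (h : G.tgt g = loopPt a) :
    under (arrTo a g h) = g := inv_inv' g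

lemma loopPt_src_arrTo (a : (inertia G).Obj) (g : G.Arr) (h : G.tgt g = loopPt a) :
    loopPt ((inertia G).src (arrTo a g h)) = G.src g := by
  rw [← src_under, under_arrTo]

lemma continuous_arrTo {X : Type u} [TopologicalSpace X] {a : X → (inertia G).Obj} {g : X → G.Arr}
    (ha : Continuous a) (hg : Continuous g) (h : ∀ x, G.tgt (g x) = loopPt (a x)) :
    Continuous fun x => arrTo (a x) (g x) (h x) :=
  (inertia G).continuous_inv.comp (LoopArr.continuous_mk (f := a) ha (G.continuous_inv.comp hg) _)

lemma under_comp_arr {E E' E'' : EtSp (inertia G)} (f : E ⟶ E') (g : E' ⟶ E'') (e : E) :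
    under ((f ≫ g).arr e) = G.mul (under (g.arr (f.map e))) (under (f.arr e))
      ((tgt_under _).trans ((congrArg loopPt ((g.tgt_arr _).trans (f.src_arr e).symm)).trans
        (src_under _).symm)) := rfl

/-- The loops based at points of `U`. -/
def loopsOver (U : Opens G.Obj) : Opens (inertia G).Obj :=
  ⟨loopPt ⁻¹' U, U.isOpen.preimage continuous_loopPt⟩

lemma loopsOver_mono {U V : Opens G.Obj} (h : U ≤ V) : loopsOver U ≤ loopsOver V :=
  fun _ ha => h ha

/-- Two morphisms to a space étale over `∧G` are equal if the underlying maps and the underlying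
arrows of `G` are equal. -/
lemma inertia_hom_ext {E E' : EtSp (inertia G)} {f g : E ⟶ E'} (h : f.map = g.map)
    (h' : ∀ e, under (f.arr e) = under (g.arr e)) : f = g :=
  EtSp.hom_ext h (funext fun e => inertia_arr_ext ((f.tgt_arr e).trans (g.tgt_arr e).symm) (h' e))

lemma inertia_openSp_hom_ext {E : EtSp (inertia G)} {U : Opens (inertia G).Obj}
    {f g : E ⟶ openSp (inertia G) U} (h' : ∀ e, under (f.arr e) = under (g.arr e)) : f = g :=
  inertia_hom_ext (funext fun e => Subtype.ext ((f.src_arr e).symm.trans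
    ((congrArg (inertia G).src (inertia_arr_ext ((f.tgt_arr e).trans (g.tgt_arr e).symm) (h' e))).trans
      (g.src_arr e)))) h'

lemma tgt_arr_loopsOver {U V : Opens G.Obj} (f : openSp G U ⟶ openSp G V) (a : loopsOver U) :
    G.tgt (f.arr ⟨loopPt a.1, a.2⟩) = loopPt a.1 := f.tgt_arr _

/-- A family of arrows acts on loops by conjugation. -/
def loopsOverMap {U V : Opens G.Obj} (f : openSp G U ⟶ openSp G V) :
    openSp (inertia G) (loopsOver U) ⟶ openSp (inertia G) (loopsOver V) where
  map a := ⟨(inertia G).src (arrTo a.1 _ (tgt_arr_loopsOver f a)),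
    (congrArg (· ∈ V) ((loopPt_src_arrTo _ _ _).trans (f.src_arr ⟨loopPt a.1, a.2⟩))).mpr
      (f.map ⟨loopPt a.1, a.2⟩).2⟩
  arr a := arrTo a.1 _ (tgt_arr_loopsOver f a)
  continuous_map := ((inertia G).etale_src.isLocalHomeomorph.continuous.comp (continuous_arrTo
    continuous_subtype_val (f.continuous_arr.comp
      ((continuous_loopPt.comp continuous_subtype_val).subtype_mk _)) _)).subtype_mk _
  continuous_arr := continuous_arrTo continuous_subtype_val (f.continuous_arr.comp
      ((continuous_loopPt.comp continuous_subtype_val).subtype_mk _)) _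
  src_arr _ := rfl
  tgt_arr a := tgt_arrTo a.1 _ (tgt_arr_loopsOver f a)

lemma under_loopsOverMap {U V : Opens G.Obj} (f : openSp G U ⟶ openSp G V) (a : loopsOver U) :
    under ((loopsOverMap f).arr a) = f.arr ⟨loopPt a.1, a.2⟩ :=
  under_arrTo _ _ (tgt_arr_loopsOver f a)

lemma loopPt_loopsOverMap {U V : Opens G.Obj} (f : openSp G U ⟶ openSp G V) (a : loopsOver U) :
    loopPt ((loopsOverMap f).map a).1 = (f.map ⟨loopPt a.1, a.2⟩).1 :=
  (loopPt_src_arrTo _ _ (tgt_arr_loopsOver f a)).trans (f.src_arr _)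

/-- The functor from the site of `G` to the site of `∧G` induced by `∧G → G`. -/
def loopSite (G : EtaleGroupoid.{u}) : Site G ⥤ Site (inertia G) where
  obj U := st (loopsOver U)
  map f := InducedCategory.homMk (loopsOverMap f.hom)
  map_id U := InducedCategory.hom_ext (inertia_openSp_hom_ext fun a =>
    (under_loopsOverMap _ _).trans (under_one _).symm)
  map_comp f g := InducedCategory.hom_ext (inertia_openSp_hom_ext fun a => by
    refine (under_loopsOverMap _ _).trans
      (Eq.trans ?_ (under_comp_arr (loopsOverMap f.hom) (loopsOverMap g.hom) a).symm)
    refine mul_congr (Eq.trans ?_ (under_loopsOverMap g.hom _).symm)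
      (under_loopsOverMap f.hom a).symm
    exact congrArg g.hom.arr (Subtype.ext (loopPt_loopsOverMap f.hom a).symm))

lemma loopSite_map_incl {U V : Opens G.Obj} (h : U ≤ V) :
    (loopSite G).map (incl h) = (incl (loopsOver_mono h) : st (loopsOver U) ⟶ st (loopsOver V)) :=
  InducedCategory.hom_ext (inertia_openSp_hom_ext fun _ =>
    (under_loopsOverMap _ _).trans (under_one _).symm)

lemma isSheaf_push (M : GSheaf (inertia G)) :
    Presheaf.IsSheaf (siteTopology G) ((loopSite G).op ⋙ M.obj) := by
  let P : (Site G)ᵒᵖ ⥤ AddCommGrpCat.{u} := (loopSite G).op ⋙ M.obj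
  have hm : ∀ {U V : Opens G.Obj} (h : U ≤ V) (s : M.obj.obj (op (st (loopsOver V)))),
      (P.map (incl h).op).hom s = M.obj.map (incl (loopsOver_mono h)).op s :=
    fun {U V} h s => congrArg (fun k : st (loopsOver U) ⟶ st (loopsOver V) => M.obj.map k.op s)
      (loopSite_map_incl h)
  refine isSheaf_of_local P (fun U (s : M.obj.obj (op (st (loopsOver U))))
    (t : M.obj.obj (op (st (loopsOver U)))) hst => ?_) (fun U W hW hxW
      (s : ∀ x, M.obj.obj (op (st (loopsOver (W x))))) hs => ?_)
  · refine eq_of_locally_eq M s t fun a ha => ?_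
    obtain ⟨W, hW, hxW, e⟩ := hst (loopPt a) ha
    exact ⟨loopsOver W, loopsOver_mono hW, hxW, (hm hW s).symm.trans (e.trans (hm hW t))⟩
  · obtain ⟨t, ht⟩ := exists_glue M (U := loopsOver U) (fun x => loopsOver (W x))
      (fun x => loopsOver_mono (hW x)) (fun a ha => ⟨⟨loopPt a, ha⟩, hxW ⟨loopPt a, ha⟩⟩) s
      fun x y => (hm _ _).symm.trans ((hs x y).trans (hm _ _))
    exact ⟨t, fun x => (hm _ _).trans (ht x)⟩

/-- The push-forward of sheaves from `∧G` to `G`. -/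
noncomputable def push (G : EtaleGroupoid.{u}) : GSheaf (inertia G) ⥤ GSheaf G where
  obj M := ⟨_, isSheaf_push M⟩
  map f := ⟨Functor.whiskerLeft (loopSite G).op f.hom⟩

instance : (push G).Additive where

/-- The push-forward along `∧G → G` preserves injective sheaves. -/
lemma injective_push (M : GSheaf (inertia G)) (hM : Injective M) : Injective ((push G).obj M) := by
  obtain ⟨D, hD, i, r, hir⟩ := exists_retract_skySheaf M hM
  have hP : Injective ((push G).obj (skySheaf D)) := by
    -- the fibre over `a` of the loops over `U` is the fibre of `U` over the base point of `a`
    let bij : ∀ (U : Opens G.Obj) (a : (inertia G).Obj),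
        fib (loopPt a) (openSp G U) → fib a (openSp (inertia G) (loopsOver U)) := fun U a p =>
      ⟨(⟨(inertia G).src (arrTo a p.1.2 p.2.2),
        (congrArg (· ∈ U) ((loopPt_src_arrTo a p.1.2 p.2.2).trans p.2.1)).mpr p.1.1.2⟩,
        arrTo a p.1.2 p.2.2), rfl, tgt_arrTo a p.1.2 p.2.2⟩
    let inv : ∀ (U : Opens G.Obj) (a : (inertia G).Obj),
        fib a (openSp (inertia G) (loopsOver U)) → fib (loopPt a) (openSp G U) := fun U a p =>
      ⟨(⟨loopPt p.1.1.1, p.1.1.2⟩, under p.1.2), (src_under _).trans (congrArg loopPt p.2.1),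
        (tgt_under _).trans (congrArg loopPt p.2.2)⟩
    have h1 : ∀ U a p, bij U a (inv U a p) = p := fun U a p => by
      have : arrTo a (under p.1.2) (inv U a p).2.2 = p.1.2 :=
        inertia_arr_ext ((tgt_arrTo _ _ _).trans p.2.2.symm) (under_arrTo _ _ _)
      refine fib_ext (Subtype.ext ?_) this
      exact (congrArg (inertia G).src this).trans p.2.1
    have h2 : ∀ U a p, inv U a (bij U a p) = p := fun U a p =>
      fib_ext (Subtype.ext ((loopPt_src_arrTo a p.1.2 p.2.2).trans p.2.1))
        (under_arrTo a p.1.2 p.2.2)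
    refine injective_of_fib _ (loopPt (G := G)) D hD (fun U => AddMonoidHom.mk'
      (fun (s : ∀ a, fib a (openSp (inertia G) (loopsOver U.unop)) → D a) a p => s a (bij _ a p))
      fun _ _ => rfl) (fun U => ⟨fun s t h => ?_, fun s => ?_⟩) (fun U V f s a p => ?_)
    · refine funext fun a => funext fun p => ?_
      have := congrFun (congrFun h a) (inv _ a p)
      change s a (bij _ a (inv _ a p)) = t a (bij _ a (inv _ a p)) at this
      exact (congrArg (s a) (h1 _ a p)).symm.trans (this.trans (congrArg (t a) (h1 _ a p)))
    · refine ⟨(fun a p => s a (inv _ a p) :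
        ∀ a, fib a (openSp (inertia G) (loopsOver U.unop)) → D a), ?_⟩
      exact funext fun a => funext fun p => congrArg (s a) (h2 _ a p)
    · change s a (fibMap a (loopsOverMap f.unop.hom) (bij _ a p)) = s a (bij _ a _)
      refine congrArg (s a) ?_
      have h3 : (inertia G).mul ((loopsOverMap f.unop.hom).arr (bij _ a p).1.1) (bij _ a p).1.2
          (((loopsOverMap f.unop.hom).tgt_arr _).trans (bij _ a p).2.1.symm) =
          arrTo a (fibMap _ f.unop.hom p).1.2 (fibMap _ f.unop.hom p).2.2 := by
        refine inertia_arr_ext (((inertia G).tgt_mul _ _ _).trans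
          ((tgt_arrTo a p.1.2 p.2.2).trans (tgt_arrTo _ _ _).symm)) ?_
        refine (under_mul _ _ _).trans (Eq.trans ?_ (under_arrTo _ _ _).symm)
        refine mul_congr ((under_loopsOverMap _ _).trans ?_) (under_arrTo a p.1.2 p.2.2)
        exact congrArg f.unop.hom.arr (Subtype.ext ((loopPt_src_arrTo a p.1.2 p.2.2).trans p.2.1))
      refine fib_ext (Subtype.ext ?_) h3
      refine Eq.trans ?_ (congrArg (inertia G).src h3)
      exact (((inertia G).src_mul _ _ _).trans ((loopsOverMap f.unop.hom).src_arr _)).symm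
  refine ⟨fun {X Y} f j hj => ⟨Injective.factorThru (f ≫ (push G).map i) j ≫ (push G).map r, ?_⟩⟩
  rw [← Category.assoc, Injective.comp_factorThru, Category.assoc, ← Functor.map_comp, hir]
  exact Category.comp_id _

end InertiaSite

/-! ### The twist, and the restriction of sections to loops -/

section Twist

variable {G : EtaleGroupoid.{u}}

/-- The arrow `(a, a)` from the loop `a` to itself. -/
def diag (a : (inertia G).Obj) : (inertia G).Arr :=
  LoopArr.mk a (show G.Loop from a).1 (show G.Loop from a).2.symm

lemma src_diag (a : (inertia G).Obj) : (inertia G).src (diag a) = a := rfl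

lemma tgt_diag (a : (inertia G).Obj) : (inertia G).tgt (diag a) = a :=
  LoopArr.conj_eq (p := LoopArr.mk a (show G.Loop from a).1 (show G.Loop from a).2.symm)
    (show G.Loop from a).2.symm rfl

lemma continuous_diag : Continuous (diag (G := G)) :=
  LoopArr.continuous_mk continuous_id continuous_subtype_val _

/-- The automorphism of a space `E` étale over `∧G` given by the identity of `E` and the arrows
`(a, a)`, which form a central section of the bundle of isotropy groups of `∧G`. -/
def twist (E : EtSp (inertia G)) : E ⟶ E where
  map e := e
  arr e := diag (E.proj e)
  continuous_map := continuous_id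
  continuous_arr := continuous_diag.comp E.etale.isLocalHomeomorph.continuous
  src_arr _ := rfl
  tgt_arr _ := tgt_diag _

lemma comp_twist {E E' : EtSp (inertia G)} (f : E ⟶ E') : f ≫ twist E' = twist E ≫ f := by
  refine inertia_hom_ext rfl fun e => ?_
  refine (under_comp_arr f (twist E') e).trans (Eq.trans ?_ (under_comp_arr (twist E) f e).symm)
  refine Eq.trans ?_ (((show G.LoopArr from f.arr e).mul_conj).symm.trans ?_)
  · exact mul_congr (congrArg (fun a : (inertia G).Obj => (show G.Loop from a).1)
      (f.src_arr e).symm) rfl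
  · exact mul_congr rfl (congrArg (fun a : (inertia G).Obj => (show G.Loop from a).1) (f.tgt_arr e))

/-- The canonical automorphism of the sheaves on `∧G`. -/
noncomputable def Θ (G : EtaleGroupoid.{u}) : 𝟭 (GSheaf (inertia G)) ⟶ 𝟭 (GSheaf (inertia G)) where
  app F :=
    { hom :=
      { app := fun U => F.obj.map
          (InducedCategory.homMk (twist (openSp _ U.unop)) : U.unop ⟶ U.unop).op
        naturality := fun U V f => by
          change F.obj.map f ≫ F.obj.map _ = F.obj.map _ ≫ F.obj.map f
          rw [← F.obj.map_comp, ← F.obj.map_comp]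
          exact congrArg (fun k => F.obj.map (Quiver.Hom.op k))
            (InducedCategory.hom_ext (comp_twist f.unop.hom).symm :
              (InducedCategory.homMk (twist (openSp _ V.unop)) : V.unop ⟶ V.unop) ≫ f.unop =
                f.unop ≫ InducedCategory.homMk (twist (openSp _ U.unop))) } }
  naturality F F' f := Sheaf.hom_ext (NatTrans.ext (funext fun _ => (f.hom.naturality _).symm))

lemma Sec.map_Θ {E : EtSp (inertia G)} {F : GSheaf (inertia G)} (c : Sec E F) :
    Sec.map ((Θ G).app F) c = Sec.pull (twist E) c := by
  refine Sec.ext fun U j => ?_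
  rw [Sec.pull_val, comp_twist]
  exact (c.val_comp _ _ (InducedCategory.homMk (twist (openSp _ U)) : st U ⟶ st U) j).symm

/-- Invariant sections do not change under the action of arrows, so `Θ` fixes them. -/
lemma Γinv_map_Θ (F : GSheaf (inertia G)) (σ : invSections (inertia G) F) :
    ((Γinv (inertia G)).map ((Θ G).app F)).hom σ = σ := by
  refine Subtype.ext ((σ.2 ⊤ (InducedCategory.homMk (twist (openSp _ ⊤)))).trans ?_)
  exact congrArg (fun k => k.hom σ.1) (F.obj.map_id (op (st ⊤)))

lemma Θ_formSheaf (p : ℕ) : (Θ G).app (formSheaf (inertia G) p) = 𝟙 _ :=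
  Sheaf.hom_ext (NatTrans.ext (funext fun U => (formFunctor (inertia G) p).map_id
    (op (openSp _ U.unop))))

lemma Θ_unitsSheaf : (Θ G).app (unitsSheaf (inertia G)) = 𝟙 _ := rfl

/-- The canonical automorphism of a complex of sheaves on `∧G`. -/
noncomputable def ΘC (M : CochainComplex (GSheaf (inertia G)) ℕ) : M ⟶ M where
  f n := (Θ G).app (M.X n)
  comm' i j _ := ((Θ G).naturality (M.d i j)).symm

lemma ΘC_naturality {M N : CochainComplex (GSheaf (inertia G)) ℕ} (f : M ⟶ N) :
    f ≫ ΘC N = ΘC M ≫ f :=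
  HomologicalComplex.hom_ext _ _ fun n => (Θ G).naturality (f.f n)

/-- The twist moves no points, hence acts trivially on functions and forms. -/
lemma ΘC_Cx_three : ΘC (Cx (inertia G) 3) = 𝟙 _ := by
  refine HomologicalComplex.hom_ext _ _ fun n => ?_
  match n with
  | 0 => exact Θ_unitsSheaf
  | 1 => exact Θ_formSheaf 1
  | 2 => exact Θ_formSheaf 2
  | _ + 3 => exact (isZero_zero (GSheaf (inertia G))).eq_of_src _ _

end Twist

section Restriction

variable {G : EtaleGroupoid.{u}}

/-- Two local sections with the same value at a point agree nearby. -/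
lemma exists_incl_comp_eq_incl_comp {U U' : Opens G.Obj} {E : EtSp G} (j : openSp G U ⟶ E)
    (j' : openSp G U' ⟶ E) {x : G.Obj} (hx : x ∈ U) (hx' : x ∈ U')
    (h : fibMap x j (fibPt hx) = fibMap x j' (fibPt hx')) :
    ∃ (W : Opens G.Obj) (hW : W ≤ U) (hW' : W ≤ U'), x ∈ W ∧
      (incl hW).hom ≫ j = (incl hW').hom ≫ j' := by
  have h4 : fibMap x (incl (inf_le_left : U ⊓ U' ≤ U)).hom (fibPt ⟨hx, hx'⟩) = fibPt hx :=
    fibMap_incl _ _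
  have h5 : fibMap x (incl (inf_le_right : U ⊓ U' ≤ U')).hom (fibPt ⟨hx, hx'⟩) = fibPt hx' :=
    fibMap_incl _ _
  obtain ⟨W, hW, hxW, e⟩ := exists_incl_comp_eq
    ((incl (inf_le_left : U ⊓ U' ≤ U)).hom ≫ j) ((incl (inf_le_right : U ⊓ U' ≤ U')).hom ≫ j')
    (x := x) ⟨hx, hx'⟩ (by rw [fibMap_comp, fibMap_comp, h4, h5, h])
  refine ⟨W, hW.trans inf_le_left, hW.trans inf_le_right, hxW, ?_⟩
  rw [← incl_comp hW inf_le_left, ← incl_comp hW inf_le_right]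
  exact (Category.assoc _ _ _).trans (e.trans (Category.assoc _ _ _).symm)

lemma map_incl_incl (F : GSheaf G) {U V W : Opens G.Obj} (h : U ≤ V) (h' : V ≤ W)
    (s : F.obj.obj (op (st W))) : F.obj.map (incl h).op (F.obj.map (incl h').op s) =
      F.obj.map (incl (h.trans h')).op s := by
  rw [← incl_comp h h', op_comp, F.obj.map_comp, ConcreteCategory.comp_apply]

lemma obj_map_comp (F : GSheaf G) {U V W : Opens G.Obj} (f : st U ⟶ st V) (g : st V ⟶ st W)
    (s : F.obj.obj (op (st W))) :
    F.obj.map (f ≫ g).op s = F.obj.map f.op (F.obj.map g.op s) := by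
  rw [op_comp, F.obj.map_comp, ConcreteCategory.comp_apply]

lemma incl_hom_comp_incl_hom {U V W : Opens G.Obj} (h : U ≤ V) (h' : V ≤ W) {E : EtSp G}
    (j : openSp G W ⟶ E) :
    (incl h).hom ≫ (incl h').hom ≫ j = (incl (h.trans h')).hom ≫ j := by
  rw [← incl_comp h h']
  exact (Category.assoc _ _ _).symm

/-- A continuous map from a space étale over `∧G` to a space étale over `G`, over the map
`∧G₀ → G₀`. -/
structure OverLoop (E' : EtSp (inertia G)) (E : EtSp G) where
  toFun : E' → E
  continuous_toFun : Continuous toFun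
  proj_toFun : ∀ e, E.proj (toFun e) = loopPt (E'.proj e)

variable {E' : EtSp (inertia G)} {E : EtSp G} (q : OverLoop E' E)

/-- The morphism `j : U ⟶ E` over `G` lifts `j' : V ⟶ E'` over `∧G`. -/
def IsLift {V : Opens (inertia G).Obj} (j' : openSp (inertia G) V ⟶ E') {U : Opens G.Obj}
    (j : openSp G U ⟶ E) (hV : V ≤ loopsOver U) : Prop :=
  ∀ v : V, q.toFun (j'.map v) = j.map ⟨loopPt v.1, hV v.2⟩ ∧
    under (j'.arr v) = j.arr ⟨loopPt v.1, hV v.2⟩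

variable {q} in
lemma IsLift.mono {V V' : Opens (inertia G).Obj} {j' : openSp (inertia G) V ⟶ E'} {U : Opens G.Obj}
    {j : openSp G U ⟶ E} {hV : V ≤ loopsOver U} (h : IsLift q j' j hV) (hV' : V' ≤ V) :
    IsLift q ((incl hV').hom ≫ j') j (hV'.trans hV) := fun v =>
  ⟨(h ⟨v.1, hV' v.2⟩).1, (congrArg under (incl_comp_arr hV' j' v)).trans (h ⟨v.1, hV' v.2⟩).2⟩

/-- A morphism over `∧G` lifts locally to a morphism over `G`. -/
lemma exists_isLift {V : Opens (inertia G).Obj} (j' : openSp (inertia G) V ⟶ E')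
    {v : (inertia G).Obj} (hv : v ∈ V) :
    ∃ (W : Opens (inertia G).Obj) (hW : W ≤ V) (_ : v ∈ W) (U : Opens G.Obj)
      (j : openSp G U ⟶ E) (hWU : W ≤ loopsOver U), IsLift q ((incl hW).hom ≫ j') j hWU := by
  let p : fib (loopPt v) E := ⟨(q.toFun (j'.map ⟨v, hv⟩), under (j'.arr ⟨v, hv⟩)),
    (src_under _).trans ((congrArg loopPt (j'.src_arr _)).trans (q.proj_toFun _).symm),
    (tgt_under _).trans (congrArg loopPt (j'.tgt_arr _))⟩
  obtain ⟨U, hU, j, hj⟩ := exists_section p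
  rw [fibMap_fibPt] at hj
  have h1 : j.map ⟨loopPt v, hU⟩ = q.toFun (j'.map ⟨v, hv⟩) :=
    congrArg (fun p : fib (loopPt v) E => p.1.1) hj
  have h2 : j.arr ⟨loopPt v, hU⟩ = under (j'.arr ⟨v, hv⟩) :=
    congrArg (fun p : fib (loopPt v) E => p.1.2) hj
  let V₀ : Opens (inertia G).Obj := V ⊓ loopsOver U
  have hcm : Continuous fun w : V₀ => q.toFun (j'.map ⟨w.1, w.2.1⟩) :=
    q.continuous_toFun.comp (j'.continuous_map.comp (continuous_subtype_val.subtype_mk _))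
  have hca : Continuous fun w : V₀ => under (j'.arr ⟨w.1, w.2.1⟩) :=
    continuous_under.comp (j'.continuous_arr.comp (continuous_subtype_val.subtype_mk _))
  have hl : Continuous fun w : V₀ => (⟨loopPt w.1, w.2.2⟩ : U) :=
    (continuous_loopPt.comp continuous_subtype_val).subtype_mk _
  have e2 : ∀ᶠ w in 𝓝 (⟨v, hv, hU⟩ : V₀),
      under (j'.arr ⟨w.1, w.2.1⟩) = j.arr ⟨loopPt w.1, w.2.2⟩ :=
    eventually_eq_of_isLocalHomeomorph G.etale_tgt.isLocalHomeomorph hca.continuousAt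
      (j.continuous_arr.comp hl).continuousAt h2.symm (Filter.Eventually.of_forall fun w =>
        ((tgt_under _).trans (congrArg loopPt (j'.tgt_arr _))).trans
          (j.tgt_arr ⟨loopPt w.1, w.2.2⟩).symm)
  have e1 : ∀ᶠ w in 𝓝 (⟨v, hv, hU⟩ : V₀),
      q.toFun (j'.map ⟨w.1, w.2.1⟩) = j.map ⟨loopPt w.1, w.2.2⟩ :=
    eventually_eq_of_isLocalHomeomorph E.etale.isLocalHomeomorph hcm.continuousAt
      (j.continuous_map.comp hl).continuousAt h1.symm (by
        filter_upwards [e2] with w hw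
        exact (q.proj_toFun _).trans ((congrArg loopPt (j'.src_arr ⟨w.1, w.2.1⟩).symm).trans
          ((src_under _).symm.trans ((congrArg G.src hw).trans (j.src_arr ⟨loopPt w.1, w.2.2⟩)))))
  obtain ⟨O, hO, hOo, hvO⟩ := eventually_nhds_iff.1 (e1.and e2)
  have key : ∀ w ∈ Subtype.val '' O, ∃ hw : w ∈ V₀, (⟨w, hw⟩ : V₀) ∈ O := by
    rintro _ ⟨w, hw, rfl⟩; exact ⟨w.2, hw⟩
  refine ⟨⟨Subtype.val '' O, V₀.isOpen.isOpenMap_subtype_val _ hOo⟩, fun w hw => (key w hw).1.1,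
    ⟨_, hvO, rfl⟩, U, j, fun w hw => (key w hw).1.2, fun w => ?_⟩
  obtain ⟨h, h'⟩ := key w.1 w.2
  exact ⟨(hO _ h').1, (congrArg under (incl_comp_arr _ j' w)).trans (hO _ h').2⟩

variable {M : GSheaf (inertia G)}

lemma push_map_incl (M : GSheaf (inertia G)) {U V : Opens G.Obj} (h : U ≤ V)
    (s : M.obj.obj (op (st (loopsOver V)))) :
    (((push G).obj M).obj.map (incl h).op).hom s = M.obj.map (incl (loopsOver_mono h)).op s :=
  congrArg (fun k : st (loopsOver U) ⟶ st (loopsOver V) => M.obj.map k.op s) (loopSite_map_incl h)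

/-- The values of a section with values in a push-forward, as sections over `∧G`. -/
def pval (c : Sec E ((push G).obj M)) (U : Opens G.Obj) (j : openSp G U ⟶ E) :
    M.obj.obj (op (st (loopsOver U))) := c.val U j

lemma pval_incl_comp (c : Sec E ((push G).obj M)) {U V : Opens G.Obj} (h : U ≤ V)
    (j : openSp G V ⟶ E) : pval c U ((incl h).hom ≫ j) =
      M.obj.map (incl (loopsOver_mono h)).op (pval c V j) :=
  (c.val_comp U V (incl h) j).trans (push_map_incl M h _)

/-- The restriction to loops does not depend on the local lift. -/
lemma map_pval_eq_of_isLift (c : Sec E ((push G).obj M)) {V : Opens (inertia G).Obj}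
    {j' : openSp (inertia G) V ⟶ E'} {U U' : Opens G.Obj} {j : openSp G U ⟶ E}
    {i : openSp G U' ⟶ E} {hV : V ≤ loopsOver U} {hV' : V ≤ loopsOver U'}
    (h : IsLift q j' j hV) (h' : IsLift q j' i hV') :
    M.obj.map (incl hV).op (pval c U j) = M.obj.map (incl hV').op (pval c U' i) := by
  refine eq_of_locally_eq M _ _ fun v hv => ?_
  have hv₁ : loopPt v ∈ U := hV hv
  have hv₂ : loopPt v ∈ U' := hV' hv
  obtain ⟨W, hW, hW', hvW, e⟩ := exists_incl_comp_eq_incl_comp j i hv₁ hv₂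
    ((fibMap_fibPt hv₁ j).trans ((fib_ext ((h ⟨v, hv⟩).1.symm.trans (h' ⟨v, hv⟩).1)
      ((h ⟨v, hv⟩).2.symm.trans (h' ⟨v, hv⟩).2)).trans (fibMap_fibPt hv₂ i).symm))
  refine ⟨V ⊓ loopsOver W, inf_le_left, ⟨hv, hvW⟩, ?_⟩
  rw [map_incl_incl, map_incl_incl]
  have h1 := map_incl_incl M (inf_le_right : V ⊓ loopsOver W ≤ _) (loopsOver_mono hW) (pval c U j)
  have h2 := map_incl_incl M (inf_le_right : V ⊓ loopsOver W ≤ _) (loopsOver_mono hW')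
    (pval c U' i)
  rw [← pval_incl_comp c hW j] at h1
  rw [← pval_incl_comp c hW' i] at h2
  rw [e] at h1
  exact h1.symm.trans h2

/-- The section `c'` over `E'` is the restriction of the section `c` over `E`: its value on a
morphism which has a lift is the value of `c` on the lift. -/
def Restricts (c : Sec E ((push G).obj M)) (c' : Sec E' M) : Prop :=
  ∀ (V : Opens (inertia G).Obj) (j' : openSp (inertia G) V ⟶ E') (U : Opens G.Obj)
    (j : openSp G U ⟶ E) (hV : V ≤ loopsOver U), IsLift q j' j hV →
      c'.val V j' = M.obj.map (incl hV).op (pval c U j)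

variable {q} in
lemma Restricts.unique {c : Sec E ((push G).obj M)} {c' c'' : Sec E' M} (h : Restricts q c c')
    (h' : Restricts q c c'') : c' = c'' := by
  refine Sec.ext fun V j' => eq_of_locally_eq M _ _ fun v hv => ?_
  obtain ⟨W, hW, hvW, U, j, hWU, hl⟩ := exists_isLift q j' hv
  refine ⟨W, hW, hvW, ?_⟩
  rw [← c'.val_comp, ← c''.val_comp, h _ _ _ _ _ hl, h' _ _ _ _ _ hl]

/-- The map from loops to their base points. -/
def overLoopPt {V : Opens (inertia G).Obj} {U : Opens G.Obj} (h : V ≤ loopsOver U) :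
    OverLoop (openSp (inertia G) V) (openSp G U) where
  toFun v := ⟨loopPt v.1, h v.2⟩
  continuous_toFun := (continuous_loopPt.comp continuous_subtype_val).subtype_mk _
  proj_toFun _ := rfl

variable {q} in
lemma IsLift.comp {V W : Opens (inertia G).Obj} {U U' : Opens G.Obj} {hV : V ≤ loopsOver U}
    {hW : W ≤ loopsOver U'} {j' : openSp (inertia G) V ⟶ E'} {j : openSp G U ⟶ E}
    {g : openSp (inertia G) W ⟶ openSp (inertia G) V} {k : openSp G U' ⟶ openSp G U}
    (h : IsLift q j' j hV) (h' : IsLift (overLoopPt hV) g k hW) :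
    IsLift q (g ≫ j') (k ≫ j) hW := fun w => by
  have h1 : (⟨loopPt (g.map w).1, hV (g.map w).2⟩ : U) = k.map ⟨loopPt w.1, hW w.2⟩ := (h' w).1
  refine ⟨(h (g.map w)).1.trans (congrArg j.map h1), ?_⟩
  exact (under_comp_arr g j' w).trans
    (mul_congr ((h (g.map w)).2.trans (congrArg j.arr h1)) (h' w).2)

lemma comp_incl_eq_of_isLift {V W : Opens (inertia G).Obj} {U U' : Opens G.Obj}
    {hV : V ≤ loopsOver U} {hW : W ≤ loopsOver U'} {g : st W ⟶ st V} {k : st U' ⟶ st U}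
    (h : IsLift (overLoopPt hV) g.hom k.hom hW) :
    g ≫ incl hV = (incl hW ≫ (loopSite G).map k : st W ⟶ st (loopsOver U)) := by
  refine InducedCategory.hom_ext (inertia_openSp_hom_ext fun w => ?_)
  have h1 : (g.hom ≫ (incl hV).hom).arr w = g.hom.arr w :=
    EtaleGroupoid.one_mul' (G := inertia G) (((inertia G).tgt_one _).trans (g.hom.src_arr w).symm)
  have h2 : ((incl hW).hom ≫ loopsOverMap k.hom).arr w = (loopsOverMap k.hom).arr ⟨w.1, hW w.2⟩ :=
    incl_comp_arr _ _ _
  exact (congrArg under h1).trans ((h w).2.trans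
    ((under_loopsOverMap _ _).symm.trans (congrArg under h2.symm)))

/-- The values on local lifts glue, as they do not depend on the lift. -/
lemma exists_restricts (c : Sec E ((push G).obj M)) : ∃ c' : Sec E' M, Restricts q c c' := by
  have loc : ∀ (V : Opens (inertia G).Obj) (j' : openSp (inertia G) V ⟶ E'),
      ∃ t : M.obj.obj (op (st V)), ∀ (W : Opens (inertia G).Obj) (hW : W ≤ V) (U : Opens G.Obj)
        (j : openSp G U ⟶ E) (hWU : W ≤ loopsOver U), IsLift q ((incl hW).hom ≫ j') j hWU →
          M.obj.map (incl hW).op t = M.obj.map (incl hWU).op (pval c U j) := by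
    intro V j'
    choose N hN hvN O i hO hi using fun v : V => exists_isLift q j' v.2
    have hi' : ∀ (v : V) (W : Opens (inertia G).Obj) (hW : W ≤ N v),
        IsLift q ((incl (hW.trans (hN v))).hom ≫ j') (i v) (hW.trans (hO v)) := fun v W hW => by
      have := (hi v).mono hW
      rw [incl_hom_comp_incl_hom] at this
      exact this
    obtain ⟨t, ht⟩ := exists_glue M N hN (fun v hv => ⟨⟨v, hv⟩, hvN ⟨v, hv⟩⟩)
      (fun v => M.obj.map (incl (hO v)).op (pval c (O v) (i v))) fun v w => by
        rw [map_incl_incl, map_incl_incl]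
        exact map_pval_eq_of_isLift q c (hi' v _ inf_le_left) (hi' w _ inf_le_right)
    refine ⟨t, fun W hW U j hWU hj => eq_of_locally_eq M _ _ fun v hv =>
      ⟨W ⊓ N ⟨v, hW hv⟩, inf_le_left, ⟨hv, hvN _⟩, ?_⟩⟩
    have h1 := congrArg (M.obj.map (incl (inf_le_right : W ⊓ N ⟨v, hW hv⟩ ≤ _)).op)
      (ht ⟨v, hW hv⟩)
    rw [map_incl_incl, map_incl_incl] at h1
    rw [map_incl_incl, map_incl_incl]
    refine h1.trans (map_pval_eq_of_isLift q c (hi' _ _ inf_le_right) ?_)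
    have := hj.mono (inf_le_left : W ⊓ N ⟨v, hW hv⟩ ≤ W)
    rw [incl_hom_comp_incl_hom] at this
    exact this
  choose t ht using loc
  refine ⟨⟨t, fun V₁ V₂ f j' => eq_of_locally_eq M _ _ fun v hv => ?_⟩,
    fun V j' U j hV hj => ?_⟩
  · -- lift `j'` near the image of `v`, and then `f` near `v`
    obtain ⟨W₂, hW₂, hvW₂, U, j, hWU, hj⟩ := exists_isLift q j' (f.hom.map ⟨v, hv⟩).2
    obtain ⟨V', hV', g, hvV', e⟩ := exists_incl_comp f W₂ hW₂ ⟨v, hv⟩ hvW₂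
    obtain ⟨W₁, hW₁, hvW₁, U₁, k, hWU₁, hk⟩ := exists_isLift (overLoopPt hWU) g.hom hvV'
    refine ⟨W₁, hW₁.trans hV', hvW₁, ?_⟩
    have e1 : incl (hW₁.trans hV') ≫ f = (incl hW₁ ≫ g) ≫ incl hW₂ := by
      rw [← incl_comp hW₁ hV', Category.assoc, e, Category.assoc]
    have h1 : IsLift q ((incl (hW₁.trans hV')).hom ≫ f.hom ≫ j') (k ≫ j) hWU₁ := by
      have h2 := hj.comp (g := (incl hW₁ ≫ g).hom) hk
      have h3 : (incl (hW₁.trans hV')).hom ≫ f.hom ≫ j' =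
          (incl hW₁ ≫ g).hom ≫ (incl hW₂).hom ≫ j' := by
        refine (Category.assoc _ _ _).symm.trans (Eq.trans ?_ (Category.assoc _ _ _))
        exact congrArg (fun m : st W₁ ⟶ st V₂ => m.hom ≫ j') e1
      rw [h3]
      exact h2
    rw [ht _ _ _ _ _ _ _ h1]
    have h4 : pval c U₁ (k ≫ j) = M.obj.map ((loopSite G).map
        (InducedCategory.homMk k : st U₁ ⟶ st U)).op (pval c U j) :=
      c.val_comp U₁ U (InducedCategory.homMk k) j
    have h5 := comp_incl_eq_of_isLift (g := incl hW₁ ≫ g)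
      (k := (InducedCategory.homMk k : st U₁ ⟶ st U)) hk
    have h6 : M.obj.map (incl hWU₁).op (pval c U₁ (k ≫ j)) =
        M.obj.map (incl hW₁ ≫ g : st W₁ ⟶ st W₂).op (M.obj.map (incl hWU).op (pval c U j)) := by
      rw [h4]
      have h7 := congrArg (fun m : st W₁ ⟶ st (loopsOver U) => M.obj.map m.op (pval c U j)) h5
      exact ((obj_map_comp M (incl hW₁ ≫ g) (incl hWU) _).symm.trans
        (h7.trans (obj_map_comp M (incl hWU₁) _ _))).symm
    rw [h6, ← ht V₂ j' W₂ hW₂ U j hWU hj]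
    have h8 := congrArg (fun m : st W₁ ⟶ st V₂ => M.obj.map m.op (t V₂ j')) e1
    exact ((obj_map_comp M (incl hW₁ ≫ g) (incl hW₂) _).symm.trans
      (h8.symm.trans (obj_map_comp M (incl (hW₁.trans hV')) f _)))
  · have h1 := ht V j' V le_rfl U j hV (by
      have : (incl (le_refl V)).hom ≫ j' = j' := Category.id_comp _
      rw [this]
      exact hj)
    have h2 : M.obj.map (incl (le_refl V)).op (t V j') = t V j' :=
      congrArg (fun k => k.hom (t V j')) (M.obj.map_id (op (st V)))
    exact h2.symm.trans h1

/-- The restriction of sections over `E` to sections over `E'`, for a map `E' → E` over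
`∧G → G`. -/
noncomputable def res : Sec E ((push G).obj M) →+ Sec E' M :=
  AddMonoidHom.mk' (fun c => (exists_restricts q c).choose) fun c d => by
    refine (exists_restricts q (c + d)).choose_spec.unique fun V j' U j hV hl => ?_
    rw [Sec.add_val, (exists_restricts q c).choose_spec _ _ _ _ _ hl,
      (exists_restricts q d).choose_spec _ _ _ _ _ hl, ← map_add]
    rfl

lemma restricts_res (c : Sec E ((push G).obj M)) : Restricts q c (res q c) :=
  (exists_restricts q c).choose_spec

variable {q} in
lemma Restricts.res_eq {c : Sec E ((push G).obj M)} {c' : Sec E' M} (h : Restricts q c c') :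
    res q c = c' :=
  (restricts_res q c).unique h

lemma map_res {M' : GSheaf (inertia G)} (f : M ⟶ M') (c : Sec E ((push G).obj M)) :
    Sec.map f (res q c) = res q (Sec.map ((push G).map f) c) := by
  refine (Restricts.res_eq fun V j' U j hV hl => ?_).symm
  rw [Sec.map_val, restricts_res q c V j' U j hV hl]
  exact congrArg (fun k => k.hom (pval c U j)) (f.hom.naturality (incl hV).op)

lemma res_pull {F' : EtSp (inertia G)} {F : EtSp G} (q' : OverLoop F' F) (f' : E' ⟶ F') (f : E ⟶ F)
    (h : ∀ e, q'.toFun (f'.map e) = f.map (q.toFun e))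
    (h' : ∀ e, under (f'.arr e) = f.arr (q.toFun e)) (c : Sec F ((push G).obj M)) :
    res q (Sec.pull f c) = Sec.pull f' (res q' c) := by
  refine Restricts.res_eq fun V j' U j hV hl => ?_
  refine restricts_res q' c V (j' ≫ f') U (j ≫ f) hV fun v => ⟨?_, ?_⟩
  · exact (h _).trans (congrArg f.map (hl v).1)
  · exact (under_comp_arr j' f' v).trans
      (mul_congr ((h' _).trans (congrArg f.arr (hl v).1)) (hl v).2)

end Restriction

section Transfer

variable {G : EtaleGroupoid.{u}} {M : GSheaf (inertia G)}

lemma top_le_loopsOver : (⊤ : Opens (inertia G).Obj) ≤ loopsOver ⊤ := fun _ _ => trivial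

/-- The invariant sections of a push-forward are invariant sections over `∧G`. -/
noncomputable def transfer (M : GSheaf (inertia G)) :
    invSections G ((push G).obj M) →+ invSections (inertia G) M :=
  AddMonoidHom.mk' (fun σ => ⟨M.obj.map (incl top_le_loopsOver).op
    (show M.obj.obj (op (st (loopsOver ⊤))) from σ.1), fun V f => by
      let σ' : M.obj.obj (op (st (loopsOver ⊤))) := σ.1
      change M.obj.map f.op (M.obj.map (incl top_le_loopsOver).op σ') =
        M.obj.map (incl le_top).op (M.obj.map (incl top_le_loopsOver).op σ')
      refine eq_of_locally_eq M _ _ fun v hv => ?_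
      obtain ⟨W, hW, hvW, U, k, hWU, hk⟩ := exists_isLift (overLoopPt top_le_loopsOver) f.hom hv
      refine ⟨W, hW, hvW, ?_⟩
      have h1 := comp_incl_eq_of_isLift (g := incl hW ≫ f)
        (k := (InducedCategory.homMk k : st U ⟶ st ⊤)) hk
      have h2 := congrArg (fun m : st W ⟶ st (loopsOver ⊤) => M.obj.map m.op σ') h1
      have h3 : M.obj.map ((loopSite G).map (InducedCategory.homMk k : st U ⟶ st ⊤)).op σ' =
          M.obj.map (incl (loopsOver_mono le_top)).op σ' :=
        (σ.2 U (InducedCategory.homMk k)).trans (push_map_incl M le_top σ')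
      have h4 : M.obj.map (incl hW).op (M.obj.map f.op
          (M.obj.map (incl top_le_loopsOver).op σ')) = M.obj.map (incl hWU).op
            (M.obj.map (incl (loopsOver_mono le_top)).op σ') :=
        (obj_map_comp M (incl hW) f _).symm.trans
          ((obj_map_comp M (incl hW ≫ f) (incl top_le_loopsOver) _).symm.trans
            (h2.trans ((obj_map_comp M (incl hWU) _ _).trans
              (congrArg (M.obj.map (incl hWU).op) h3))))
      refine h4.trans ?_
      rw [map_incl_incl, map_incl_incl]
      exact (map_incl_incl M _ _ _).symm⟩) fun σ τ =>
    Subtype.ext (map_add (M.obj.map (incl top_le_loopsOver).op).hom _ _)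

lemma Γinv_map_transfer {M' : GSheaf (inertia G)} (f : M ⟶ M')
    (σ : invSections G ((push G).obj M)) :
    ((Γinv (inertia G)).map f).hom (transfer M σ) =
      transfer M' (((Γinv G).map ((push G).map f)).hom σ) :=
  Subtype.ext (congrArg (fun k => k.hom (show M.obj.obj (op (st (loopsOver ⊤))) from σ.1))
    (f.hom.naturality (incl (top_le_loopsOver (G := G))).op))

/-- The restriction of an invariant section is again the section given by an invariant section. -/
lemma res_ofInv {E' : EtSp (inertia G)} {E : EtSp G} (q : OverLoop E' E)
    (σ : invSections G ((push G).obj M)) :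
    res q (Sec.ofInv E σ) = Sec.ofInv E' (transfer M σ) := by
  refine Restricts.res_eq fun V j' U j hV hl => ?_
  let σ' : M.obj.obj (op (st (loopsOver ⊤))) := σ.1
  have h1 : pval (Sec.ofInv E σ) U j = M.obj.map (incl (loopsOver_mono le_top)).op σ' :=
    push_map_incl M le_top σ'
  rw [h1, map_incl_incl]
  exact map_incl_incl M le_top top_le_loopsOver σ'

end Transfer

/-! ### The restriction of forms, and the holonomy line bundle -/

section PullForms

variable {M N N' P : Type u} [TopologicalSpace M] [SmoothSpace M] [TopologicalSpace N]
  [SmoothSpace N] [TopologicalSpace N'] [SmoothSpace N'] [TopologicalSpace P] [SmoothSpace P]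

lemma Form.pull_apply {p : ℕ} (f : SMap M N) (α : Form p N) {n : ℕ} {w : Eu n → M} {x : Eu n}
    (h : IsSmoothAt w x) : (Form.pull f α).1 n w x = α.1 n (f.toFun ∘ w) x := if_pos h

lemma Form.pull_congr {p : ℕ} {f g : SMap M N} (h : ∀ x, f.toFun x = g.toFun x) (α : Form p N) :
    Form.pull f α = Form.pull g α := by
  obtain ⟨f, _, _⟩ := f
  obtain ⟨g, _, _⟩ := g
  obtain rfl : f = g := funext h
  rfl

/-- The composite of smooth maps. -/
def SMap.comp (g : SMap N P) (f : SMap M N) : SMap M P where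
  toFun x := g.toFun (f.toFun x)
  continuous := g.continuous.comp f.continuous
  smooth h := g.smooth (f.smooth h)

lemma Form.pull_pull {p : ℕ} (f : SMap M N) (g : SMap N P) (α : Form p P) :
    Form.pull f (Form.pull g α) = Form.pull (g.comp f) α := by
  apply Subtype.ext; funext n w x
  by_cases h : IsSmoothAt w x
  · exact (Form.pull_apply f _ h).trans ((Form.pull_apply g _ (f.smooth h)).trans
      (Form.pull_apply (g.comp f) α h).symm)
  · exact (if_neg h).trans (if_neg h).symm

end PullForms

section RestrictForms

variable {G : EtaleGroupoid.{u}}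

/-- The map `∧G₀ → G₀` is smooth. -/
def loopPtMap (G : EtaleGroupoid.{u}) : SMap (inertia G).Obj G.Obj :=
  (G.etale_src.smap).comp (loopIncl G)

variable {E' F' : EtSp (inertia G)} {E F : EtSp G}

/-- A map over `∧G → G` is smooth. -/
def OverLoop.smap (q : OverLoop E' E) : SMap E' E where
  toFun := q.toFun
  continuous := q.continuous_toFun
  smooth {n w x} h := by
    have h1 : ∀ᶠ y in 𝓝 x, ContinuousAt (q.toFun ∘ w) y :=
      (IsSmoothAt.continuousNear h).mono fun _ hy => q.continuous_toFun.continuousAt.comp hy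
    refine (E.etale.smooth_iff h1).1 ?_
    have h2 := (loopPtMap G).smooth (E'.etale.smap.smooth h)
    have h3 : E.proj ∘ q.toFun ∘ w = (loopPtMap G).toFun ∘ E'.etale.smap.toFun ∘ w :=
      funext fun y => q.proj_toFun (w y)
    rw [h3]
    exact h2

/-- The pull-back of forms to loops. -/
noncomputable def pullLoops (p : ℕ) (U : Opens G.Obj) :
    Form p (openSp G U) →+ Form p (openSp (inertia G) (loopsOver U)) :=
  Form.pull (overLoopPt (le_refl (loopsOver U))).smap

/-- The pull-back of functions to loops. -/
def pullLoopsUnits (U : Opens G.Obj) :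
    smoothUnits (openSp G U) →+ smoothUnits (openSp (inertia G) (loopsOver U)) :=
  smoothUnits.pull (overLoopPt (le_refl (loopsOver U))).smap

lemma pullLoops_pull {p : ℕ} {U V : Opens G.Obj} (f : openSp G V ⟶ openSp G U)
    (α : Form p (openSp G U)) : pullLoops p V (Form.pull (EtSp.smap f) α) =
      Form.pull (EtSp.smap (loopsOverMap f)) (pullLoops p U α) := by
  refine (Form.pull_pull (overLoopPt (le_refl (loopsOver V))).smap (EtSp.smap f) α).trans
    (Eq.trans ?_ (Form.pull_pull (P := openSp G U)
      (EtSp.smap (loopsOverMap f)) (overLoopPt (le_refl (loopsOver U))).smap α).symm)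
  exact Form.pull_congr (N := openSp G U) (fun a => Subtype.ext (loopPt_loopsOverMap f a).symm) α

/-- The restriction of forms along `∧G → G`. -/
noncomputable def restrictForms (G : EtaleGroupoid.{u}) (p : ℕ) :
    formSheaf G p ⟶ (push G).obj (formSheaf (inertia G) p) where
  hom :=
    { app := fun U => AddCommGrpCat.ofHom (pullLoops p (Site.opens U.unop))
      naturality := fun _ _ f => AddCommGrpCat.hom_ext (AddMonoidHom.ext fun α =>
        pullLoops_pull f.unop.hom α) }

/-- The restriction of `ℂ^×`-valued functions along `∧G → G`. -/
noncomputable def restrictUnits (G : EtaleGroupoid.{u}) :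
    unitsSheaf G ⟶ (push G).obj (unitsSheaf (inertia G)) where
  hom :=
    { app := fun U => AddCommGrpCat.ofHom (pullLoopsUnits (Site.opens U.unop))
      naturality := fun _ _ f => AddCommGrpCat.hom_ext (AddMonoidHom.ext fun α =>
        Subtype.ext (funext fun a => congrArg α.1
          (Subtype.ext (loopPt_loopsOverMap f.unop.hom a).symm))) }

lemma restrictForms_dSheaf (p : ℕ) : restrictForms G p ≫ (push G).map (dSheaf (inertia G) p) =
    dSheaf G p ≫ restrictForms G (p + 1) :=
  Sheaf.hom_ext (NatTrans.ext (funext fun U => AddCommGrpCat.hom_ext (AddMonoidHom.ext fun α =>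
    (Form.d_pull (overLoopPt (le_refl (loopsOver (Site.opens U.unop)))).smap α))))

lemma restrictUnits_dlogSheaf : restrictUnits G ≫ (push G).map (dlogSheaf (inertia G)) =
    dlogSheaf G ≫ restrictForms G 1 :=
  Sheaf.hom_ext (NatTrans.ext (funext fun U => AddCommGrpCat.hom_ext (AddMonoidHom.ext fun α =>
    (dlog_pull (overLoopPt (le_refl (loopsOver (Site.opens U.unop)))).smap α))))

/-- The push-forward of complexes of sheaves from `∧G` to `G`. -/
noncomputable abbrev pushC (M : CochainComplex (GSheaf (inertia G)) ℕ) :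
    CochainComplex (GSheaf G) ℕ :=
  ((push G).mapHomologicalComplex (ComplexShape.up ℕ)).obj M

/-- The restriction `ℂ^×(3) → β_* ℂ^×(3)` along `β : ∧G → G`. -/
noncomputable def restrictCx (G : EtaleGroupoid.{u}) : Cx G 3 ⟶ pushC (Cx (inertia G) 3) where
  f
    | 0 => restrictUnits G
    | 1 => restrictForms G 1
    | 2 => restrictForms G 2
    | _ + 3 => 0
  comm' := by
    rintro i _ (rfl : _ = _)
    match i with
    | 0 =>
      rw [Cx_d G 3 0]
      refine Eq.trans ?_ (restrictUnits_dlogSheaf (G := G))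
      exact congrArg (fun k => restrictUnits G ≫ (push G).map k) (Cx_d (inertia G) 3 0)
    | 1 =>
      rw [Cx_d G 3 1]
      refine Eq.trans ?_ (restrictForms_dSheaf (G := G) 1)
      exact congrArg (fun k => restrictForms G 1 ≫ (push G).map k) (Cx_d (inertia G) 3 1)
    | 2 =>
      refine Eq.trans ?_ (comp_zero (X := (Cx G 3).X 2)).symm
      refine Eq.trans (congrArg (fun k => restrictForms G 2 ≫ (push G).map k)
        ((isZero_zero (GSheaf (inertia G))).eq_of_tgt ((Cx (inertia G) 3).d 2 3) 0)) ?_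
      exact (congrArg (restrictForms G 2 ≫ ·) ((push G).map_zero _ _)).trans comp_zero
    | _ + 3 => exact (isZero_zero (GSheaf G)).eq_of_src _ _

variable (q : OverLoop E' E)

lemma res_restrictForms {p : ℕ} (α : Form p E) :
    res q (Sec.map (restrictForms G p) (Sec.ofForm α)) = Sec.ofForm (Form.pull q.smap α) := by
  refine Restricts.res_eq fun V j' U j hV hl => ?_
  refine (Form.pull_pull (EtSp.smap j') q.smap α).trans ?_
  change _ = Form.pull (EtSp.smap (incl hV).hom) (pullLoops p U (Form.pull (EtSp.smap j) α))
  refine Eq.trans ?_ (congrArg (Form.pull (EtSp.smap (incl hV).hom))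
    (Form.pull_pull (overLoopPt (le_refl (loopsOver U))).smap (EtSp.smap j) α)).symm
  refine Eq.trans ?_ (Form.pull_pull (EtSp.smap (incl hV).hom) _ α).symm
  exact Form.pull_congr (fun v => (hl v).1) α

lemma res_restrictUnits (h : smoothUnits E) :
    res q (Sec.map (restrictUnits G) (Sec.ofUnits h)) =
      Sec.ofUnits (smoothUnits.pull q.smap h) := by
  refine Restricts.res_eq fun V j' U j hV hl => ?_
  exact Subtype.ext (funext fun v => congrArg h.1 (hl v).1)

end RestrictForms

section InertiaMorita

variable {K G : EtaleGroupoid.{u}} {φ : EtaleFunctor K G}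

/-- A Morita morphism `K → G` induces a Morita morphism `∧K → ∧G`. -/
lemma EtaleFunctor.IsMorita.inertia (hφ : φ.IsMorita) : φ.inertia.IsMorita where
  cartesian := fun (x : K.Loop) (y : K.Loop) (g : G.LoopArr) (hx : g.fst = φ.loop x)
      (hy : g.conj = φ.loop y) => by
    have h1 : G.src g.snd = φ.obj (K.tgt x.1) := by
      rw [← g.eq, hx]; exact φ.tgt_arr _
    have h2 : G.tgt g.snd = φ.obj (K.src y.1) := by
      rw [← g.src_conj, hy]; exact φ.src_arr _
    obtain ⟨k, ⟨hk1, hk2, hk3⟩, huk⟩ := hφ.cartesian _ _ _ h1 h2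
    let p : K.LoopArr := LoopArr.mk x k hk1.symm
    have hp : φ.loopArr p = g := LoopArr.ext (congrArg Subtype.val hx.symm) hk3
    have hc : p.conj = y := by
      have h3 : φ.loop p.conj = φ.loop y := (φ.conj_loopArr p).symm.trans ((congrArg _ hp).trans hy)
      refine Subtype.ext ((hφ.cartesian (K.src y.1) (K.tgt y.1) (φ.arr y.1)
        (φ.src_arr _) (φ.tgt_arr _)).unique ⟨?_, ?_, congrArg Subtype.val h3⟩ ⟨rfl, rfl, rfl⟩)
      · exact p.src_conj.trans hk2
      · exact p.tgt_conj.trans (hk2.trans y.2)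
    refine ⟨p, ⟨rfl, hc, hp⟩, ?_⟩
    rintro (q : K.LoopArr) ⟨(hq1 : q.fst = x), (hq2 : q.conj = y), (hq3 : φ.loopArr q = g)⟩
    refine LoopArr.ext (congrArg Subtype.val hq1) (huk q.snd ⟨?_, ?_, ?_⟩)
    · rw [← q.eq, hq1]
    · rw [← q.src_conj, hq2]
    · exact congrArg LoopArr.snd hq3
  surjective := fun (y : G.Loop) => by
    obtain ⟨x, g, hx, hg⟩ := hφ.surjective (G.tgt y.1)
    obtain ⟨g', hg'⟩ : ∃ g' : G.LoopArr, g' = LoopArr.mk y g hg.symm := ⟨_, rfl⟩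
    have h1 : G.src g'.conj.1 = φ.obj x := by rw [g'.src_conj, hg', hx]; rfl
    have h2 : G.tgt g'.conj.1 = φ.obj x := by rw [g'.tgt_conj, hg', hx]; rfl
    obtain ⟨k, ⟨hk1, hk2, hk3⟩, _⟩ := hφ.cartesian x x g'.conj.1 h1 h2
    refine ⟨(⟨k, hk1.trans hk2.symm⟩ : K.Loop), g', Subtype.ext hk3, ?_⟩
    rw [hg']; rfl

end InertiaMorita

section LineBundle

variable {K : EtaleGroupoid.{u}}

/-- The pair `(a, b)`, as a pair of composable arrows. -/
def pairMap (K : EtaleGroupoid.{u}) : SMap K.LoopArr K.Arr₂ where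
  toFun := Subtype.val
  continuous := continuous_subtype_val
  smooth {n w x} h := by
    refine ⟨(IsSmoothAt.continuousNear h).mono fun _ hy =>
      continuous_subtype_val.continuousAt.comp hy, ?_⟩
    exact (LoopArr.isSmoothAt_iff_snd (IsSmoothAt.continuousNear h)).1 h

/-- The pair `(b, b⁻¹ab)` of composable arrows. -/
def pairConjMap (K : EtaleGroupoid.{u}) : SMap K.LoopArr K.Arr₂ where
  toFun p := ⟨(p.snd, p.conj.1), p.src_conj.symm⟩
  continuous := (LoopArr.continuous_snd.prodMk
    (continuous_subtype_val.comp LoopArr.continuous_conj)).subtype_mk _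
  smooth {n w x} h := by
    have hc : Continuous fun p : K.LoopArr => (⟨(p.snd, p.conj.1), p.src_conj.symm⟩ : K.Arr₂) :=
      (LoopArr.continuous_snd.prodMk
        (continuous_subtype_val.comp LoopArr.continuous_conj)).subtype_mk _
    refine ⟨(IsSmoothAt.continuousNear h).mono fun _ hy => hc.continuousAt.comp hy, ?_⟩
    exact (loopIncl K).smooth (LoopArr.etale_conj.smap.smooth h)

lemma comp_pairMap_pairConjMap (p : K.LoopArr) :
    K.mul ((pairMap K).toFun p).1.1 ((pairMap K).toFun p).1.2 ((pairMap K).toFun p).2 =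
      K.mul ((pairConjMap K).toFun p).1.1 ((pairConjMap K).toFun p).1.2
        ((pairConjMap K).toFun p).2 :=
  p.mul_conj.symm

namespace GerbeConn

variable (𝒢 : GerbeConn K)

/-- The function `ρ(a, b) = h(a, b) / h(b, b⁻¹ab)`. -/
def holonomy : smoothUnits K.LoopArr :=
  smoothUnits.pull (pairMap K) 𝒢.h - smoothUnits.pull (pairConjMap K) 𝒢.h

lemma holonomy_apply (p : K.LoopArr) : 𝒢.holonomy.1 p =
    𝒢.h.1 p.1 - 𝒢.h.1 ⟨(p.snd, p.conj.1), p.src_conj.symm⟩ := rfl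

lemma h_congr {a b c d : K.Arr} {p : K.tgt a = K.src b} (h : a = c) (h' : b = d) :
    𝒢.h.1 ⟨(a, b), p⟩ = 𝒢.h.1 ⟨(c, d), h ▸ h' ▸ p⟩ := by
  subst h h'; rfl

/-- The line bundle on `∧K` given by the holonomy of a gerbe. -/
noncomputable def lineBundle : LineBundleConn (Holonomy.inertia K) where
  ρ := 𝒢.holonomy
  conn := Form.pull (loopIncl K) 𝒢.A
  ρ_mul := fun (p : K.LoopArr) (q : K.LoopArr) (e : p.conj = q.fst) => by
    change 𝒢.holonomy.1 (p.mul q e) = 𝒢.holonomy.1 p + 𝒢.holonomy.1 q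
    rw [holonomy_apply, holonomy_apply, holonomy_apply]
    have e1 : K.tgt p.snd = K.src q.snd := by rw [← q.eq, ← e, p.tgt_conj]
    have e2 : K.tgt p.conj.1 = K.src q.snd := p.tgt_conj.trans e1
    -- the cocycle condition at `(a, b, d)`, `(b, a', d)` and `(b, d, a'')`
    have d1 := 𝒢.δh p.fst.1 p.snd q.snd p.eq e1
    have d2 := 𝒢.δh p.snd p.conj.1 q.snd p.src_conj.symm e2
    have d3 := 𝒢.δh p.snd q.snd q.conj.1 e1 q.src_conj.symm
    have f1 := 𝒢.h_congr (p := (K.tgt_mul _ _ _).trans e2) p.mul_conj (rfl : q.snd = q.snd)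
    have f2 : K.mul q.snd q.conj.1 q.src_conj.symm = K.mul p.conj.1 q.snd e2 :=
      q.mul_conj.trans (mul_congr (congrArg Subtype.val e).symm rfl)
    have f3 := 𝒢.h_congr (p := e1.trans (K.src_mul _ _ q.src_conj.symm).symm)
      (rfl : p.snd = p.snd) f2
    have f4 := 𝒢.h_congr (p := e2) (congrArg Subtype.val e) (rfl : q.snd = q.snd)
    have f5 := 𝒢.h_congr (p := (p.mul q e).src_conj.symm) (rfl : (p.mul q e).snd = _)
      (congrArg Subtype.val (LoopArr.conj_mul p q e))
    have g1 : 𝒢.h.1 (p.mul q e).1 = 𝒢.h.1 ⟨(p.fst.1, K.mul p.snd q.snd e1),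
      p.eq.trans (K.src_mul _ _ _).symm⟩ := rfl
    have g2 : 𝒢.h.1 p.1 = 𝒢.h.1 ⟨(p.fst.1, p.snd), p.eq⟩ := rfl
    have g3 : 𝒢.h.1 q.1 = 𝒢.h.1 ⟨(q.fst.1, q.snd), q.eq⟩ := rfl
    have g4 : 𝒢.h.1 ⟨((p.mul q e).snd, q.conj.1), by
      rw [← LoopArr.conj_mul p q e]; exact (p.mul q e).src_conj.symm⟩ =
      𝒢.h.1 ⟨(K.mul p.snd q.snd e1, q.conj.1), (K.tgt_mul _ _ _).trans q.src_conj.symm⟩ := rfl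
    rw [f1] at d2
    rw [f3] at d3
    rw [f4] at d2
    rw [g1, f5.trans g4, g2, g3]
    refine sub_eq_zero.1 (Eq.trans ?_
      ((congrArg₂ (· + ·) (congrArg₂ (· - ·) d1 d2) d3).trans (by simp)))
    abel
  δconn := by
    have key : ∀ f : SMap K.LoopArr K.Arr₂, dlog (smoothUnits.pull f 𝒢.h) =
        Form.pull (K.etale_snd.smap.comp f) 𝒢.A - Form.pull (K.etale_comp.smap.comp f) 𝒢.A +
          Form.pull (K.etale_fst.smap.comp f) 𝒢.A := fun f => by
      rw [dlog_pull, ← 𝒢.δA, map_add, map_sub, Form.pull_pull, Form.pull_pull, Form.pull_pull]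
    have h1 : Form.pull (LoopArr.etale_fst (G := K)).smap (Form.pull (loopIncl K) 𝒢.A) =
        Form.pull (K.etale_fst.smap.comp (pairMap K)) 𝒢.A :=
      (Form.pull_pull _ _ _).trans (Form.pull_congr (fun _ => rfl) _)
    have h2 : Form.pull (LoopArr.etale_conj (G := K)).smap (Form.pull (loopIncl K) 𝒢.A) =
        Form.pull (K.etale_snd.smap.comp (pairConjMap K)) 𝒢.A :=
      (Form.pull_pull _ _ _).trans (Form.pull_congr (fun _ => rfl) _)
    have h3 : Form.pull (K.etale_comp.smap.comp (pairMap K)) 𝒢.A =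
        Form.pull (K.etale_comp.smap.comp (pairConjMap K)) 𝒢.A :=
      Form.pull_congr comp_pairMap_pairConjMap _
    have h4 : Form.pull (K.etale_snd.smap.comp (pairMap K)) 𝒢.A =
        Form.pull (K.etale_fst.smap.comp (pairConjMap K)) 𝒢.A :=
      Form.pull_congr (fun _ => rfl) _
    have h5 : dlog 𝒢.holonomy = _ := map_sub dlog _ _
    have h6 : Form.pull (LoopArr.etale_fst (G := K)).smap (Form.pull (loopIncl K) 𝒢.A) -
        Form.pull (LoopArr.etale_conj (G := K)).smap (Form.pull (loopIncl K) 𝒢.A) =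
          dlog 𝒢.holonomy := by
      rw [h1, h2, h5, key, key, h3, h4]
      abel
    exact h6

/-- The connection of the holonomy line bundle is flat. -/
lemma d_lineBundle_conn : Form.d 𝒢.lineBundle.conn = 0 := by
  have h : Form.d (Form.pull (loopIncl K) 𝒢.A) = 0 := by
    rw [Form.d_pull, ← 𝒢.δB, map_sub, Form.pull_pull, Form.pull_pull, sub_eq_zero]
    -- the source and the target map agree on loops
    exact Form.pull_congr (fun a => a.2) 𝒢.B
  exact h

end GerbeConn

end LineBundle

section CechRestriction

variable {K G : EtaleGroupoid.{u}} (φ : EtaleFunctor K G)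

namespace EtaleFunctor

/-- The map `∧K₀ → K₀`. -/
def over₀ : OverLoop φ.inertia.E₀ φ.E₀ where
  toFun := loopPt
  continuous_toFun := continuous_loopPt
  proj_toFun a := (φ.src_arr (show K.Loop from a).1).symm

/-- The map `∧K₁ → K₁`. -/
def over₁ : OverLoop φ.inertia.E₁ φ.E₁ where
  toFun := under
  continuous_toFun := continuous_under
  proj_toFun p := (congrArg φ.obj (tgt_under p)).trans (φ.src_arr _).symm

/-- The map `∧K₂ → K₂`. -/
def over₂ : OverLoop φ.inertia.E₂ φ.E₂ where
  toFun p := ⟨(under p.1.1, under p.1.2),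
    (tgt_under _).trans ((congrArg loopPt p.2).trans (src_under _).symm)⟩
  continuous_toFun := ((continuous_under.comp
    (EtaleGroupoid.continuous_fst (Holonomy.inertia K))).prodMk (continuous_under.comp
      (Holonomy.inertia K).etale_snd.isLocalHomeomorph.continuous)).subtype_mk _
  proj_toFun p := (congrArg φ.obj (tgt_under p.1.2)).trans (φ.src_arr _).symm

variable {M : GSheaf (Holonomy.inertia G)}

lemma under_one_loop (a : (Holonomy.inertia K).Obj) {x : K.Obj} (h : x = loopPt a) :
    under ((Holonomy.inertia G).one (φ.inertia.obj a)) = G.one (φ.obj x) :=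
  (under_one _).trans (congrArg G.one ((φ.src_arr _).trans (congrArg φ.obj h.symm)))

lemma res_δ₀ (c : Sec φ.E₀ ((push G).obj M)) :
    res φ.over₁ (φ.δ₀ c) = φ.inertia.δ₀ (res φ.over₀ c) := by
  rw [δ₀_apply, δ₀_apply, map_sub]
  refine congrArg₂ (· - ·) (res_pull φ.over₁ φ.over₀ _ _ (fun p => ?_) (fun p => ?_) c)
    (res_pull φ.over₁ φ.over₀ _ _ (fun p => ?_) (fun p => ?_) c)
  · exact (src_under p).symm
  · rfl
  · exact (tgt_under p).symm
  · exact φ.under_one_loop _ (tgt_under p)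

lemma res_δ₁ (c : Sec φ.E₁ ((push G).obj M)) :
    res φ.over₂ (φ.δ₁ c) = φ.inertia.δ₁ (res φ.over₁ c) := by
  rw [δ₁_apply, δ₁_apply, map_add, map_sub]
  refine congrArg₂ (· + ·) (congrArg₂ (· - ·)
    (res_pull φ.over₂ φ.over₁ _ _ (fun p => ?_) (fun p => ?_) c)
    (res_pull φ.over₂ φ.over₁ _ _ (fun p => ?_) (fun p => ?_) c))
    (res_pull φ.over₂ φ.over₁ _ _ (fun p => ?_) (fun p => ?_) c)
  · rfl
  · exact φ.under_one_loop _ (tgt_under p.1.2)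
  · rfl
  · exact φ.under_one_loop _ (tgt_under p.1.2)
  · rfl
  · rfl

/-- The degeneracy `a ↦ (a, a)`. -/
def diag₀ : φ.inertia.E₀ ⟶ φ.inertia.E₁ where
  map := diag
  arr a := (Holonomy.inertia G).one (φ.inertia.obj a)
  continuous_map := continuous_diag
  continuous_arr := (Holonomy.inertia G).continuous_one.comp
    φ.inertia.etale_obj.isLocalHomeomorph.continuous
  src_arr a := ((Holonomy.inertia G).src_one _).trans (congrArg φ.inertia.obj (tgt_diag a).symm)
  tgt_arr _ := (Holonomy.inertia G).tgt_one _

/-- The map `(a, b) ↦ ((a, a), (a, b))`. -/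
def diagLeft : φ.inertia.E₁ ⟶ φ.inertia.E₂ where
  map p := ⟨(diag ((Holonomy.inertia K).src p), p), tgt_diag _⟩
  arr p := (Holonomy.inertia G).one (φ.inertia.obj ((Holonomy.inertia K).tgt p))
  continuous_map := ((continuous_diag.comp
    (Holonomy.inertia K).etale_src.isLocalHomeomorph.continuous).prodMk continuous_id).subtype_mk _
  continuous_arr := (Holonomy.inertia G).continuous_one.comp
    φ.inertia.E₁.etale.isLocalHomeomorph.continuous
  src_arr _ := (Holonomy.inertia G).src_one _
  tgt_arr _ := (Holonomy.inertia G).tgt_one _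

/-- The map `(a, b) ↦ ((a, b), (a', a'))`, where `a' = b⁻¹ab`. -/
def diagRight : φ.inertia.E₁ ⟶ φ.inertia.E₂ where
  map p := ⟨(p, diag ((Holonomy.inertia K).tgt p)), (src_diag _).symm⟩
  arr p := (Holonomy.inertia G).one (φ.inertia.obj ((Holonomy.inertia K).tgt p))
  continuous_map := (continuous_id.prodMk (continuous_diag.comp
    (Holonomy.inertia K).etale_tgt.isLocalHomeomorph.continuous)).subtype_mk _
  continuous_arr := (Holonomy.inertia G).continuous_one.comp
    φ.inertia.E₁.etale.isLocalHomeomorph.continuous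
  src_arr _ := ((Holonomy.inertia G).src_one _).trans (congrArg φ.inertia.obj (tgt_diag _).symm)
  tgt_arr _ := (Holonomy.inertia G).tgt_one _

end EtaleFunctor

variable {Λ : EtaleGroupoid.{u}}

/-- A composite with a morphism given by unit arrows on the right. -/
lemma comp_arr_of_one_right {E E' E'' : EtSp Λ} (f : E ⟶ E') (g : E' ⟶ E'') {e : E} {x : Λ.Obj}
    (h : g.arr (f.map e) = Λ.one x) : (f ≫ g).arr e = f.arr e := by
  have hx : x = Λ.src (f.arr e) := by
    rw [← Λ.tgt_one x, ← h, g.tgt_arr, f.src_arr]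
  exact (mul_congr h rfl).trans (one_mul' ((Λ.tgt_one x).trans hx))

lemma comp_arr_of_one_left {E E' E'' : EtSp Λ} (f : E ⟶ E') (g : E' ⟶ E'') {e : E} {x : Λ.Obj}
    (h : f.arr e = Λ.one x) : (f ≫ g).arr e = g.arr (f.map e) := by
  have hx : Λ.tgt (g.arr (f.map e)) = x := by
    rw [← Λ.src_one x, ← h, g.tgt_arr, f.src_arr]
  exact (mul_congr rfl h).trans (mul_one' (hx.trans (Λ.src_one x).symm))

namespace EtaleFunctor

lemma diag₀_face₁₁ : φ.diag₀ ≫ φ.inertia.face₁₁ = twist _ :=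
  EtSp.hom_ext rfl (funext fun _ => comp_arr_of_one_left _ _ rfl)

lemma diag₀_face₁₀ : φ.diag₀ ≫ φ.inertia.face₁₀ = 𝟙 _ :=
  EtSp.hom_ext (funext tgt_diag) (funext fun _ => comp_arr_of_one_right _ _ rfl)

lemma diagLeft_face₂₀ : φ.diagLeft ≫ φ.inertia.face₂₀ = 𝟙 _ :=
  EtSp.hom_ext rfl (funext fun _ => comp_arr_of_one_right _ _ rfl)

lemma diagLeft_face₂₂ : φ.diagLeft ≫ φ.inertia.face₂₂ = φ.inertia.face₁₁ ≫ φ.diag₀ :=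
  EtSp.hom_ext rfl (funext fun _ => (comp_arr_of_one_left _ _ rfl).trans
    (comp_arr_of_one_right φ.inertia.face₁₁ φ.diag₀ rfl).symm)

lemma diagRight_face₂₀ : φ.diagRight ≫ φ.inertia.face₂₀ = φ.inertia.face₁₀ ≫ φ.diag₀ :=
  EtSp.hom_ext rfl (funext fun _ => (comp_arr_of_one_right _ _ rfl).trans
    (comp_arr_of_one_right φ.inertia.face₁₀ φ.diag₀ rfl).symm)

lemma diagRight_face₂₂ : φ.diagRight ≫ φ.inertia.face₂₂ = twist _ :=
  EtSp.hom_ext rfl (funext fun _ => comp_arr_of_one_left _ _ rfl)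

lemma diagLeft_face₂₁ :
    φ.diagLeft ≫ φ.inertia.face₂₁ = φ.diagRight ≫ φ.inertia.face₂₁ :=
  EtSp.hom_ext (funext fun p => LoopArr.ext rfl (show K.LoopArr from p).mul_conj.symm)
    (funext fun _ => (comp_arr_of_one_right _ _ rfl).trans
      (comp_arr_of_one_right φ.diagRight φ.inertia.face₂₁ rfl).symm)

/-- The twist acts on the sections over `∧K₀` as `1` plus the Čech differential, followed by the
pull-back along `a ↦ (a, a)`. -/
lemma pull_diag₀_δ₀ (c : Sec φ.inertia.E₀ M) :
    Sec.pull φ.diag₀ (φ.inertia.δ₀ c) = Sec.map (F := M) (F' := M) ((Θ G).app M) c - c := by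
  rw [δ₀_apply, map_sub, Sec.pull_pull, Sec.pull_pull, diag₀_face₁₁, diag₀_face₁₀]
  exact congrArg₂ (· - ·) (Sec.map_Θ c).symm
    (Sec.ext fun U j => congrArg (c.val U) (Category.comp_id j))

/-- On sections over `∧K₁`, the pull-backs along the maps which insert `(a, a)` form a homotopy
between the twist and the identity. -/
lemma pull_diag_δ₁ (c : Sec φ.inertia.E₁ M) :
    Sec.pull φ.diagLeft (φ.inertia.δ₁ c) - Sec.pull φ.diagRight (φ.inertia.δ₁ c) =
      c - Sec.map (F := M) (F' := M) ((Θ G).app M) c + φ.inertia.δ₀ (Sec.pull φ.diag₀ c) := by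
  have h : Sec.pull (𝟙 φ.inertia.E₁) c = c :=
    Sec.ext fun U j => congrArg (c.val U) (Category.comp_id j)
  have h' : Sec.map (F := M) (F' := M) ((Θ G).app M) c = Sec.pull (twist _) c := Sec.map_Θ c
  simp only [δ₁_apply, δ₀_apply, map_sub, map_add, Sec.pull_pull, diagLeft_face₂₀, diagLeft_face₂₁,
    diagLeft_face₂₂, diagRight_face₂₀, diagRight_face₂₂, h', h]
  abel

/-- The insertion of `(a, a)` before and after `(a, b)` takes `h`, restricted to `∧K`, to
`h(a, b) / h(b, b⁻¹ab)`, since the arrows of `∧K` underlying `(a, a)` and `(a, b)` are `a` and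
`b`. -/
lemma res_over_units (h : smoothUnits φ.E₂) :
    Sec.pull φ.diagLeft (res φ.over₂ (Sec.map (restrictUnits G) (Sec.ofUnits h))) -
      Sec.pull φ.diagRight (res φ.over₂ (Sec.map (restrictUnits G) (Sec.ofUnits h))) =
    Sec.ofUnits (E := φ.inertia.E₁) (smoothUnits.pull (pairMap K) h -
      smoothUnits.pull (pairConjMap K) h) := by
  rw [res_restrictUnits, Sec.pull_ofUnits, Sec.pull_ofUnits, ← map_sub]
  rfl

/-- The pull-back along `a ↦ (a, a)` takes `A`, restricted to `∧K`, to the form `A|_{∧K₀}`. -/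
lemma res_over_forms (α : Form 1 φ.E₁) :
    Sec.pull φ.diag₀ (res φ.over₁ (Sec.map (restrictForms G 1) (Sec.ofForm α))) =
    Sec.ofForm (E := φ.inertia.E₀) (Form.pull (loopIncl K) α) := by
  rw [res_restrictForms, Sec.pull_ofForm]
  exact congrArg Sec.ofForm ((Form.pull_pull _ _ _).trans (Form.pull_congr (fun _ => rfl) _))

end EtaleFunctor

end CechRestriction

/-! ### The holonomy homomorphism -/

section Homotopies

variable {Λ : EtaleGroupoid.{u}} {A B : CochainComplex (GSheaf Λ) ℕ} {f g : A ⟶ B}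

lemma Sec.map_f_zero_of_homotopy (h : Homotopy f g) {E : EtSp Λ} (c : Sec E (A.X 0)) :
    Sec.map (f.f 0) c = Sec.map (h.hom 1 0) (Sec.map (A.d 0 1) c) + Sec.map (g.f 0) c := by
  have h1 := h.comm 0
  rw [Homotopy.dNext_cochainComplex, Homotopy.prevD_zero_cochainComplex, add_zero] at h1
  rw [h1]
  rfl

lemma Sec.map_f_succ_of_homotopy (h : Homotopy f g) (n : ℕ) {E : EtSp Λ}
    (c : Sec E (A.X (n + 1))) :
    Sec.map (f.f (n + 1)) c = Sec.map (h.hom (n + 2) (n + 1)) (Sec.map (A.d (n + 1) (n + 2)) c) +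
      Sec.map (B.d n (n + 1)) (Sec.map (h.hom (n + 1) n) c) + Sec.map (g.f (n + 1)) c := by
  have h1 := h.comm (n + 1)
  rw [Homotopy.dNext_cochainComplex, Homotopy.prevD_succ_cochainComplex] at h1
  rw [h1]
  rfl

/-- The map on invariant sections given by a morphism of sheaves. -/
noncomputable abbrev Γmap {F F' : GSheaf Λ} (f : F ⟶ F') : invSections Λ F →+ invSections Λ F' :=
  ((Γinv Λ).map f).hom

lemma Γmap_f_succ_of_homotopy (h : Homotopy f g) (n : ℕ) (σ : invSections Λ (A.X (n + 1))) :
    Γmap (f.f (n + 1)) σ = Γmap (h.hom (n + 2) (n + 1)) (Γmap (A.d (n + 1) (n + 2)) σ) +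
      Γmap (B.d n (n + 1)) (Γmap (h.hom (n + 1) n) σ) + Γmap (g.f (n + 1)) σ := by
  have h1 := h.comm (n + 1)
  rw [Homotopy.dNext_cochainComplex, Homotopy.prevD_succ_cochainComplex] at h1
  rw [h1]
  rfl

lemma Γmap_f_Γmap_d (f : A ⟶ B) (i j : ℕ) (σ : invSections Λ (A.X i)) :
    Γmap (B.d i j) (Γmap (f.f i) σ) = Γmap (f.f j) (Γmap (A.d i j) σ) :=
  congrArg (fun k => Γmap k σ) (f.comm i j)

end Homotopies

section HolonomyData

/-- The truncation `ℂ^×(3) → ℂ^×(2)`. -/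
noncomputable def truncCx (Λ : EtaleGroupoid.{u}) : Cx Λ 3 ⟶ Cx Λ 2 where
  f
    | 0 => 𝟙 (unitsSheaf Λ)
    | 1 => 𝟙 (formSheaf Λ 1)
    | _ + 2 => 0
  comm' := by
    rintro i _ (rfl : _ = _)
    match i with
    | 0 =>
      rw [Cx_d Λ 3 0, Cx_d Λ 2 0]
      exact (Category.id_comp (dlogSheaf Λ)).trans (Category.comp_id (dlogSheaf Λ)).symm
    | n + 1 => exact (isZero_zero (GSheaf Λ)).eq_of_tgt _ _

/-- The resolutions, morphisms of complexes and homotopies which compute the holonomy. The chosen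
injective resolution of `ℂ^×(3)` on `∧G` need not be a monomorphism, so another one, `m`, is used for
the homotopy `H` to vanish on `ℂ^×(3)`. -/
structure HolonomyData (G : EtaleGroupoid.{u}) where
  /-- A resolution of `ℂ^×(3)` on `∧G`. -/
  M : CochainComplex (GSheaf (inertia G)) ℕ
  /-- The inclusion of `ℂ^×(3)`. -/
  m : Cx (inertia G) 3 ⟶ M
  quasiIso_m : QuasiIso m
  /-- A homotopy from the twist to the identity, relative to `ℂ^×(3)`. -/
  H : Homotopy (ΘC M) (𝟙 M)
  m_H : ∀ i j, m.f i ≫ H.hom i j = 0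
  /-- The restriction along `β : ∧G → G`, on resolutions. -/
  R : injRes (Cx G 3) ⟶ pushC M
  /-- The compatibility of `R` with the restriction of functions and forms. -/
  k : Homotopy (injResι (Cx G 3) ≫ R)
    (restrictCx G ≫ ((push G).mapHomologicalComplex (ComplexShape.up ℕ)).map m)
  /-- The truncation `ℂ^×(3) → ℂ^×(2)`, on resolutions. -/
  S : M ⟶ injRes (Cx (inertia G) 2)
  /-- The compatibility of `S` with the truncation. -/
  l : Homotopy (m ≫ S) (truncCx (inertia G) ≫ injResι (Cx (inertia G) 2))

/-- The homotopy `H` exists since `Θ` is natural, and the identity on `ℂ^×(3)`. -/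
lemma nonempty_holonomyData (G : EtaleGroupoid.{u}) : Nonempty (HolonomyData G) := by
  obtain ⟨M, m, hm, hm', hM⟩ := exists_mono_injectiveResolution (Cx (inertia G) 3)
  have h1 : m ≫ (ΘC M - 𝟙 M) = 0 := by
    rw [Preadditive.comp_sub, ΘC_naturality, ΘC_Cx_three, Category.id_comp, Category.comp_id,
      sub_self]
  obtain ⟨H, hH⟩ := exists_relative_homotopy m hm hm' hM _ h1
  obtain ⟨R, ⟨k⟩⟩ := exists_lift (injResι (Cx G 3)) (quasiIso_injResι _)
    (restrictCx G ≫ ((push G).mapHomologicalComplex (ComplexShape.up ℕ)).map m)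
    (fun n => injective_push _ (hM n))
  obtain ⟨S, ⟨l⟩⟩ := exists_lift m hm (truncCx (inertia G) ≫ injResι (Cx (inertia G) 2))
    (injective_injRes _)
  refine ⟨⟨M, m, hm, (Homotopy.equivSubZero).symm H, fun i j => ?_, R, k, S, l⟩⟩
  exact hH i j

namespace HolonomyData

variable {G : EtaleGroupoid.{u}} (D : HolonomyData G)

/-- The components of `R`. -/
noncomputable def Rf (n : ℕ) : (injRes (Cx G 3)).X n ⟶ (push G).obj (D.M.X n) := D.R.f n

/-- The operator on invariant sections which represents the holonomy: the restriction to `∧G`,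
followed by `-H` and the truncation. -/
noncomputable def op (n : ℕ) : invSections G ((injRes (Cx G 3)).X (n + 1)) →+
    invSections (inertia G) ((injRes (Cx (inertia G) 2)).X n) :=
  -((Γmap (D.S.f n)).comp ((Γmap (D.H.hom (n + 1) n)).comp
    ((transfer (D.M.X (n + 1))).comp (Γmap (D.Rf (n + 1))))))

/-- On invariant sections, `H` anticommutes with the differential. -/
lemma Γmap_d_H (n : ℕ) (σ : invSections (inertia G) (D.M.X (n + 1))) :
    Γmap (D.M.d n (n + 1)) (Γmap (D.H.hom (n + 1) n) σ) =
      -Γmap (D.H.hom (n + 2) (n + 1)) (Γmap (D.M.d (n + 1) (n + 2)) σ) := by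
  have h1 := Γmap_f_succ_of_homotopy D.H n σ
  have h2 : Γmap ((ΘC D.M).f (n + 1)) σ = σ := Γinv_map_Θ _ σ
  have h3 : Γmap ((𝟙 D.M : D.M ⟶ D.M).f (n + 1)) σ = σ := rfl
  rw [h2, h3, right_eq_add] at h1
  exact eq_neg_of_add_eq_zero_right h1

lemma Γmap_d_transfer (n : ℕ) (σ : invSections G ((injRes (Cx G 3)).X n)) :
    Γmap (D.M.d n (n + 1)) (transfer (D.M.X n) (Γmap (D.Rf n) σ)) =
      transfer (D.M.X (n + 1)) (Γmap (D.Rf (n + 1)) (Γmap ((injRes (Cx G 3)).d n (n + 1)) σ)) :=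
  (Γinv_map_transfer (D.M.d n (n + 1)) (Γmap (D.Rf n) σ)).trans
    (congrArg (transfer (D.M.X (n + 1))) (Γmap_f_Γmap_d D.R n (n + 1) σ))

lemma Γmap_d_op (n : ℕ) (σ : invSections G ((injRes (Cx G 3)).X (n + 1))) :
    Γmap ((injRes (Cx (inertia G) 2)).d n (n + 1)) (D.op n σ) =
      -D.op (n + 1) (Γmap ((injRes (Cx G 3)).d (n + 1) (n + 2)) σ) := by
  let y := transfer (D.M.X (n + 1)) (Γmap (D.Rf (n + 1)) σ)
  have h1 : Γmap ((injRes (Cx (inertia G) 2)).d n (n + 1))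
      (Γmap (D.S.f n) (Γmap (D.H.hom (n + 1) n) y)) =
        -Γmap (D.S.f (n + 1)) (Γmap (D.H.hom (n + 2) (n + 1)) (Γmap (D.M.d (n + 1) (n + 2)) y)) :=
    (Γmap_f_Γmap_d D.S n (n + 1) _).trans
      ((congrArg (Γmap (D.S.f (n + 1))) (D.Γmap_d_H n y)).trans (map_neg _ _))
  have h2 : Γmap (D.M.d (n + 1) (n + 2)) y = transfer (D.M.X (n + 2)) (Γmap (D.Rf (n + 2))
      (Γmap ((injRes (Cx G 3)).d (n + 1) (n + 2)) σ)) := D.Γmap_d_transfer (n + 1) σ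
  rw [h2] at h1
  exact (map_neg (Γmap ((injRes (Cx (inertia G) 2)).d n (n + 1))) _).trans (congrArg Neg.neg h1)

/-- The operator `op` induces a homomorphism in cohomology. -/
lemma exists_holo : ∃ F : HH 2 (Cx G 3) →+ HH 1 (Cx (inertia G) 2),
    ∀ (z : (ΓinvComplex G (injRes (Cx G 3))).cycles 2)
      (z' : (ΓinvComplex (inertia G) (injRes (Cx (inertia G) 2))).cycles 1),
      cocycleInv z' = D.op 1 (cocycleInv z) →
        F (((ΓinvComplex G (injRes (Cx G 3))).homologyπ 2).hom z) =
          ((ΓinvComplex (inertia G) (injRes (Cx (inertia G) 2))).homologyπ 1).hom z' := by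
  refine exists_homology_hom (ΓinvComplex G (injRes (Cx G 3)))
    (ΓinvComplex (inertia G) (injRes (Cx (inertia G) 2))) 0 (D.op 1) (fun x hx => ?_)
    fun (y : invSections G ((injRes (Cx G 3)).X 1)) => ⟨-D.op 0 y, ?_⟩
  · exact (D.Γmap_d_op 1 x).trans ((congrArg (fun s => -D.op 2 s) hx).trans
      ((congrArg _ (map_zero (D.op 2))).trans neg_zero))
  · exact (map_neg (Γmap ((injRes (Cx (inertia G) 2)).d 0 1)) (D.op 0 y)).trans
      ((congrArg _ (D.Γmap_d_op 0 y)).trans (neg_neg _))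

lemma ofInv_op (E : EtSp (inertia G)) (n : ℕ)
    (σ : invSections G ((injRes (Cx G 3)).X (n + 1))) :
    Sec.ofInv E (D.op n σ) = -Sec.map (D.S.f n) (Sec.map (D.H.hom (n + 1) n)
      (Sec.ofInv E (transfer (D.M.X (n + 1)) (Γmap (D.Rf (n + 1)) σ)))) := by
  let y := transfer (D.M.X (n + 1)) (Γmap (D.Rf (n + 1)) σ)
  have h : Sec.map (D.S.f n) (Sec.map (D.H.hom (n + 1) n) (Sec.ofInv E y)) =
      Sec.ofInv E (Γmap (D.S.f n) (Γmap (D.H.hom (n + 1) n) y)) :=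
    (congrArg (Sec.map (D.S.f n)) (Sec.map_ofInv _ y)).trans (Sec.map_ofInv _ _)
  exact (map_neg (Sec.ofInv E) _).trans (congrArg Neg.neg h.symm)

variable {K : EtaleGroupoid.{u}} {φ : EtaleFunctor K G}

lemma map_H_map_m (i j : ℕ) {E : EtSp (inertia G)} (c : Sec E ((Cx (inertia G) 3).X i)) :
    Sec.map (D.H.hom i j) (Sec.map (D.m.f i) c) = 0 := by
  rw [Sec.map_map, D.m_H]
  rfl

/-- A cochain which relates a cocycle `(h, A, B)` on `K` to an invariant section `t` restricts to
one which relates their restrictions to `∧K` and `∧G`, in the resolution `M`. -/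
lemma exists_restricted_cochain {h : Sec φ.E₂ ((Cx G 3).X 0)} {A : Sec φ.E₁ ((Cx G 3).X 1)}
    {B : Sec φ.E₀ ((Cx G 3).X 2)} (hh : Sec.map ((Cx G 3).d 0 1) h = φ.δ₁ A)
    (hA : Sec.map ((Cx G 3).d 1 2) A = φ.δ₀ B) {t : invSections G ((injRes (Cx G 3)).X 2)}
    {c₁ : Sec φ.E₁ ((injRes (Cx G 3)).X 0)} {c₀ : Sec φ.E₀ ((injRes (Cx G 3)).X 1)}
    (e₀ : Sec.map ((injResι (Cx G 3)).f 0) h = φ.δ₁ c₁)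
    (e₁ : Sec.map ((injResι (Cx G 3)).f 1) A =
      Sec.map ((injRes (Cx G 3)).d 0 1) c₁ + φ.δ₀ c₀)
    (e₂ : Sec.map ((injResι (Cx G 3)).f 2) B =
      Sec.ofInv _ t + Sec.map ((injRes (Cx G 3)).d 1 2) c₀) :
    ∃ (c₁' : Sec φ.inertia.E₁ (D.M.X 0)) (c₀' : Sec φ.inertia.E₀ (D.M.X 1)),
      Sec.map (D.m.f 0) (res φ.over₂ (Sec.map ((restrictCx G).f 0) h)) = φ.inertia.δ₁ c₁' ∧
      Sec.map (D.m.f 1) (res φ.over₁ (Sec.map ((restrictCx G).f 1) A)) =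
        Sec.map (D.M.d 0 1) c₁' + φ.inertia.δ₀ c₀' ∧
      Sec.map (D.m.f 2) (res φ.over₀ (Sec.map ((restrictCx G).f 2) B)) =
        Sec.ofInv _ (transfer (D.M.X 2) (Γmap (D.Rf 2) t)) + Sec.map (D.M.d 1 2) c₀' := by
  let k₁ : (Cx G 3).X 1 ⟶ (push G).obj (D.M.X 0) := D.k.hom 1 0
  let k₂ : (Cx G 3).X 2 ⟶ (push G).obj (D.M.X 1) := D.k.hom 2 1
  let k₃ : (Cx G 3).X 3 ⟶ (push G).obj (D.M.X 2) := D.k.hom 3 2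
  let r : ∀ n, (Cx G 3).X n ⟶ (push G).obj ((Cx (inertia G) 3).X n) := fun n => (restrictCx G).f n
  let d₁ : Sec φ.E₁ ((push G).obj (D.M.X 0)) := Sec.map (D.Rf 0) c₁ - Sec.map k₁ A
  let d₀ : Sec φ.E₀ ((push G).obj (D.M.X 1)) := Sec.map (D.Rf 1) c₀ - Sec.map k₂ B
  have hRd : ∀ (n : ℕ) {E : EtSp G} (c : Sec E ((injRes (Cx G 3)).X n)),
      Sec.map (D.Rf (n + 1)) (Sec.map ((injRes (Cx G 3)).d n (n + 1)) c) =
        Sec.map ((push G).map (D.M.d n (n + 1))) (Sec.map (D.Rf n) c) := fun n E c =>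
    (Sec.map_f_map_d D.R n (n + 1) c).symm
  have f₀ : Sec.map ((push G).map (D.m.f 0)) (Sec.map (r 0) h) = φ.δ₁ d₁ := by
    have h1 : Sec.map (D.Rf 0) (Sec.map ((injResι (Cx G 3)).f 0) h) =
      Sec.map k₁ (Sec.map ((Cx G 3).d 0 1) h) +
        Sec.map ((push G).map (D.m.f 0)) (Sec.map (r 0) h) := Sec.map_f_zero_of_homotopy D.k h
    rw [e₀, hh, φ.map_δ₁, φ.map_δ₁] at h1
    rw [map_sub, h1]
    abel
  have f₁ : Sec.map ((push G).map (D.m.f 1)) (Sec.map (r 1) A) =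
      Sec.map ((push G).map (D.M.d 0 1)) d₁ + φ.δ₀ d₀ := by
    have h1 : Sec.map (D.Rf 1) (Sec.map ((injResι (Cx G 3)).f 1) A) =
      Sec.map k₂ (Sec.map ((Cx G 3).d 1 2) A) +
        Sec.map ((push G).map (D.M.d 0 1)) (Sec.map k₁ A) +
        Sec.map ((push G).map (D.m.f 1)) (Sec.map (r 1) A) := Sec.map_f_succ_of_homotopy D.k 0 A
    rw [e₁, hA, map_add, hRd, φ.map_δ₀, φ.map_δ₀] at h1
    rw [map_sub, map_sub, ← sub_eq_iff_eq_add'.2 h1]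
    abel
  have f₂ : Sec.map ((push G).map (D.m.f 2)) (Sec.map (r 2) B) =
      Sec.ofInv _ (Γmap (D.Rf 2) t) + Sec.map ((push G).map (D.M.d 1 2)) d₀ := by
    have h1 : Sec.map (D.Rf 2) (Sec.map ((injResι (Cx G 3)).f 2) B) =
      Sec.map k₃ (Sec.map ((Cx G 3).d 2 3) B) +
        Sec.map ((push G).map (D.M.d 1 2)) (Sec.map k₂ B) +
        Sec.map ((push G).map (D.m.f 2)) (Sec.map (r 2) B) := Sec.map_f_succ_of_homotopy D.k 1 B
    have h2 : Sec.map ((Cx G 3).d 2 3) B = 0 := by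
      rw [(isZero_zero (GSheaf G)).eq_of_tgt ((Cx G 3).d 2 3) 0]
      rfl
    have h3 : Sec.map (D.Rf 2) (Sec.ofInv φ.E₀ t) = Sec.ofInv _ (Γmap (D.Rf 2) t) :=
      Sec.map_ofInv _ _
    rw [e₂, h2, map_zero, zero_add, map_add, hRd, h3] at h1
    rw [map_sub, ← sub_eq_iff_eq_add'.2 h1]
    abel
  refine ⟨res φ.over₁ d₁, res φ.over₀ d₀, ?_, ?_, ?_⟩
  · exact (map_res φ.over₂ (D.m.f 0) (Sec.map (r 0) h)).trans
      ((congrArg (res φ.over₂) f₀).trans (φ.res_δ₁ d₁))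
  · refine (map_res φ.over₁ (D.m.f 1) (Sec.map (r 1) A)).trans ((congrArg (res φ.over₁) f₁).trans ?_)
    rw [map_add, φ.res_δ₀, map_res]
  · refine (map_res φ.over₀ (D.m.f 2) (Sec.map (r 2) B)).trans ((congrArg (res φ.over₀) f₂).trans ?_)
    rw [map_add, map_res]
    exact congrArg (· + _) (res_ofInv φ.over₀ (Γmap (D.Rf 2) t))

/-- In the double complex of `∧K` with coefficients in `M`, the insertion of `(a, a)` is a homotopy
from the twist to the identity, and so is `H`. As `H` vanishes on the image of `m`, their difference
takes a cochain which relates `(h, A, B)` to `t` to one which relates their images, of degree one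
less. -/
lemma exists_looped_cochain {h : Sec φ.inertia.E₂ ((Cx (inertia G) 3).X 0)}
    {A : Sec φ.inertia.E₁ ((Cx (inertia G) 3).X 1)} {B : Sec φ.inertia.E₀ ((Cx (inertia G) 3).X 2)}
    {t : invSections (inertia G) (D.M.X 2)} {c₁ : Sec φ.inertia.E₁ (D.M.X 0)}
    {c₀ : Sec φ.inertia.E₀ (D.M.X 1)} (e₀ : Sec.map (D.m.f 0) h = φ.inertia.δ₁ c₁)
    (e₁ : Sec.map (D.m.f 1) A = Sec.map (D.M.d 0 1) c₁ + φ.inertia.δ₀ c₀)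
    (e₂ : Sec.map (D.m.f 2) B = Sec.ofInv _ t + Sec.map (D.M.d 1 2) c₀) :
    ∃ c : Sec φ.inertia.E₀ (D.M.X 0),
      Sec.map (D.m.f 0) (Sec.pull φ.diagLeft h - Sec.pull φ.diagRight h) = φ.inertia.δ₀ c ∧
      Sec.map (D.m.f 1) (Sec.pull φ.diag₀ A) =
        -Sec.map (D.H.hom 2 1) (Sec.ofInv _ t) + Sec.map (D.M.d 0 1) c := by
  refine ⟨Sec.map (D.H.hom 1 0) c₀ + Sec.pull φ.diag₀ c₁, ?_, ?_⟩
  · have h1 : Sec.map (F := D.M.X 0) (F' := D.M.X 0) ((Θ G).app (D.M.X 0)) c₁ =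
        Sec.map (D.H.hom 1 0) (Sec.map (D.M.d 0 1) c₁) + c₁ := Sec.map_f_zero_of_homotopy D.H c₁
    have h2 := D.map_H_map_m 1 0 A
    rw [e₁, map_add, φ.inertia.map_δ₀] at h2
    rw [map_sub, Sec.map_pull, Sec.map_pull, e₀, φ.pull_diag_δ₁, h1, map_add,
      eq_neg_of_add_eq_zero_left h2]
    abel
  · have h1 : Sec.map (F := D.M.X 1) (F' := D.M.X 1) ((Θ G).app (D.M.X 1)) c₀ =
        Sec.map (D.H.hom 2 1) (Sec.map (D.M.d 1 2) c₀) +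
          Sec.map (D.M.d 0 1) (Sec.map (D.H.hom 1 0) c₀) + c₀ :=
      Sec.map_f_succ_of_homotopy D.H 0 c₀
    have h2 := D.map_H_map_m 2 1 B
    rw [e₂, map_add] at h2
    rw [Sec.map_pull, e₁, map_add, ← Sec.map_pull, φ.pull_diag₀_δ₀, h1, map_add,
      eq_neg_of_add_eq_zero_right h2]
    abel

/-- The passage from the resolution of `ℂ^×(3)` to that of `ℂ^×(2)`. -/
lemma exists_truncated_cochain {ρ : Sec φ.inertia.E₁ ((Cx (inertia G) 3).X 0)}
    {A : Sec φ.inertia.E₀ ((Cx (inertia G) 3).X 1)}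
    (hρ : Sec.map ((Cx (inertia G) 3).d 0 1) ρ = φ.inertia.δ₀ A)
    (hA : Sec.map ((Cx (inertia G) 3).d 1 2) A = 0) {s : Sec φ.inertia.E₀ (D.M.X 1)}
    {c : Sec φ.inertia.E₀ (D.M.X 0)} (e₀ : Sec.map (D.m.f 0) ρ = φ.inertia.δ₀ c)
    (e₁ : Sec.map (D.m.f 1) A = s + Sec.map (D.M.d 0 1) c) :
    ∃ c' : Sec φ.inertia.E₀ ((injRes (Cx (inertia G) 2)).X 0),
      Sec.map ((injResι (Cx (inertia G) 2)).f 0) (Sec.map ((truncCx (inertia G)).f 0) ρ) =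
        φ.inertia.δ₀ c' ∧
      Sec.map ((injResι (Cx (inertia G) 2)).f 1) (Sec.map ((truncCx (inertia G)).f 1) A) =
        Sec.map (D.S.f 1) s + Sec.map ((injRes (Cx (inertia G) 2)).d 0 1) c' := by
  refine ⟨Sec.map (D.S.f 0) c - Sec.map (D.l.hom 1 0) A, ?_, ?_⟩
  · have h1 : Sec.map (D.S.f 0) (Sec.map (D.m.f 0) ρ) =
        Sec.map (D.l.hom 1 0) (Sec.map ((Cx (inertia G) 3).d 0 1) ρ) +
          Sec.map ((injResι (Cx (inertia G) 2)).f 0) (Sec.map ((truncCx (inertia G)).f 0) ρ) :=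
      Sec.map_f_zero_of_homotopy D.l ρ
    rw [e₀, hρ, φ.inertia.map_δ₀, φ.inertia.map_δ₀] at h1
    rw [map_sub, h1]
    abel
  · have h1 : Sec.map (D.S.f 1) (Sec.map (D.m.f 1) A) =
        Sec.map (D.l.hom 2 1) (Sec.map ((Cx (inertia G) 3).d 1 2) A) +
          Sec.map ((injRes (Cx (inertia G) 2)).d 0 1) (Sec.map (D.l.hom 1 0) A) +
          Sec.map ((injResι (Cx (inertia G) 2)).f 1) (Sec.map ((truncCx (inertia G)).f 1) A) :=
      Sec.map_f_succ_of_homotopy D.l 0 A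
    rw [e₁, hA, map_zero, zero_add, map_add, ← Sec.map_f_map_d] at h1
    rw [map_sub, ← sub_eq_iff_eq_add'.2 h1]
    abel

end HolonomyData

end HolonomyData

/-! ### The curvature of the holonomy, and the holonomy of a gerbe -/

section Curvature

/-- The identity of `𝒜²` is a homotopy from the curvature `ℂ^×(3) → 𝒜²[-1]` to `0`. -/
noncomputable def curvatureHomotopy (Λ : EtaleGroupoid.{u}) :
    Homotopy (truncCx Λ ≫ curvComplex Λ) 0 where
  hom
    | 2, 1 => show formSheaf Λ 2 ⟶ _ from
      (HomologicalComplex.singleObjXSelf (ComplexShape.up ℕ) 1 (formSheaf Λ 2)).inv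
    | _, _ => 0
  zero i j h := by
    match i, j, h with
    | 2, 1, h => exact absurd rfl h
    | 0, _, _ => rfl
    | 1, _, _ => rfl
    | 2, 0, _ => rfl
    | 2, _ + 2, _ => rfl
    | _ + 3, _, _ => rfl
  comm i := by
    by_cases hi : i = 1
    · subst hi
      rw [Homotopy.dNext_cochainComplex, Homotopy.prevD_succ_cochainComplex, Cx_d Λ 3 1]
      refine Eq.trans ?_ (add_zero _).symm
      refine Eq.trans ?_ ((congrArg (_ + ·) zero_comp).trans (add_zero _)).symm
      refine (Category.id_comp _).trans ?_
      exact HomologicalComplex.mkHomToSingle_f _ _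
    · exact (HomologicalComplex.isZero_single_obj_X (ComplexShape.up ℕ) 1 _ i hi).eq_of_tgt _ _

end Curvature

namespace HolonomyData

variable {G : EtaleGroupoid.{u}} (D : HolonomyData G)

/-- The holonomy homomorphism, induced by the operator `op`. -/
noncomputable def holo : HH 2 (Cx G 3) →+ HH 1 (Cx (inertia G) 2) := D.exists_holo.choose

lemma holo_homologyπ (z : (ΓinvComplex G (injRes (Cx G 3))).cycles 2)
    (z' : (ΓinvComplex (inertia G) (injRes (Cx (inertia G) 2))).cycles 1)
    (h : cocycleInv z' = D.op 1 (cocycleInv z)) :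
    D.holo (((ΓinvComplex G (injRes (Cx G 3))).homologyπ 2).hom z) =
      ((ΓinvComplex (inertia G) (injRes (Cx (inertia G) 2))).homologyπ 1).hom z' :=
  D.exists_holo.choose_spec z z' h

lemma exists_cocycle_op (z : (ΓinvComplex G (injRes (Cx G 3))).cycles 2) :
    ∃ z' : (ΓinvComplex (inertia G) (injRes (Cx (inertia G) 2))).cycles 1,
      cocycleInv z' = D.op 1 (cocycleInv z) := by
  refine exists_cycle (ΓinvComplex (inertia G) (injRes (Cx (inertia G) 2))) _ ?_
  refine (D.Γmap_d_op 1 (cocycleInv z)).trans ?_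
  exact (congrArg (fun s => -D.op 2 s) (d_iCycles (ΓinvComplex G (injRes (Cx G 3))) 2 z)).trans
      ((congrArg _ (map_zero (D.op 2))).trans neg_zero)

/-- The lift of the curvature to the resolutions. -/
noncomputable abbrev curvLift (Λ : EtaleGroupoid.{u}) :=
  injLift (curvComplex Λ ≫ injResι _) (injective_injRes
    ((HomologicalComplex.single (GSheaf Λ) (ComplexShape.up ℕ) 1).obj (formSheaf Λ 2)))

lemma nullHomotopic_S_curvLift : Nonempty (Homotopy (D.S ≫ curvLift (inertia G)) 0) := by
  obtain ⟨hκ⟩ := homotopy_injLift (curvComplex (inertia G) ≫ injResι _) (injective_injRes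
    ((HomologicalComplex.single (GSheaf (inertia G)) (ComplexShape.up ℕ) 1).obj
      (formSheaf (inertia G) 2)))
  refine nullHomotopic_of_quasiIso_comp D.m D.quasiIso_m (injective_injRes _) _ ?_
  refine (Homotopy.ofEq (Category.assoc _ _ _).symm).trans ((D.l.compRight _).trans ?_)
  refine (Homotopy.ofEq (Category.assoc _ _ _)).trans ((hκ.compLeft _).trans ?_)
  refine (Homotopy.ofEq (Category.assoc _ _ _).symm).trans ?_
  exact ((curvatureHomotopy (inertia G)).compRight _).trans (Homotopy.ofEq zero_comp)

/-- The holonomy classes are flat. -/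
lemma curvature_holo (x : HH 2 (Cx G 3)) : HH.map 1 (curvComplex (inertia G)) (D.holo x) = 0 := by
  obtain ⟨z, rfl⟩ := homologyπ_surjective (ΓinvComplex G (injRes (Cx G 3))) 2 x
  obtain ⟨z', hz'⟩ := D.exists_cocycle_op z
  refine (congrArg _ (D.holo_homologyπ z z' hz')).trans ?_
  obtain ⟨N⟩ := D.nullHomotopic_S_curvLift
  let J := injRes ((HomologicalComplex.single (GSheaf (inertia G)) (ComplexShape.up ℕ) 1).obj
    (formSheaf (inertia G) 2))
  let y : invSections (inertia G) (D.M.X 2) :=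
    transfer (D.M.X 2) (Γmap (D.Rf 2) (cocycleInv z))
  have hy : Γmap (D.M.d 2 3) y = 0 := by
    refine (D.Γmap_d_transfer 2 (cocycleInv z)).trans ?_
    refine (congrArg (fun s => transfer (D.M.X 3) (Γmap (D.Rf 3) s))
      (d_iCycles (ΓinvComplex G (injRes (Cx G 3))) 2 z)).trans ?_
    exact (congrArg (transfer (D.M.X 3)) (map_zero (Γmap (D.Rf 3)))).trans (map_zero _)
  have hu : Γmap (D.M.d 1 2) (Γmap (D.H.hom 2 1) y) = 0 := by
    refine (D.Γmap_d_H 1 y).trans ?_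
    rw [hy]
    exact (congrArg Neg.neg (map_zero (Γmap (D.H.hom 3 2)))).trans neg_zero
  have h1 : Γmap ((curvLift (inertia G)).f 1) (Γmap (D.S.f 1) (Γmap (D.H.hom 2 1) y)) =
      Γmap (J.d 0 1) (Γmap (N.hom 1 0) (Γmap (D.H.hom 2 1) y)) := by
    refine (Γmap_f_succ_of_homotopy N 0 (Γmap (D.H.hom 2 1) y)).trans ?_
    refine (add_zero _).trans ?_
    refine (congrArg (· + _) ?_).trans (zero_add _)
    exact (congrArg (Γmap (N.hom 2 1)) hu).trans (map_zero _)
  obtain ⟨z'', hz''⟩ := exists_cycle (ΓinvComplex (inertia G) J) (n := 1)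
    (Γmap ((curvLift (inertia G)).f 1) (cocycleInv z')) (by
      refine (Γmap_f_Γmap_d (curvLift (inertia G)) 1 2 (cocycleInv z')).trans ?_
      exact (congrArg (Γmap ((curvLift (inertia G)).f 2)) (d_iCycles _ 1 z')).trans (map_zero _))
  refine (homologyMap_homologyπ _ 1 z' z'' hz'').trans ?_
  refine (homologyπ_eq_zero_iff (ΓinvComplex (inertia G) J) 0 z'').2
    ⟨-Γmap (N.hom 1 0) (Γmap (D.H.hom 2 1) y), ?_⟩
  refine (map_neg (Γmap (J.d 0 1)) _).trans ?_
  refine Eq.trans ?_ hz''.symm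
  refine Eq.trans (congrArg Neg.neg h1.symm) ?_
  refine Eq.trans ?_ (congrArg (Γmap ((curvLift (inertia G)).f 1)) hz'.symm)
  exact (map_neg (Γmap ((curvLift (inertia G)).f 1)) _).symm

variable {K : EtaleGroupoid.{u}}

/-- The holonomy of the class of a gerbe is the class of its holonomy line bundle. -/
lemma represents_holo (φ : EtaleFunctor K G) (𝒢 : GerbeConn K) (x : HH 2 (Cx G 3))
    (hx : 𝒢.Represents φ x) : 𝒢.lineBundle.Represents φ.inertia (D.holo x) := by
  obtain ⟨t, c₁, c₀, rfl, e₀, e₁, e₂⟩ := (GerbeConn.represents_iff φ 𝒢 x).1 hx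
  obtain ⟨z', hz'⟩ := D.exists_cocycle_op t
  obtain ⟨c₁', c₀', e₀', e₁', e₂'⟩ := D.exists_restricted_cochain (𝒢.δ₁_secA φ).symm
    (𝒢.δ₀_secB φ).symm e₀ e₁ e₂
  obtain ⟨c, f₀, f₁⟩ := D.exists_looped_cochain e₀' e₁' e₂'
  let L := 𝒢.lineBundle
  let ρ : Sec φ.inertia.E₁ ((Cx (inertia G) 3).X 0) := Sec.ofUnits (E := φ.inertia.E₁) L.ρ
  let α : Sec φ.inertia.E₀ ((Cx (inertia G) 3).X 1) :=
    Sec.ofForm (E := φ.inertia.E₀) (p := 1) L.conn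
  have hρ : Sec.map ((Cx (inertia G) 3).d 0 1) ρ = φ.inertia.δ₀ α :=
    (map_Cx_three_d_zero (E := φ.inertia.E₁) L.ρ).trans
      ((congrArg (Sec.ofForm (E := φ.inertia.E₁) (p := 1)) L.δconn.symm).trans
        (φ.inertia.δ₀_ofForm (p := 1) L.conn).symm)
  have hα : Sec.map ((Cx (inertia G) 3).d 1 2) α = 0 :=
    (map_Cx_three_d_one (E := φ.inertia.E₀) L.conn).trans
      ((congrArg (Sec.ofForm (E := φ.inertia.E₀) (p := 2)) 𝒢.d_lineBundle_conn).trans (map_zero _))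
  have g₀ : Sec.map (D.m.f 0) ρ = φ.inertia.δ₀ c :=
    (congrArg (Sec.map (D.m.f 0)) (φ.res_over_units 𝒢.h).symm).trans f₀
  have g₁ : Sec.map (D.m.f 1) α = _ :=
    (congrArg (Sec.map (D.m.f 1)) (φ.res_over_forms 𝒢.A).symm).trans f₁
  obtain ⟨c', k₀, k₁⟩ := D.exists_truncated_cochain hρ hα g₀ g₁
  refine (LineBundleConn.represents_iff φ.inertia L _).2
    ⟨z', c', (D.holo_homologyπ t z' hz').symm, k₀, k₁.trans ?_⟩
  refine congrArg (· + _) ((map_neg (Sec.map (D.S.f 1)) _).trans ?_)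
  exact (D.ofInv_op φ.inertia.E₀ 1 (cocycleInv t)).symm.trans
    (congrArg (Sec.ofInv φ.inertia.E₀) hz'.symm)

end HolonomyData

end Holonomy

theorem mainTheorem1 (G : EtaleGroupoid.{u}) (hG : G.IsSmooth) (hΛ : (inertia G).IsSmooth) :
    ∃ (holo : HH 2 (Cx G 3) →+ HH 1 (Cx (inertia G) 2))
      (holoD : HH 3 (Deligne G 3) →+ HH 2 (Deligne (inertia G) 2)),
      -- the vertical isomorphisms, and the commutativity of the square
      Function.Bijective (deligneExp G 3 1) ∧
      Function.Bijective (deligneExp (inertia G) 2 0) ∧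
      (∀ y, holo (deligneExp G 3 1 y) = deligneExp (inertia G) 2 0 (holoD y)) ∧
      -- the image consists of flat classes
      (∀ x, HH.map 1 (curvComplex (inertia G)) (holo x) = 0) ∧
      -- the class of a gerbe with connection is sent to that of a flat line bundle with connection
      ∀ (K : EtaleGroupoid.{u}) (_ : K.IsSmooth) (φ : EtaleFunctor K G) (_ : φ.IsMorita)
        (𝒢 : GerbeConn K), (∃! x, 𝒢.Represents φ x) ∧
        ∃ L : LineBundleConn (inertia K),
          (∀ p : K.LoopArr, (L.ρ.1 p).toMul =
            (𝒢.h.1 p.1).toMul / (𝒢.h.1 ⟨(p.snd, p.conj.1), p.src_conj.symm⟩).toMul) ∧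
          L.conn = Form.pull (loopIncl K) 𝒢.A ∧
          Form.d L.conn = 0 ∧
          (∃! y, L.Represents φ.inertia y) ∧
          ∀ x, 𝒢.Represents φ x → L.Represents φ.inertia (holo x) := by
  obtain ⟨D⟩ := nonempty_holonomyData G
  have h₃ := bijective_deligneExp G hG 2 1
  have h₂ := bijective_deligneExp (inertia G) hΛ 1 0
  let e := AddEquiv.ofBijective (deligneExp (inertia G) 2 0) h₂
  refine ⟨D.holo, e.symm.toAddMonoidHom.comp (D.holo.comp (deligneExp G 3 1)), h₃, h₂,
    fun y => (e.apply_symm_apply _).symm, D.curvature_holo, fun K _ φ hφ 𝒢 =>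
      ⟨GerbeConn.existsUnique_represents φ 𝒢 hφ, 𝒢.lineBundle, fun p => rfl, rfl,
        𝒢.d_lineBundle_conn, LineBundleConn.existsUnique_represents φ.inertia _ hφ.inertia,
        D.represents_holo φ 𝒢⟩⟩
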